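/- Fix $d\ge 1$ and a spin $s\in\{\tfrac12,1,\tfrac32,\dots\}$. Let $I=\{+,z,-\}$ with conjugation $\bar\pm=\mp$, $\bar z=z$, and let $\tilde\epsilon_{ijk}$ be given by $\tilde\epsilon_{\pm\mp z}=\pm1$, $\tilde\epsilon_{\pm z\pm}=\mp1$, $\tilde\epsilon_{z\pm\pm}=\pm1$ and $\tilde\epsilon_{ijk}=0$ otherwise. For $p\ge 0$ let $\mathscr B^{(p)}$ be the set of continuous $f:\mathbb R^{pd}\to\mathbb C^{3^p}$, $f=(f_{i_1\dots i_p})$, that are invariant under simultaneous permutations of the indices and of the arguments. For $h>0$ put $$\|f\|_1^{(h)}=h^{pd}\sum_{i_1,\dots,i_p\in I}\ \sum_{x_1,\dots,x_p\in h\mathbb Z^d}|f_{i_1\dots i_p}(x_1,\dots,x_p)|,$$ $$\|f\|_{\infty,1}^{(h)}=\sup_{x\in h\mathbb Z^d}\ \sum_{i_1,\dots,i_p\in I}h^{(p-1)d}\sum_{x_2,\dots,x_p\in h\mathbb Z^d}|f_{i_1\dots i_p}(x,x_2,\dots,x_p)|\qquad(p\ge1).$$ **Classical system.** For $\Lambda\subset\mathbb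 R^d$ open and bounded let $\Xi_\Lambda=\{M\in L^\infty(\Lambda;\mathbb R^3):\|M\|_\infty\le1\}$, $M_\pm=(M_1\pm iM_2)/\sqrt2$, $M_z=M_3$, and $$M_\Lambda(f)=\sum_{i_1,\dots,i_p}\int_{\Lambda^p}f_{i_1\dots i_p}(x_1,\dots,x_p)\,M_{i_1}(x_1)\cdots M_{i_p}(x_p)\,dx_1\cdots dx_p .$$ Let $\mathfrak P_\Lambda$ be the algebra of functions on $\Xi_\Lambda$ generated by the $M_\Lambda(f)$ with $f\in\mathscr B^{(p)}$, $p\ge 0$, and $\limsup_{h\to0}\|f\|_1^{(h)}<\infty$; its elements are the finite sums $A=\sum_pM_\Lambda(f^{(p)})$ of such functions. Write $\|A\|_\infty=\sup_{M\in\Xi_\Lambda}|A(M)|$. Let $V=(V^{(n)})_{n\ge1}$, $V^{(n)}\in\mathscr B^{(n)}$, satisfy $\overline{V^{(n)}_{i_1\dots i_n}}=V^{(n)}_{\bar i_1\dots\bar i_n}$ and $$\limsup_{h\to0}\ \sum_{n\ge1}n\,e^n\,\|V^{(n)}\|_{\infty,1}^{(h)}<\infty .$$ **Quantum system.** For $h>0$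 let $\Lambda^{(h)}=h\mathbb Z^d\cap\Lambda$ and, on $\bigotimes_{x\in\Lambda^{(h)}}\mathbb C^{2s+1}$, let $\hat S_1(x),\hat S_2(x),\hat S_3(x)$ be the generators of the spin-$s$ representation of $\mathfrak{su}(2)$ at the site $x$, multiplied by $h^d/s$; put $\hat S_\pm=(\hat S_1\pm i\hat S_2)/\sqrt2$, $\hat S_z=\hat S_3$. Let $:\,\cdot\,:$ denote normal ordering (factors $\hat S_+$ to the left of factors $\hat S_z$, and these to the left of factors $\hat S_-$). The quantization of $M_\Lambda(f)$ is $$\widehat{M_\Lambda(f)}=\sum_{i_1,\dots,i_p}\ \sum_{x_1,\dots,x_p\in\Lambda^{(h)}}f_{i_1\dots i_p}(x_1,\dots,x_p):\hat S_{i_1}(x_1)\cdots\hat S_{i_p}(x_p):\,,$$ extended by linearity, so that for $A=\sum_p M_\Lambda(f^{(p)})$ one has $\hat A=\sum_p\widehat{M_\Lambda(f^{(p)})}$. Put $\hat H_\Lambda=\sum_{n\ge1}\widehat{M_\Lambda(V^{(n)})}$ and $$\hat\alpha_\Lambda^t\mathcal A=U^*\mathcal A\,U,\qquad U=e^{-ish^{-d}t\hat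 H_\Lambda}.$$ **Theorem.** There is $h_0>0$ (depending only on $d,s,V$) such that, for every open bounded $\Lambda\subset\mathbb R^d$ and every $0<h<h_0$, the series for $\hat H_\Lambda$ converges, and the following holds. Let functions $f^{(0)},\dots,f^{(D)}$ with $f^{(p)}\in\mathscr B^{(p)}$ and $\limsup_{h\to0}\|f^{(p)}\|_1^{(h)}<\infty$ define $A=\sum_{p\le D}M_\Lambda(f^{(p)})\in\mathfrak P_\Lambda$ for all $\Lambda$, and let $\epsilon>0$. Then there are constants $C(\epsilon,t,A)$, $t\in\mathbb R$, independent of $\Lambda$ and $h$, such that for every open bounded $\Lambda\subset\mathbb R^d$: 1. for every $M_0\in\Xi_\Lambda$ the Hamiltonian (nonlocal Landau–Lifshitz) equation $$\tfrac{d}{dt}M_i(t,x)=i\sum_{n\ge1}n\sum_{i_1,\dots,i_n,j\in I}\int_{\Lambda^{n-1}}V^{(n)}_{i_1\dots i_n}(x,x_2,\dots,x_n)\,\tilde\epsilon_{i_1ij}\,M_j(t,x)\,M_{i_2}(t,x_2)\cdots M_{i_n}(t,x_n)\,dx_2\cdots dx_n$$ has a unique solution $M\in C^1(\mathbb R,\Xi_\Lambda)$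 with $M(0)=M_0$; it defines the flow $\phi^t_\Lambda(M_0)=M(t)$, and we write $\alpha^t_\Lambda A=A\circ\phi^t_\Lambda$; 2. there are $A(t)\in\mathfrak P_\Lambda$, $t\in\mathbb R$, not depending on $h$, such that $$\sup_{t\in\mathbb R}\|\alpha_\Lambda^tA-A(t)\|_\infty\le\epsilon,\qquad \|\hat\alpha_\Lambda^t\hat A-\widehat{A(t)}\|\le\epsilon+C(\epsilon,t,A)\,h^d\quad\text{for all }t\in\mathbb R,\ 0<h<h_0 ,$$ where the last norm is the operator norm. -/

import Mathlib

open MeasureTheory Filter Topology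
open scoped ENNReal NNReal Matrix Matrix.Norms.L2Operator

noncomputable section

namespace SpinEgorov

/-! ## Ladder indices, smearing functions and their norms -/

/-- The index set `I = {+, z, -}` of ladder components. -/
inductive Idx where
  | plus
  | z
  | minus
  deriving DecidableEq

instance : Fintype Idx :=
  ⟨{Idx.plus, Idx.z, Idx.minus}, fun x => by cases x <;> simp⟩

/-- The conjugation `(+, z, -) ↦ (-, z, +)` on `I`. -/
def Idx.conj : Idx → Idx
  | .plus => .minus
  | .z => .z
  | .minus => .plus

/-- The structure constants `ε̃_{ijk}` of the ladder representation. -/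
def eps : Idx → Idx → Idx → ℂ
  | .plus, .minus, .z => 1
  | .minus, .plus, .z => -1
  | .plus, .z, .plus => -1
  | .minus, .z, .minus => 1
  | .z, .plus, .plus => 1
  | .z, .minus, .minus => -1
  | _, _, _ => 0

/-- Points of `ℝ^d`. Only the topology, the bounded sets and Lebesgue measure are used, and
these do not depend on the choice of the norm. -/
abbrev Pt (d : ℕ) : Type := Fin d → ℝ

/-- The point `h k` of the lattice `h ℤ^d`. -/
def latticePt {d : ℕ} (h : ℝ) (k : Fin d → ℤ) : Pt d := fun a => h * (k a : ℝ)

/-- The space `𝓑^(p)`: continuous functions `ℝ^{pd} → ℂ^{3^p}`, symmetric under simultaneous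
permutation of the indices and of the points. -/
structure Smearing (d p : ℕ) where
  toFun : (Fin p → Idx) → (Fin p → Pt d) → ℂ
  continuous_toFun : ∀ i, Continuous (toFun i)
  symm : ∀ (σ : Equiv.Perm (Fin p)) (i : Fin p → Idx) (x : Fin p → Pt d),
    toFun (i ∘ σ) (x ∘ σ) = toFun i x

/-- The lattice norm `‖f‖_1^{(h)}`, with values in `[0, ∞]`. -/
def norm1 {d p : ℕ} (h : ℝ) (f : Smearing d p) : ℝ≥0∞ :=
  ENNReal.ofReal (h ^ (p * d)) *
    ∑ i : Fin p → Idx, ∑' k : Fin p → Fin d → ℤ, ‖f.toFun i (fun a => latticePt h (k a))‖ₑ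

/-- The lattice norm `‖f‖_{∞,1}^{(h)}` on `𝓑^(m+1)`, with values in `[0, ∞]`. The first point
runs over the lattice (like the others); the supremum over `ℝ^d` is at least as large. -/
def normSup1 {d m : ℕ} (h : ℝ) (f : Smearing d (m + 1)) : ℝ≥0∞ :=
  ⨆ k₁ : Fin d → ℤ, ∑ i : Fin (m + 1) → Idx, ENNReal.ofReal (h ^ (m * d)) *
    ∑' k : Fin m → Fin d → ℤ,
      ‖f.toFun i (Fin.cons (latticePt h k₁) (fun a => latticePt h (k a)))‖ₑ

/-- The condition `limsup_{h → 0} ‖f‖_1^{(h)} < ∞`. -/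
def Smearing.IsSummable {d p : ℕ} (f : Smearing d p) : Prop :=
  limsup (fun h : ℝ => norm1 h f) (𝓝[>] 0) < ⊤

/-- A family of interactions `(V^(n))_{n ≥ 1}`; `V m` is `V^(m+1) ∈ 𝓑^(m+1)`. -/
abbrev Interaction (d : ℕ) : Type := (m : ℕ) → Smearing d (m + 1)

/-- The reality condition on the interaction. -/
def Interaction.IsReal {d : ℕ} (V : Interaction d) : Prop :=
  ∀ (m : ℕ) (i : Fin (m + 1) → Idx) (x : Fin (m + 1) → Pt d),
    (starRingEnd ℂ) ((V m).toFun i x) = (V m).toFun (fun a => (i a).conj) x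

/-- `‖V‖^{(h)} = ∑_{n ≥ 1} n e^n ‖V^(n)‖_{∞,1}^{(h)}`. -/
def Interaction.normAt {d : ℕ} (V : Interaction d) (h : ℝ) : ℝ≥0∞ :=
  ∑' m : ℕ, ENNReal.ofReal (((m : ℝ) + 1) * Real.exp ((m : ℝ) + 1)) * normSup1 h (V m)

/-- The condition `‖V‖ = limsup_{h → 0} ‖V‖^{(h)} < ∞`. -/
def Interaction.IsBounded {d : ℕ} (V : Interaction d) : Prop :=
  limsup (fun h : ℝ => V.normAt h) (𝓝[>] 0) < ⊤

/-! ## The classical continuum spin system -/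

/-- `L^∞(Λ; ℝ³)`, where `ℝ³` carries the Euclidean norm. -/
abbrev SpinField {d : ℕ} (Λ : Set (Pt d)) : Type :=
  Lp (EuclideanSpace ℝ (Fin 3)) ∞ ((volume : Measure (Pt d)).restrict Λ)

/-- The phase space `Ξ_Λ`, the closed unit ball of `L^∞(Λ; ℝ³)`. -/
abbrev Phase {d : ℕ} (Λ : Set (Pt d)) : Type := {M : SpinField Λ // ‖M‖ ≤ 1}

/-- The complex components `M_± = (M_1 ± i M_2) / √2`, `M_z = M_3`. -/
def ladder (v : EuclideanSpace ℝ (Fin 3)) : Idx → ℂ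
  | .plus => ((v 0 : ℂ) + Complex.I * (v 1 : ℂ)) / (Real.sqrt 2 : ℂ)
  | .z => (v 2 : ℂ)
  | .minus => ((v 0 : ℂ) - Complex.I * (v 1 : ℂ)) / (Real.sqrt 2 : ℂ)

/-- Lebesgue measure on `Λ^p`. -/
def powMeasure {d : ℕ} (Λ : Set (Pt d)) (p : ℕ) : Measure (Fin p → Pt d) :=
  Measure.pi fun _ => (volume : Measure (Pt d)).restrict Λ

/-- The function `M_Λ(f)` on phase space. -/
def classicalMonomial {d p : ℕ} (Λ : Set (Pt d)) (f : Smearing d p) (M : Phase Λ) : ℂ :=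
  ∑ i : Fin p → Idx,
    ∫ x, f.toFun i x * ∏ a, ladder ((M : SpinField Λ) (x a)) (i a) ∂(powMeasure Λ p)

/-- The right-hand side of the (nonlocal Landau-Lifshitz) Hamiltonian equation of motion for
the component `M_i` at the point `x`. -/
def llField {d : ℕ} (V : Interaction d) (Λ : Set (Pt d)) (M : SpinField Λ) (x : Pt d)
    (i : Idx) : ℂ :=
  Complex.I * ∑' m : ℕ, ((m : ℂ) + 1) * ∑ l : Fin (m + 1) → Idx, ∑ j : Idx,
    ∫ y, (V m).toFun l (Fin.cons x y) * eps (l 0) i j * ladder (M x) j *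
      ∏ a : Fin m, ladder (M (y a)) (l a.succ) ∂(powMeasure Λ m)

/-- `M ∈ C¹(ℝ, Ξ_Λ)` solves the Hamiltonian equation of motion. -/
def IsSolution {d : ℕ} (V : Interaction d) (Λ : Set (Pt d)) (M : ℝ → Phase Λ) : Prop :=
  ContDiff ℝ 1 (fun t => (M t : SpinField Λ)) ∧
  ∀ t : ℝ, ∀ᵐ x ∂((volume : Measure (Pt d)).restrict Λ), ∀ i : Idx,
    ladder ((deriv (fun r => (M r : SpinField Λ)) t : SpinField Λ) x) i =
      llField V Λ (M t : SpinField Λ) x i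

/-- `φ` is the Hamiltonian flow: `t ↦ φ t M₀` is the one and only solution starting at `M₀`. -/
def IsHamiltonianFlow {d : ℕ} (V : Interaction d) (Λ : Set (Pt d))
    (φ : ℝ → Phase Λ → Phase Λ) : Prop :=
  ∀ M₀ : Phase Λ, φ 0 M₀ = M₀ ∧ IsSolution V Λ (fun t => φ t M₀) ∧
    ∀ M : ℝ → Phase Λ, IsSolution V Λ M → M 0 = M₀ → M = fun t => φ t M₀

/-! ## The quantum spin system -/

open Classical in
/-- The finite lattice `Λ^{(h)} = h ℤ^d ∩ Λ`, whose site `h k` is labelled by `k ∈ ℤ^d`. -/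
def sites {d : ℕ} (h : ℝ) (Λ : Set (Pt d)) : Finset (Fin d → ℤ) :=
  if hfin : {k : Fin d → ℤ | latticePt h k ∈ Λ}.Finite then hfin.toFinset else ∅

/-- Operators on `⨂_{x ∈ X} ℂ^{N+1}`, as matrices in the product basis, which is labelled by
the configurations `X → {0, …, N}`. They carry the operator norm of the Hilbert space. -/
abbrev Op {d : ℕ} (N : ℕ) (X : Finset (Fin d → ℤ)) : Type :=
  Matrix (X → Fin (N + 1)) (X → Fin (N + 1)) ℂ

/-- The ladder matrices `(J_1 ± i J_2) / √2` and `J_3` of the spin-`N/2` representation of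
`su(2)` on `ℂ^{N+1}`, in the basis of eigenvectors of `J_3`, where the `k`-th one has
eigenvalue `N/2 - k`. -/
def spinMatrix (N : ℕ) : Idx → Matrix (Fin (N + 1)) (Fin (N + 1)) ℂ
  | .plus => Matrix.of fun j k =>
      if (j : ℕ) + 1 = k then ((Real.sqrt ((k : ℝ) * ((N : ℝ) + 1 - k)) / Real.sqrt 2 : ℝ) : ℂ)
      else 0
  | .z => Matrix.diagonal fun k => (N : ℂ) / 2 - ((k : ℕ) : ℂ)
  | .minus => Matrix.of fun j k =>
      if (k : ℕ) + 1 = j then ((Real.sqrt ((j : ℝ) * ((N : ℝ) + 1 - j)) / Real.sqrt 2 : ℝ) : ℂ)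
      else 0

/-- The one-site operator `a` acting on the tensor factor at the site `x`. -/
def siteOp {d N : ℕ} {X : Finset (Fin d → ℤ)} (x : X)
    (a : Matrix (Fin (N + 1)) (Fin (N + 1)) ℂ) : Op N X :=
  Matrix.of fun σ τ => if ∀ y, y ≠ x → σ y = τ y then a (σ x) (τ x) else 0

/-- The spin operators `Ŝ_i(x)`, rescaled by `h^d / s` with `s = N/2`. -/
def spinOp {d N : ℕ} {X : Finset (Fin d → ℤ)} (h : ℝ) (i : Idx) (x : X) : Op N X :=
  ((h ^ d / ((N : ℝ) / 2) : ℝ) : ℂ) • siteOp x (spinMatrix N i)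

/-- The normal-ordered product `:Ŝ_{i_1}(x_1) ⋯ Ŝ_{i_p}(x_p):`, that is, first the factors with
index `+`, then those with index `z`, then those with index `-` (factors with the same index
commute). -/
def normalOrdered {d N p : ℕ} {X : Finset (Fin d → ℤ)} (h : ℝ) (i : Fin p → Idx)
    (x : Fin p → X) : Op N X :=
  let part : Idx → Op N X := fun j =>
    (((List.finRange p).filter fun a => i a = j).map fun a => spinOp h (i a) (x a)).prod
  part .plus * part .z * part .minus

/-- The normal-ordered smeared operator `:Ŝ_Λ(f):`, the quantization of `M_Λ(f)`. -/
def quantumMonomial {d p : ℕ} (N : ℕ) (h : ℝ) (Λ : Set (Pt d)) (f : Smearing d p) :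
    Op N (sites h Λ) :=
  ∑ i : Fin p → Idx, ∑ x : Fin p → sites h Λ,
    f.toFun i (fun a => latticePt h (x a : Fin d → ℤ)) • normalOrdered h i x

/-- The Hamiltonian `Ĥ_Λ`, quantized term by term. -/
def hamiltonian {d : ℕ} (N : ℕ) (h : ℝ) (V : Interaction d) (Λ : Set (Pt d)) :
    Op N (sites h Λ) :=
  ∑' m : ℕ, quantumMonomial N h Λ (V m)

/-- The propagator `exp(-i s h^{-d} t Ĥ_Λ)`, with `s = N/2`. -/
def propagator {d : ℕ} (N : ℕ) (h : ℝ) (V : Interaction d) (Λ : Set (Pt d)) (t : ℝ) :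
    Op N (sites h Λ) :=
  NormedSpace.exp ((-Complex.I * (((N : ℝ) / 2 * (h ^ d)⁻¹ * t : ℝ) : ℂ)) •
    hamiltonian N h V Λ)

/-- The quantum (Heisenberg) time evolution `𝒜 ↦ U(t)^* 𝒜 U(t)`. -/
def quantumEvolution {d : ℕ} (N : ℕ) (h : ℝ) (V : Interaction d) (Λ : Set (Pt d)) (t : ℝ)
    (B : Op N (sites h Λ)) : Op N (sites h Λ) :=
  (propagator N h V Λ t)ᴴ * B * propagator N h V Λ t

/-! ## Polynomial observables -/

/-- The data `f^(0), …, f^(D)` of a polynomial observable `∑_p M_Λ(f^(p))`. Since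
`M_Λ(f) M_Λ(g) = M_Λ(P(f ⊗ g))` and constants are the `M_Λ(f)` with `p = 0`, the functions
`F.classical Λ` are exactly the elements of the algebra `𝔓_Λ` generated by the `M_Λ(f)`. -/
structure Observable (d : ℕ) where
  deg : ℕ
  comp : (p : Fin (deg + 1)) → Smearing d p
  isSummable : ∀ p, (comp p).IsSummable

/-- The element `∑_p M_Λ(f^(p))` of `𝔓_Λ`, a function on phase space. -/
def Observable.classical {d : ℕ} (F : Observable d) (Λ : Set (Pt d)) (M : Phase Λ) : ℂ :=
  ∑ p, classicalMonomial Λ (F.comp p) M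

/-- Its quantization `∑_p :Ŝ_Λ(f^(p)):`. -/
def Observable.quantum {d : ℕ} (F : Observable d) (N : ℕ) (h : ℝ) (Λ : Set (Pt d)) :
    Op N (sites h Λ) :=
  ∑ p, quantumMonomial N h Λ (F.comp p)

/-- For bounded `Λ` and `h > 0`, the finite set `sites h Λ` really is `h ℤ^d ∩ Λ`. -/
theorem mem_sites {d : ℕ} {h : ℝ} (hh : 0 < h) {Λ : Set (Pt d)} (hΛ : Bornology.IsBounded Λ)
    (k : Fin d → ℤ) : k ∈ sites h Λ ↔ latticePt h k ∈ Λ := by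
  have hfin : {k : Fin d → ℤ | latticePt h k ∈ Λ}.Finite := by
    obtain ⟨R, hR⟩ := hΛ.exists_norm_le
    refine (Set.Finite.pi' (t := fun _ : Fin d => Set.Icc (-⌈R / h⌉) ⌈R / h⌉)
      fun _ => Set.finite_Icc _ _).subset ?_
    intro k hk a
    have h1 : ‖latticePt h k a‖ ≤ R := (norm_le_pi_norm _ a).trans (hR _ hk)
    have h2 : |(k a : ℝ)| ≤ R / h := by
      rw [le_div_iff₀ hh]
      simpa [latticePt, abs_mul, abs_of_pos hh, mul_comm] using h1
    have h3 := h2.trans (Int.le_ceil (R / h))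
    have h4 : |k a| ≤ ⌈R / h⌉ := by exact_mod_cast h3
    exact abs_le.mp h4
  simp [sites, hfin]

end SpinEgorov

end

open MeasureTheory Filter Topology
open scoped ENNReal NNReal Matrix Matrix.Norms.L2Operator

noncomputable section

set_option linter.unusedSectionVars false

namespace SpinEgorov

/-! ## Operators on the product of sites -/

section Tensor

variable {d N : ℕ} {X : Finset (Fin d → ℤ)}

/-- One-site matrices. -/
abbrev SiteMat (N : ℕ) : Type := Matrix (Fin (N + 1)) (Fin (N + 1)) ℂ

/-- The tensor product of a family of one-site matrices. -/
def tensorOp (w : X → SiteMat N) : Op N X :=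
  Matrix.of fun σ τ => ∏ x, w x (σ x) (τ x)

theorem tensorOp_one : tensorOp (1 : X → SiteMat N) = 1 := by
  ext σ τ
  simp only [tensorOp, Matrix.of_apply, Pi.one_apply, Matrix.one_apply, Finset.prod_ite_zero,
    Finset.prod_const_one]
  simp [funext_iff]

theorem tensorOp_mul (v w : X → SiteMat N) :
    tensorOp (v * w) = tensorOp v * tensorOp w := by
  ext σ τ
  simp only [tensorOp, Matrix.of_apply, Pi.mul_apply, Matrix.mul_apply]
  rw [Finset.prod_univ_sum, Fintype.piFinset_univ]
  simp [Finset.prod_mul_distrib]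

theorem siteOp_eq_tensorOp (x : X) (a : SiteMat N) :
    siteOp x a = tensorOp (Pi.mulSingle x a) := by
  ext σ τ
  simp only [siteOp, tensorOp, Matrix.of_apply]
  rw [← Finset.mul_prod_erase _ _ (Finset.mem_univ x)]
  have h : ∏ y ∈ Finset.univ.erase x, (Pi.mulSingle x a : X → SiteMat N) y (σ y) (τ y) =
      if ∀ y, y ≠ x → σ y = τ y then 1 else 0 := by
    rw [Finset.prod_congr rfl (g := fun y => if σ y = τ y then (1 : ℂ) else 0)]
    · rw [Finset.prod_ite_zero]
      simp
    · intro y hy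
      rw [Pi.mulSingle_eq_of_ne (Finset.ne_of_mem_erase hy), Matrix.one_apply]
  rw [h, Pi.mulSingle_eq_same]
  split_ifs <;> simp

theorem siteOp_mul (x : X) (a b : SiteMat N) :
    siteOp x (a * b) = siteOp x a * siteOp x b := by
  rw [siteOp_eq_tensorOp, siteOp_eq_tensorOp, siteOp_eq_tensorOp, ← tensorOp_mul,
    Pi.mulSingle_mul]

theorem siteOp_one (x : X) : siteOp x (1 : SiteMat N) = 1 := by
  rw [siteOp_eq_tensorOp, Pi.mulSingle_one, tensorOp_one]

theorem siteOp_add (x : X) (a b : SiteMat N) :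
    siteOp x (a + b) = siteOp x a + siteOp x b := by
  ext σ τ
  simp only [siteOp, Matrix.of_apply, Matrix.add_apply]
  split_ifs <;> simp

theorem siteOp_smul (x : X) (c : ℂ) (a : SiteMat N) :
    siteOp x (c • a) = c • siteOp x a := by
  ext σ τ
  simp only [siteOp, Matrix.of_apply, Matrix.smul_apply]
  split_ifs <;> simp

theorem siteOp_zero (x : X) : siteOp x (0 : SiteMat N) = 0 := by
  simpa using siteOp_smul x 0 (0 : SiteMat N)

theorem siteOp_conjTranspose (x : X) (a : SiteMat N) : siteOp x aᴴ = (siteOp x a)ᴴ := by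
  ext σ τ
  simp only [siteOp, Matrix.of_apply, Matrix.conjTranspose_apply]
  by_cases h : ∀ y, y ≠ x → σ y = τ y
  · rw [if_pos h, if_pos fun y hy => (h y hy).symm]
  · rw [if_neg h, if_neg fun h' => h fun y hy => (h' y hy).symm, star_zero]

/-- The embedding of the one-site algebra. -/
def siteHom (x : X) : SiteMat N →⋆ₐ[ℂ] Op N X where
  toFun := siteOp x
  map_one' := siteOp_one x
  map_mul' := siteOp_mul x
  map_zero' := siteOp_zero x
  map_add' := siteOp_add x
  commutes' c := by
    rw [Algebra.algebraMap_eq_smul_one, Algebra.algebraMap_eq_smul_one, siteOp_smul, siteOp_one]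
  map_star' a := siteOp_conjTranspose x a

theorem norm_siteOp_le (x : X) (a : SiteMat N) : ‖siteOp x a‖ ≤ ‖a‖ := by
  let _ : CStarAlgebra (SiteMat N) := Matrix.instCStarAlgebra
  let _ : CStarAlgebra (Op N X) := Matrix.instCStarAlgebra
  exact NonUnitalStarAlgHom.norm_apply_le (F := SiteMat N →⋆ₐ[ℂ] Op N X) (siteHom x) a

theorem siteOp_commute {x y : X} (hxy : x ≠ y) (a b : SiteMat N) :
    Commute (siteOp x a) (siteOp y b) := by
  rw [Commute, SemiconjBy, siteOp_eq_tensorOp, siteOp_eq_tensorOp, ← tensorOp_mul, ← tensorOp_mul]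
  exact congrArg tensorOp (Pi.mulSingle_commute (f := fun _ : X => SiteMat N) hxy a b)

theorem norm_tensorOp_le (w : X → SiteMat N) : ‖tensorOp w‖ ≤ ∏ x, ‖w x‖ := by
  have h : ∀ s : Finset X, ‖tensorOp (fun x => if x ∈ s then w x else 1)‖ ≤ ∏ x ∈ s, ‖w x‖ := by
    intro s
    induction s using Finset.induction_on with
    | empty =>
      have : (fun x => if x ∈ (∅ : Finset X) then w x else 1) = (1 : X → SiteMat N) := by
        ext1 x; simp
      rw [this, tensorOp_one, Finset.prod_empty]
      exact CStarRing.norm_one.le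
    | insert a s ha ih =>
      have : (fun x => if x ∈ insert a s then w x else 1) =
          Pi.mulSingle a (w a) * (fun x => if x ∈ s then w x else 1) := by
        ext1 x
        by_cases hx : x = a
        · subst hx; simp [ha]
        · simp [hx]
      rw [this, tensorOp_mul, ← siteOp_eq_tensorOp, Finset.prod_insert ha]
      exact (norm_mul_le _ _).trans (mul_le_mul (norm_siteOp_le _ _) ih (norm_nonneg _)
        (norm_nonneg _))
  simpa using h Finset.univ

theorem list_prod_siteOp {α : Type*} (l : List α) (x : α → X) (a : α → SiteMat N) :
    (l.map fun c => siteOp (x c) (a c)).prod =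
      tensorOp fun k => ((l.filter fun c => x c = k).map a).prod := by
  induction l with
  | nil => exact tensorOp_one.symm
  | cons c l ih =>
    rw [List.map_cons, List.prod_cons, ih, siteOp_eq_tensorOp, ← tensorOp_mul]
    congr 1
    ext1 k
    by_cases h : x c = k
    · subst h; simp
    · simp [Ne.symm h, h]

instance : NormOneClass (Op N X) := ⟨CStarRing.norm_one⟩

end Tensor

section Spin

variable {N : ℕ}

theorem spinMatrix_conjTranspose (i : Idx) : (spinMatrix N i)ᴴ = spinMatrix N i.conj := by
  ext j k
  cases i
  · simp only [spinMatrix, Idx.conj, Matrix.conjTranspose_apply, Matrix.of_apply]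
    split_ifs <;> simp
  · simp only [spinMatrix, Idx.conj, Matrix.conjTranspose_apply, Matrix.diagonal_apply]
    by_cases h : k = j
    · subst h; simp
    · simp [h, Ne.symm h]
  · simp only [spinMatrix, Idx.conj, Matrix.conjTranspose_apply, Matrix.of_apply]
    split_ifs <;> simp

theorem sum_Idx {M : Type*} [AddCommMonoid M] (f : Idx → M) :
    ∑ k, f k = f .plus + f .z + f .minus := by
  have : (Finset.univ : Finset Idx) = {Idx.plus, Idx.z, Idx.minus} := rfl
  rw [this, Finset.sum_insert (by decide), Finset.sum_insert (by decide), Finset.sum_singleton,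
    add_assoc]

theorem sqrt_mul_sqrt_half {x : ℝ} (hx : 0 ≤ x) :
    ((Real.sqrt x / Real.sqrt 2 : ℝ) : ℂ) * ((Real.sqrt x / Real.sqrt 2 : ℝ) : ℂ) =
      ((x / 2 : ℝ) : ℂ) := by
  rw [← Complex.ofReal_mul, div_mul_div_comm, Real.mul_self_sqrt hx,
    Real.mul_self_sqrt (by norm_num)]

theorem spinMatrix_minus_mul_plus :
    spinMatrix N .minus * spinMatrix N .plus =
      Matrix.diagonal fun k : Fin (N + 1) =>
        ((((k : ℕ) : ℝ) * ((N : ℝ) + 1 - ((k : ℕ) : ℝ)) / 2 : ℝ) : ℂ) := by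
  ext j k
  simp only [spinMatrix, Matrix.mul_apply, Matrix.of_apply, Matrix.diagonal_apply]
  have hk : ((k : ℕ) : ℝ) ≤ N := by exact_mod_cast Nat.lt_succ_iff.mp k.2
  have hk0 : (0 : ℝ) ≤ ((k : ℕ) : ℝ) * ((N : ℝ) + 1 - ((k : ℕ) : ℝ)) :=
    mul_nonneg (Nat.cast_nonneg _) (by linarith)
  by_cases hjk : j = k
  · subst hjk
    rw [if_pos rfl]
    by_cases hj : (j : ℕ) = 0
    · rw [Finset.sum_eq_zero]
      · simp [hj]
      · intro l _
        rw [if_neg (by omega), zero_mul]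
    · rw [Finset.sum_eq_single (⟨(j : ℕ) - 1, by omega⟩ : Fin (N + 1))]
      · rw [if_pos (by simp; omega), sqrt_mul_sqrt_half hk0]
      · intro l _ hl
        rw [if_neg, zero_mul]
        intro h
        exact hl (Fin.ext (by simp; omega))
      · simp
  · rw [if_neg hjk, Finset.sum_eq_zero]
    intro l _
    by_cases h : (l : ℕ) + 1 = j
    · rw [if_neg (c := (l : ℕ) + 1 = k) (fun h' => hjk (Fin.ext (by omega))), mul_zero]
    · rw [if_neg h, zero_mul]

theorem spinMatrix_plus_mul_minus :
    spinMatrix N .plus * spinMatrix N .minus =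
      Matrix.diagonal fun k : Fin (N + 1) =>
        (((((k : ℕ) : ℝ) + 1) * ((N : ℝ) - ((k : ℕ) : ℝ)) / 2 : ℝ) : ℂ) := by
  ext j k
  simp only [spinMatrix, Matrix.mul_apply, Matrix.of_apply, Matrix.diagonal_apply]
  by_cases hjk : j = k
  · subst hjk
    rw [if_pos rfl]
    have hk : ((j : ℕ) : ℝ) ≤ N := by exact_mod_cast Nat.lt_succ_iff.mp j.2
    by_cases hj : (j : ℕ) = N
    · rw [Finset.sum_eq_zero]
      · simp [hj]
      · intro l _
        rw [if_neg (by omega), zero_mul]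
    · rw [Finset.sum_eq_single (⟨(j : ℕ) + 1, by omega⟩ : Fin (N + 1))]
      · rw [if_pos (by simp), sqrt_mul_sqrt_half]
        · push_cast
          ring
        · push_cast
          have : (0 : ℝ) ≤ ((j : ℕ) : ℝ) := Nat.cast_nonneg _
          exact mul_nonneg (by linarith) (by linarith)
      · intro l _ hl
        rw [if_neg, zero_mul]
        intro h
        exact hl (Fin.ext (by simp; omega))
      · simp
  · rw [if_neg hjk, Finset.sum_eq_zero]
    intro l _
    by_cases h : (j : ℕ) + 1 = l
    · rw [if_neg (c := (k : ℕ) + 1 = l) (fun h' => hjk (Fin.ext (by omega))), mul_zero]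
    · rw [if_neg h, zero_mul]

theorem spinMatrix_commutator_plus_minus :
    spinMatrix N .plus * spinMatrix N .minus - spinMatrix N .minus * spinMatrix N .plus =
      spinMatrix N .z := by
  rw [spinMatrix_plus_mul_minus, spinMatrix_minus_mul_plus, Matrix.diagonal_sub]
  congr 1
  ext1 k
  push_cast
  ring

theorem spinMatrix_commutator_z_plus :
    spinMatrix N .z * spinMatrix N .plus - spinMatrix N .plus * spinMatrix N .z =
      spinMatrix N .plus := by
  ext j k
  simp only [spinMatrix, Matrix.sub_apply, Matrix.diagonal_mul, Matrix.mul_diagonal,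
    Matrix.of_apply]
  split_ifs with h
  · rw [← h]; push_cast; ring
  · simp

theorem spinMatrix_commutator_z_minus :
    spinMatrix N .z * spinMatrix N .minus - spinMatrix N .minus * spinMatrix N .z =
      -spinMatrix N .minus := by
  ext j k
  simp only [spinMatrix, Matrix.sub_apply, Matrix.diagonal_mul, Matrix.mul_diagonal,
    Matrix.of_apply, Matrix.neg_apply]
  split_ifs with h
  · rw [← h]; push_cast; ring
  · simp

theorem spinMatrix_commutator (i j : Idx) :
    spinMatrix N i * spinMatrix N j - spinMatrix N j * spinMatrix N i =
      ∑ k, eps i j k • spinMatrix N k := by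
  rw [sum_Idx]
  cases i <;> cases j <;> simp only [eps, zero_smul, one_smul, neg_smul, add_zero, zero_add,
    sub_self, spinMatrix_commutator_plus_minus, spinMatrix_commutator_z_plus,
    spinMatrix_commutator_z_minus]
  · rw [← neg_sub, spinMatrix_commutator_z_plus]
  · rw [← neg_sub, spinMatrix_commutator_plus_minus]
  · rw [← neg_sub, spinMatrix_commutator_z_minus, neg_neg]

/-- The spin matrices divided by the spin. -/
def unitSpin (N : ℕ) (i : Idx) : SiteMat N := ((((N : ℝ) / 2)⁻¹ : ℝ) : ℂ) • spinMatrix N i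

theorem norm_spinMatrix_z_le : ‖spinMatrix N .z‖ ≤ (N : ℝ) / 2 := by
  rw [spinMatrix, Matrix.l2_opNorm_diagonal, pi_norm_le_iff_of_nonneg (by positivity)]
  intro k
  have hk : ((k : ℕ) : ℝ) ≤ N := by exact_mod_cast Nat.lt_succ_iff.mp k.2
  have hk0 : (0 : ℝ) ≤ ((k : ℕ) : ℝ) := Nat.cast_nonneg _
  have : (N : ℂ) / 2 - ((k : ℕ) : ℂ) = (((N : ℝ) / 2 - ((k : ℕ) : ℝ) : ℝ) : ℂ) := by push_cast; rfl
  rw [this, Complex.norm_real, Real.norm_eq_abs, abs_le]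
  constructor <;> linarith

theorem norm_spinMatrix_plus_sq_le : ‖spinMatrix N .plus‖ ^ 2 ≤ ((N : ℝ) + 1) ^ 2 / 8 := by
  have h : ‖(spinMatrix N .plus)ᴴ * spinMatrix N .plus‖ = ‖spinMatrix N .plus‖ ^ 2 := by
    rw [sq]; exact CStarRing.norm_star_mul_self
  rw [← h, spinMatrix_conjTranspose, Idx.conj, spinMatrix_minus_mul_plus,
    Matrix.l2_opNorm_diagonal, pi_norm_le_iff_of_nonneg (by positivity)]
  intro k
  have hk : ((k : ℕ) : ℝ) ≤ N := by exact_mod_cast Nat.lt_succ_iff.mp k.2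
  have hk0 : (0 : ℝ) ≤ ((k : ℕ) : ℝ) := Nat.cast_nonneg _
  rw [Complex.norm_real, Real.norm_eq_abs, abs_of_nonneg
    (div_nonneg (mul_nonneg hk0 (by linarith)) (by norm_num))]
  nlinarith [sq_nonneg ((N : ℝ) + 1 - 2 * ((k : ℕ) : ℝ))]

theorem norm_spinMatrix_minus : ‖spinMatrix N .minus‖ = ‖spinMatrix N .plus‖ := by
  have h := spinMatrix_conjTranspose (N := N) .plus
  rw [Idx.conj] at h
  rw [← h, Matrix.l2_opNorm_conjTranspose]

theorem norm_unitSpin_le (hN : 0 < N) (i : Idx) : ‖unitSpin N i‖ ≤ Real.sqrt 2 := by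
  have hN1 : (1 : ℝ) ≤ N := by exact_mod_cast hN
  have hp : ‖spinMatrix N .plus‖ ≤ Real.sqrt 2 * ((N : ℝ) / 2) := by
    refine abs_le_of_sq_le_sq' ?_ (by positivity) |>.2
    refine norm_spinMatrix_plus_sq_le.trans ?_
    rw [mul_pow, Real.sq_sqrt (by norm_num)]
    nlinarith
  have h : ‖spinMatrix N i‖ ≤ Real.sqrt 2 * ((N : ℝ) / 2) := by
    cases i
    · exact hp
    · refine norm_spinMatrix_z_le.trans ?_
      exact le_mul_of_one_le_left (by positivity) (Real.one_le_sqrt.mpr (by norm_num))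
    · rw [norm_spinMatrix_minus]; exact hp
  rw [unitSpin, norm_smul, Complex.norm_real, Real.norm_eq_abs, abs_of_pos (by positivity),
    inv_mul_le_iff₀ (by positivity), mul_comm]
  exact h

end Spin

/-! ## Ordered words -/

section Words

variable {ι ι' : Type*} {B : Type*}

/-- The ordered product of the letters `A c` along a list. -/
def word [Monoid B] (l : List ι) (A : ι → B) : B := (l.map A).prod

@[simp] theorem word_nil [Monoid B] (A : ι → B) : word [] A = 1 := rfl

@[simp] theorem word_cons [Monoid B] (c : ι) (l : List ι) (A : ι → B) :
    word (c :: l) A = A c * word l A := by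
  simp [word]

theorem word_append [Monoid B] (l l' : List ι) (A : ι → B) :
    word (l ++ l') A = word l A * word l' A := by
  simp [word]

theorem word_congr [Monoid B] {l : List ι} {A A' : ι → B} (h : ∀ c ∈ l, A c = A' c) :
    word l A = word l A' := by
  rw [word, word, List.map_congr_left h]

theorem word_map [Monoid B] (l : List ι) (f : ι → ι') (A : ι' → B) :
    word (l.map f) A = word l (A ∘ f) := by
  simp [word]

theorem word_flatMap [Monoid B] (l : List ι) (f : ι → List ι') (A : ι' → B) :
    word (l.flatMap f) A = word l fun c => word (f c) A := by
  induction l with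
  | nil => rfl
  | cons c l ih => rw [List.flatMap_cons, word_append, ih, word_cons]

theorem exists_word_update [Monoid B] [DecidableEq ι] {l : List ι} (hl : l.Nodup) {b : ι}
    (hb : b ∈ l) (A : ι → B) : ∃ P Q : B, ∀ x, word l (Function.update A b x) = P * x * Q := by
  obtain ⟨s, t, rfl⟩ := List.append_of_mem hb
  rw [List.nodup_middle, List.nodup_cons] at hl
  have hs : b ∉ s := fun h => hl.1 (List.mem_append_left _ h)
  have ht : b ∉ t := fun h => hl.1 (List.mem_append_right _ h)
  refine ⟨word s A, word t A, fun x => ?_⟩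
  rw [word_append, word_cons, Function.update_self,
    word_congr (A' := A) (fun c hc => Function.update_of_ne (by rintro rfl; exact hs hc) _ _),
    word_congr (l := t) (A' := A) (fun c hc => Function.update_of_ne (by rintro rfl; exact ht hc) _ _),
    mul_assoc]

theorem norm_word_le [NormedRing B] [NormOneClass B] (l : List ι) {A : ι → B} {r : ℝ}
    (h : ∀ c, ‖A c‖ ≤ r) : ‖word l A‖ ≤ r ^ l.length := by
  induction l with
  | nil => simp
  | cons c l ih =>
    have hr : 0 ≤ r := (norm_nonneg _).trans (h c)
    rw [word_cons, List.length_cons, pow_succ']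
    exact (norm_mul_le _ _).trans (mul_le_mul (h c) ih (norm_nonneg _) hr)

/-- The sum over the positions of a list of the products with one letter replaced. -/
def wordD [Ring B] : List ι → (ι → B) → (ι → B) → B
  | [], _, _ => 0
  | c :: l, A, A' => A' c * word l A + A c * wordD l A A'

theorem wordD_eq_sum [Ring B] [DecidableEq ι] {l : List ι} (hl : l.Nodup) (A A' : ι → B) :
    wordD l A A' = (l.map fun b => word l (Function.update A b (A' b))).sum := by
  induction l with
  | nil => rfl
  | cons c l ih =>
    rw [List.nodup_cons] at hl
    rw [wordD, ih hl.2, List.map_cons, List.sum_cons, word_cons, Function.update_self,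
      word_congr (l := l) (A := Function.update A c (A' c)) (A' := A)
        (fun e he => Function.update_of_ne (by rintro rfl; exact hl.1 he) _ _),
      ← List.sum_map_mul_left]
    congr 2
    refine List.map_congr_left fun b hb => ?_
    rw [word_cons, Function.update_of_ne (a := c) (a' := b) (by rintro rfl; exact hl.1 hb)]

theorem wordD_eq_sum_univ [Ring B] [DecidableEq ι] [Fintype ι] {l : List ι} (hl : l.Nodup)
    (hc : ∀ c, c ∈ l) (A A' : ι → B) :
    wordD l A A' = ∑ b, word l (Function.update A b (A' b)) := by
  rw [wordD_eq_sum hl, ← List.sum_toFinset _ hl]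
  congr 1
  ext b
  simp [hc]

/-- Leibniz rule for the commutator with an ordered product. -/
theorem word_commutator [Ring B] (l : List ι) (A : ι → B) (x : B) :
    word l A * x - x * word l A = wordD l A fun c => A c * x - x * A c := by
  induction l with
  | nil => simp [wordD]
  | cons c l ih => rw [word_cons, wordD, ← ih]; noncomm_ring

/-- The list of positions in normal order: first the `+`, then the `z`, then the `-`. -/
def normalList {p : ℕ} (l : Fin p → Idx) : List (Fin p) :=
  ((List.finRange p).filter fun a => l a = .plus) ++
    ((List.finRange p).filter fun a => l a = .z) ++
    ((List.finRange p).filter fun a => l a = .minus)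

theorem mem_normalList {p : ℕ} (l : Fin p → Idx) (a : Fin p) : a ∈ normalList l := by
  simp only [normalList, List.mem_append, List.mem_filter, List.mem_finRange, true_and,
    decide_eq_true_eq]
  cases l a <;> simp

theorem nodup_normalList {p : ℕ} (l : Fin p → Idx) : (normalList l).Nodup := by
  have h : ∀ i, ((List.finRange p).filter fun a => l a = i).Nodup :=
    fun i => (List.nodup_finRange p).filter _
  have h' : ∀ (i j : Idx), i ≠ j → List.Disjoint ((List.finRange p).filter fun a => l a = i)
      ((List.finRange p).filter fun a => l a = j) := by
    intro i j hij a ha hb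
    simp only [List.mem_filter, List.mem_finRange, true_and, decide_eq_true_eq] at ha hb
    exact hij (ha.symm.trans hb)
  rw [normalList, List.nodup_append', List.nodup_append', List.disjoint_append_left]
  exact ⟨⟨h _, h _, h' _ _ (by decide)⟩, h _, h' _ _ (by decide), h' _ _ (by decide)⟩

theorem normalOrdered_eq_word {d N p : ℕ} {X : Finset (Fin d → ℤ)} (h : ℝ) (l : Fin p → Idx)
    (x : Fin p → X) :
    normalOrdered (N := N) h l x = word (normalList l) fun a => spinOp h (l a) (x a) := by
  rw [normalList, word_append, word_append]
  rfl

end Words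

/-! ## Terms: smeared ordered words -/

/-- A finite sum of smeared ordered products of spins, each with `card ι` factors at the
independent points `x c`, `c : ι`. -/
structure Term (d : ℕ) where
  ι : Type
  κ : Type
  fι : Fintype ι
  dι : DecidableEq ι
  fκ : Fintype κ
  order : κ → List ι
  nodup : ∀ k, (order k).Nodup
  complete : ∀ k c, c ∈ order k
  label : κ → ι → Idx
  kernel : κ → (ι → Pt d) → ℂ
  cont : ∀ k, Continuous (kernel k)

namespace Term

attribute [instance] Term.fι Term.dι Term.fκ

variable {d : ℕ}

/-- The number of points of a term. -/
def deg (T : Term d) : ℕ := Fintype.card T.ι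

theorem length_order (T : Term d) (k : T.κ) : (T.order k).length = T.deg := by
  rw [← List.toFinset_card_of_nodup (T.nodup k), deg, ← Finset.card_univ]
  congr 1
  ext c
  simp [T.complete]

variable {Y : Type*} [MeasurableSpace Y]

/-- The total mass of the kernels of a term. -/
def mass (T : Term d) (ν : Measure Y) (pos : Y → Pt d) : ℝ≥0∞ :=
  ∑ k, ∫⁻ x, ‖T.kernel k fun c => pos (x c)‖ₑ ∂(Measure.pi fun _ : T.ι => ν)

/-- The value of a term on a field of spins. -/
def eval {B : Type*} [NormedRing B] [NormedAlgebra ℂ B] (T : Term d) (ν : Measure Y)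
    (pos : Y → Pt d) (S : Idx → Y → B) : B :=
  ∑ k, ∫ x, (T.kernel k fun c => pos (x c)) • word (T.order k) (fun c => S (T.label k c) (x c))
    ∂(Measure.pi fun _ : T.ι => ν)

end Term

section Deriv

variable {d : ℕ}

/-- The kernel with which a spin with index `i` is replaced under the evolution. -/
def rateKernel (V : Interaction d) (m : ℕ) (i : Idx) (l : Fin (m + 1) → Idx) (j : Idx)
    (a : Fin (m + 1)) (y : Pt d) (x : Fin m → Pt d) : ℂ :=
  Complex.I * eps (l a) i j * (V m).toFun l (Fin.insertNth (α := fun _ => Pt d) a y x)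

theorem continuous_insertNth_uncurry {m : ℕ} (a : Fin (m + 1)) :
    Continuous fun z : Pt d × (Fin m → Pt d) =>
      (Fin.insertNth (α := fun _ => Pt d) a z.1 z.2 : Fin (m + 1) → Pt d) := by
  refine continuous_pi fun c => ?_
  refine Fin.succAboveCases a ?_ (fun e => ?_) c
  · simpa using continuous_fst
  · simpa [Function.comp_def] using (continuous_apply e).comp continuous_snd

theorem continuous_rateKernel (V : Interaction d) (m : ℕ) (i : Idx) (l : Fin (m + 1) → Idx)
    (j : Idx) (a : Fin (m + 1)) :
    Continuous fun z : Pt d × (Fin m → Pt d) => rateKernel V m i l j a z.1 z.2 :=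
  continuous_const.mul (((V m).continuous_toFun l).comp (continuous_insertNth_uncurry a))

/-- The contribution of `V m` to the time derivative of a term. -/
def Term.deriv (V : Interaction d) (T : Term d) (m : ℕ) : Term d where
  ι := T.ι ⊕ Fin m
  κ := (T.κ × T.ι) × ((Fin (m + 1) → Idx) × Idx × Fin (m + 1))
  fι := inferInstance
  dι := inferInstance
  fκ := inferInstance
  order k := (T.order k.1.1).flatMap fun c =>
    if c = k.1.2 then
      (normalList k.2.1).map (Fin.insertNth (α := fun _ => T.ι ⊕ Fin m) k.2.2.2 (.inl c) .inr)
    else [.inl c]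
  nodup k := by
    have hinj : ∀ c, Function.Injective
        (Fin.insertNth (α := fun _ => T.ι ⊕ Fin m) k.2.2.2 (.inl c) .inr) := by
      intro c e e'
      refine Fin.succAboveCases k.2.2.2 ?_ (fun e => ?_) e <;>
      refine Fin.succAboveCases k.2.2.2 ?_ (fun e' => ?_) e' <;> simp
    rw [List.nodup_flatMap]
    constructor
    · intro c _
      split_ifs
      · exact (nodup_normalList _).map (hinj c)
      · exact List.nodup_singleton _
    · refine (T.nodup k.1.1).imp fun {c e} hce => ?_
      have hmem : ∀ (c : T.ι) (z : T.ι ⊕ Fin m), z ∈ (if c = k.1.2 then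
          (normalList k.2.1).map (Fin.insertNth (α := fun _ => T.ι ⊕ Fin m) k.2.2.2 (.inl c) .inr)
          else [.inl c]) → z = .inl c ∨ (c = k.1.2 ∧ ∃ r, z = .inr r) := by
        intro c z hz
        split_ifs at hz with h
        · obtain ⟨s, -, rfl⟩ := List.mem_map.mp hz
          refine Fin.succAboveCases k.2.2.2 ?_ (fun s => ?_) s
          · left; simp
          · right; exact ⟨h, s, by simp⟩
        · left; simpa using hz
      intro z hz hz'
      rcases hmem c z hz with h | ⟨h, r, hr⟩ <;> rcases hmem e z hz' with h' | ⟨h', r', hr'⟩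
      · exact hce (Sum.inl_injective (h.symm.trans h'))
      · rw [h] at hr'; cases hr'
      · rw [h'] at hr; cases hr
      · exact hce (h.trans h'.symm)
  complete k z := by
    rw [List.mem_flatMap]
    rcases z with c | r
    · refine ⟨c, T.complete _ c, ?_⟩
      split_ifs
      · exact List.mem_map.mpr ⟨k.2.2.2, mem_normalList _ _, by simp⟩
      · simp
    · refine ⟨k.1.2, T.complete _ _, ?_⟩
      rw [if_pos rfl]
      exact List.mem_map.mpr ⟨k.2.2.2.succAbove r, mem_normalList _ _, by simp⟩
  label k := Sum.elim (Function.update (T.label k.1.1) k.1.2 k.2.2.1)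
    fun r => k.2.1 (k.2.2.2.succAbove r)
  kernel k z := T.kernel k.1.1 (fun c => z (.inl c)) *
    rateKernel V m (T.label k.1.1 k.1.2) k.2.1 k.2.2.1 k.2.2.2 (z (.inl k.1.2)) fun r => z (.inr r)
  cont k := by
    refine ((T.cont k.1.1).comp (by fun_prop)).mul ?_
    exact (continuous_rateKernel V m _ _ _ _).comp
      (Continuous.prodMk (by fun_prop) (by fun_prop))

theorem Term.deg_deriv (V : Interaction d) (T : Term d) (m : ℕ) :
    (T.deriv V m).deg = T.deg + m := by
  simp only [Term.deg]
  exact (Fintype.card_sum (α := T.ι) (β := Fin m)).trans (by simp)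

end Deriv

/-! ## Masses and Fubini -/

section Mass

variable {d : ℕ} {Y : Type*} [MeasurableSpace Y]

theorem sum_enorm_eps_le (i j : Idx) : ∑ k, ‖eps i j k‖ₑ ≤ 1 := by
  rw [sum_Idx]
  cases i <;> cases j <;> simp [eps]

theorem toFun_insertNth (V : Interaction d) (m : ℕ) (l : Fin (m + 1) → Idx) (a : Fin (m + 1))
    (y : Pt d) (x : Fin m → Pt d) :
    (V m).toFun l (Fin.insertNth (α := fun _ => Pt d) a y x) =
      (V m).toFun (l ∘ a.cycleRange.symm) (Fin.cons y x) := by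
  rw [← Fin.insertNth_comp_cycleRange_symm (p := a), (V m).symm]

/-- The mass of the interaction kernel with one point fixed. -/
def pointMass (V : Interaction d) (m : ℕ) (ν : Measure Y) (pos : Y → Pt d) (y : Y) : ℝ≥0∞ :=
  ∑ l : Fin (m + 1) → Idx, ∫⁻ x, ‖(V m).toFun l
    (Fin.cons (α := fun _ => Pt d) (pos y) fun r => pos (x r))‖ₑ ∂(Measure.pi fun _ : Fin m => ν)

theorem sum_lintegral_rateKernel_le (V : Interaction d) (m : ℕ) (ν : Measure Y) (pos : Y → Pt d)
    (i : Idx) (y : Y) :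
    ∑ p : (Fin (m + 1) → Idx) × Idx × Fin (m + 1),
      ∫⁻ x, ‖rateKernel V m i p.1 p.2.1 p.2.2 (pos y) fun r => pos (x r)‖ₑ
        ∂(Measure.pi fun _ : Fin m => ν) ≤ (m + 1) * pointMass V m ν pos y := by
  have h1 : ∀ p : (Fin (m + 1) → Idx) × Idx × Fin (m + 1),
      ∫⁻ x, ‖rateKernel V m i p.1 p.2.1 p.2.2 (pos y) fun r => pos (x r)‖ₑ
        ∂(Measure.pi fun _ : Fin m => ν) = ‖eps (p.1 p.2.2) i p.2.1‖ₑ *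
      ∫⁻ x, ‖(V m).toFun (p.1 ∘ p.2.2.cycleRange.symm)
        (Fin.cons (α := fun _ => Pt d) (pos y) fun r => pos (x r))‖ₑ
          ∂(Measure.pi fun _ : Fin m => ν) := by
    intro p
    rw [← lintegral_const_mul' _ _ enorm_ne_top]
    refine lintegral_congr fun x => ?_
    have hI : ‖Complex.I‖ₑ = 1 := by rw [← ofReal_norm, Complex.norm_I, ENNReal.ofReal_one]
    rw [rateKernel, toFun_insertNth, enorm_mul, enorm_mul, hI, one_mul]
  simp_rw [h1]
  rw [Fintype.sum_prod_type]
  calc _ = ∑ a : Fin (m + 1), ∑ l : Fin (m + 1) → Idx, (∑ j, ‖eps (l a) i j‖ₑ) *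
      ∫⁻ x, ‖(V m).toFun (l ∘ a.cycleRange.symm)
        (Fin.cons (α := fun _ => Pt d) (pos y) fun r => pos (x r))‖ₑ
          ∂(Measure.pi fun _ : Fin m => ν) := by
        rw [Finset.sum_comm (s := (Finset.univ : Finset (Fin (m + 1))))]
        refine Finset.sum_congr rfl fun l _ => ?_
        rw [Fintype.sum_prod_type, Finset.sum_comm]
        exact Finset.sum_congr rfl fun a _ => by rw [Finset.sum_mul]
    _ ≤ ∑ a : Fin (m + 1), pointMass V m ν pos y := by
        refine Finset.sum_le_sum fun a _ => ?_
        rw [pointMass, ← (Equiv.arrowCongr a.cycleRange (Equiv.refl Idx)).sum_comp (fun l => ∫⁻ x, ‖(V m).toFun l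
          (Fin.cons (α := fun _ => Pt d) (pos y) fun r => pos (x r))‖ₑ
            ∂(Measure.pi fun _ : Fin m => ν))]
        refine Finset.sum_le_sum fun l _ => ?_
        refine (mul_le_mul_left (sum_enorm_eps_le _ _) _).trans_eq ?_
        rw [one_mul]
        rfl
    _ = _ := by simp

theorem aestronglyMeasurable_pi_eval {B : Type*} [TopologicalSpace B] {ι : Type*} [Fintype ι]
    {ν : Measure Y} [SigmaFinite ν] {f : Y → B} (hf : AEStronglyMeasurable f ν) (c : ι) :
    AEStronglyMeasurable (fun x : ι → Y => f (x c)) (Measure.pi fun _ => ν) :=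
  hf.comp_quasiMeasurePreserving (Measure.quasiMeasurePreserving_eval (fun _ : ι => ν) c)

theorem ae_pi_eval {ι : Type*} [Fintype ι] {ν : Measure Y} [SigmaFinite ν] {p : Y → Prop}
    (h : ∀ᵐ y ∂ν, p y) (c : ι) : ∀ᵐ x ∂(Measure.pi fun _ : ι => ν), p (x c) :=
  (Measure.quasiMeasurePreserving_eval (fun _ : ι => ν) c).ae h

/-- Splitting the points of a configuration over a sum type. -/
theorem lintegral_pi_sum {ι ι' : Type*} [Fintype ι] [Fintype ι'] {ν : Measure Y} [SigmaFinite ν]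
    {f : (ι ⊕ ι' → Y) → ℝ≥0∞} (hf : Measurable f) :
    ∫⁻ z, f z ∂(Measure.pi fun _ => ν) =
      ∫⁻ y, ∫⁻ x, f (Sum.elim y x) ∂(Measure.pi fun _ : ι' => ν) ∂(Measure.pi fun _ : ι => ν) := by
  have h := measurePreserving_sumPiEquivProdPi_symm (X := fun _ : ι ⊕ ι' => Y) fun _ => ν
  rw [← h.lintegral_comp hf]
  refine (lintegral_prod _ (hf.comp h.measurable).aemeasurable).trans ?_
  refine lintegral_congr fun y => lintegral_congr fun x => congrArg f ?_
  ext c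
  cases c <;> rfl

theorem integral_pi_sum {ι ι' B : Type*} [NormedAddCommGroup B] [NormedSpace ℝ B] [Fintype ι]
    [Fintype ι'] {ν : Measure Y} [SigmaFinite ν]
    {f : (ι ⊕ ι' → Y) → B} (hf : Integrable f (Measure.pi fun _ => ν)) :
    Integrable (fun y => ∫ x, f (Sum.elim y x) ∂(Measure.pi fun _ : ι' => ν))
      (Measure.pi fun _ : ι => ν) ∧
    ∫ z, f z ∂(Measure.pi fun _ => ν) =
      ∫ y, ∫ x, f (Sum.elim y x) ∂(Measure.pi fun _ : ι' => ν) ∂(Measure.pi fun _ : ι => ν) := by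
  have h := measurePreserving_sumPiEquivProdPi_symm (X := fun _ : ι ⊕ ι' => Y) fun _ => ν
  have he : ∀ p : (ι → Y) × (ι' → Y),
      (MeasurableEquiv.sumPiEquivProdPi fun _ : ι ⊕ ι' => Y).symm p = Sum.elim p.1 p.2 := by
    intro p
    ext c
    cases c <;> rfl
  have hi := h.integrable_comp_of_integrable hf
  simp only [Function.comp_def, he] at hi
  refine ⟨hi.integral_prod_left, ?_⟩
  rw [← h.integral_comp (MeasurableEquiv.measurableEmbedding _)]
  simp only [he]
  exact integral_prod _ hi

theorem measurable_kernel (T : Term d) {pos : Y → Pt d} (hpos : Measurable pos) (k : T.κ) :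
    Measurable fun x : T.ι → Y => T.kernel k fun c => pos (x c) :=
  (T.cont k).measurable.comp
    (measurable_pi_lambda _ fun c => hpos.comp (measurable_pi_apply c))

theorem mass_deriv_le (V : Interaction d) (T : Term d) (m : ℕ) (ν : Measure Y)
    [IsFiniteMeasure ν] {pos : Y → Pt d} (hpos : Measurable pos) {v : ℝ≥0∞}
    (hv : ∀ᵐ y ∂ν, pointMass V m ν pos y ≤ v) :
    (T.deriv V m).mass ν pos ≤ T.deg * ((m + 1) * v) * T.mass ν pos := by
  have h1 : ∀ (k : T.κ) (b : T.ι), ∑ p : (Fin (m + 1) → Idx) × Idx × Fin (m + 1),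
      ∫⁻ z, ‖(T.deriv V m).kernel ((k, b), p) fun c => pos (z c)‖ₑ
        ∂(Measure.pi fun _ : (T.deriv V m).ι => ν) ≤
      ((m + 1) * v) * ∫⁻ x, ‖T.kernel k fun c => pos (x c)‖ₑ ∂(Measure.pi fun _ : T.ι => ν) := by
    intro k b
    have h2 : ∀ p, ∫⁻ z, ‖(T.deriv V m).kernel ((k, b), p) fun c => pos (z c)‖ₑ
        ∂(Measure.pi fun _ : (T.deriv V m).ι => ν) =
        ∫⁻ y, ‖T.kernel k fun c => pos (y c)‖ₑ *
          ∫⁻ x, ‖rateKernel V m (T.label k b) p.1 p.2.1 p.2.2 (pos (y b)) fun r => pos (x r)‖ₑ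
            ∂(Measure.pi fun _ : Fin m => ν) ∂(Measure.pi fun _ : T.ι => ν) := by
      intro p
      refine (lintegral_pi_sum (ι := T.ι) (ι' := Fin m)
        (measurable_kernel (T.deriv V m) hpos ((k, b), p)).enorm).trans ?_
      refine lintegral_congr fun y => ?_
      rw [← lintegral_const_mul' _ _ enorm_ne_top]
      refine lintegral_congr fun x => ?_
      rw [← enorm_mul]
      rfl
    have hm : ∀ p : (Fin (m + 1) → Idx) × Idx × Fin (m + 1), Measurable fun y : T.ι → Y =>
        ‖T.kernel k fun c => pos (y c)‖ₑ *
          ∫⁻ x, ‖rateKernel V m (T.label k b) p.1 p.2.1 p.2.2 (pos (y b)) fun r => pos (x r)‖ₑ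
            ∂(Measure.pi fun _ : Fin m => ν) := by
      intro p
      refine (measurable_kernel T hpos k).enorm.mul ?_
      refine Measurable.lintegral_prod_right' (f := fun z : (T.ι → Y) × (Fin m → Y) =>
        ‖rateKernel V m (T.label k b) p.1 p.2.1 p.2.2 (pos (z.1 b)) fun r => pos (z.2 r)‖ₑ) ?_
      refine ((continuous_rateKernel V m (T.label k b) p.1 p.2.1 p.2.2).measurable.comp
        (Measurable.prodMk ?_ ?_)).enorm
      · exact hpos.comp ((measurable_pi_apply b).comp measurable_fst)
      · exact measurable_pi_lambda _ fun r =>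
          hpos.comp ((measurable_pi_apply r).comp measurable_snd)
    simp_rw [h2]
    rw [← lintegral_finsetSum _ fun p _ => hm p,
      ← lintegral_const_mul _ (measurable_kernel T hpos k).enorm]
    refine lintegral_mono_ae ?_
    filter_upwards [ae_pi_eval hv b] with y hy
    rw [← Finset.mul_sum, mul_comm]
    refine mul_le_mul_left ?_ _
    exact (sum_lintegral_rateKernel_le V m ν pos _ (y b)).trans (mul_le_mul_right hy _)
  calc (T.deriv V m).mass ν pos
      = ∑ kb : T.κ × T.ι, ∑ p : (Fin (m + 1) → Idx) × Idx × Fin (m + 1),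
        ∫⁻ z, ‖(T.deriv V m).kernel (kb, p) fun c => pos (z c)‖ₑ
        ∂(Measure.pi fun _ : (T.deriv V m).ι => ν) := Fintype.sum_prod_type _
    _ ≤ ∑ kb : T.κ × T.ι, ((m + 1) * v) *
        ∫⁻ x, ‖T.kernel kb.1 fun c => pos (x c)‖ₑ ∂(Measure.pi fun _ : T.ι => ν) :=
        Finset.sum_le_sum fun kb _ => h1 kb.1 kb.2
    _ = _ := by
        rw [Fintype.sum_prod_type, Term.mass, Finset.mul_sum]
        refine Finset.sum_congr rfl fun k _ => ?_
        simp [Term.deg, mul_assoc]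

end Mass

/-! ## Evolution of the value of a term -/

section Flow

variable {d : ℕ} {Y : Type*} [MeasurableSpace Y]
variable {B : Type*} [NormedRing B] [NormedAlgebra ℂ B] [NormOneClass B]

theorem integrable_smul_of_bound {Z : Type*} [MeasurableSpace Z] {ζ : Measure Z} {g : Z → ℂ}
    {W : Z → B} {C : ℝ} (hg : AEStronglyMeasurable g ζ) (hgm : ∫⁻ z, ‖g z‖ₑ ∂ζ < ⊤)
    (hW : AEStronglyMeasurable W ζ) (hWb : ∀ᵐ z ∂ζ, ‖W z‖ ≤ C) :
    Integrable (fun z => g z • W z) ζ :=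
  Integrable.smul_bdd (φ := g) ⟨hg, hgm⟩ C hW hWb

theorem aestronglyMeasurable_word {Z : Type*} [MeasurableSpace Z] {ζ : Measure Z} {ι : Type*}
    (l : List ι) {A : Z → ι → B} (hA : ∀ c, AEStronglyMeasurable (fun z => A z c) ζ) :
    AEStronglyMeasurable (fun z => word l (A z)) ζ := by
  induction l with
  | nil => exact aestronglyMeasurable_const
  | cons c l ih =>
    simp only [word_cons]
    exact (hA c).mul ih

/-- The contribution of `V m` to the time derivative of the spin at `y`. -/
def rate (V : Interaction d) (ν : Measure Y) (pos : Y → Pt d) (S : Idx → Y → B) (m : ℕ) (i : Idx)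
    (y : Y) : B :=
  ∑ p : (Fin (m + 1) → Idx) × Idx × Fin (m + 1),
    ∫ x, rateKernel V m i p.1 p.2.1 p.2.2 (pos y) (fun r => pos (x r)) •
      word (normalList p.1) (fun c => S (Function.update p.1 p.2.2 p.2.1 c)
        (Fin.insertNth (α := fun _ => Y) p.2.2 y x c)) ∂(Measure.pi fun _ : Fin m => ν)

theorem word_order_deriv (V : Interaction d) (T : Term d) (m : ℕ) (k : T.κ) (b : T.ι)
    (p : (Fin (m + 1) → Idx) × Idx × Fin (m + 1)) (S : Idx → Y → B) (y : T.ι → Y)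
    (x : Fin m → Y) :
    word ((T.deriv V m).order ((k, b), p))
        (fun c => S ((T.deriv V m).label ((k, b), p) c) (Sum.elim y x c)) =
      word (T.order k) (Function.update (fun c => S (T.label k c) (y c)) b
        (word (normalList p.1) fun c => S (Function.update p.1 p.2.2 p.2.1 c)
          (Fin.insertNth (α := fun _ => Y) p.2.2 (y b) x c))) := by
  refine (word_flatMap _ _ _).trans (word_congr fun c _ => ?_)
  have hlab : ∀ e : Fin (m + 1), (T.deriv V m).label ((k, b), p)
      (Fin.insertNth (α := fun _ => T.ι ⊕ Fin m) p.2.2 (.inl b) .inr e) =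
        Function.update p.1 p.2.2 p.2.1 e := by
    intro e
    change Sum.elim (Function.update (T.label k) b p.2.1) (fun r => p.1 (p.2.2.succAbove r)) _ = _
    refine Fin.succAboveCases p.2.2 ?_ (fun e => ?_) e
    · simp
    · simp
  have hpt : ∀ e : Fin (m + 1), (Sum.elim y x : T.ι ⊕ Fin m → Y)
      (Fin.insertNth (α := fun _ => T.ι ⊕ Fin m) p.2.2 (.inl b) .inr e) =
        Fin.insertNth (α := fun _ => Y) p.2.2 (y b) x e := by
    intro e
    refine Fin.succAboveCases p.2.2 ?_ (fun e => ?_) e <;> simp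
  change word (if c = b then (normalList p.1).map
    (Fin.insertNth (α := fun _ => T.ι ⊕ Fin m) p.2.2 (.inl c) .inr) else [.inl c]) _ = _
  by_cases hc : c = b
  · subst hc
    rw [if_pos rfl, Function.update_self]
    exact (word_map _ _ _).trans (word_congr fun e _ => congr (congrArg S (hlab e)) (hpt e))
  · rw [if_neg hc, Function.update_of_ne hc]
    refine (word_cons _ _ _).trans ((mul_one _).trans ?_)
    change S (Function.update (T.label k) b p.2.1 c) (y c) = _
    rw [Function.update_of_ne hc]

variable {ν : Measure Y} [IsFiniteMeasure ν] {pos : Y → Pt d}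

theorem ae_norm_le_insertNth {S : Idx → Y → B} {w : ℝ} (hS : ∀ i, ∀ᵐ y ∂ν, ‖S i y‖ ≤ w) {m : ℕ}
    (a : Fin (m + 1)) {y : Y} (hy : ∀ i, ‖S i y‖ ≤ w) :
    ∀ᵐ x ∂(Measure.pi fun _ : Fin m => ν), ∀ i c,
      ‖S i (Fin.insertNth (α := fun _ => Y) a y x c)‖ ≤ w := by
  have : ∀ᵐ x ∂(Measure.pi fun _ : Fin m => ν), ∀ r i, ‖S i (x r)‖ ≤ w :=
    ae_all_iff.mpr fun r => ae_all_iff.mpr fun i => ae_pi_eval (hS i) r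
  filter_upwards [this] with x hx i c
  refine Fin.succAboveCases a ?_ (fun c => ?_) c
  · simpa using hy i
  · simpa using hx c i

theorem aestronglyMeasurable_insertNth {S : Idx → Y → B}
    (hS : ∀ i, AEStronglyMeasurable (S i) ν) {m : ℕ} (a : Fin (m + 1)) (y : Y) (i : Idx)
    (c : Fin (m + 1)) :
    AEStronglyMeasurable (fun x => S i (Fin.insertNth (α := fun _ => Y) a y x c))
      (Measure.pi fun _ : Fin m => ν) := by
  refine Fin.succAboveCases a ?_ (fun c => ?_) c
  · simpa using aestronglyMeasurable_const
  · simpa using aestronglyMeasurable_pi_eval (hS i) c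

theorem lintegral_rateKernel_lt_top {V : Interaction d} {m : ℕ} {y : Y}
    (hy : pointMass V m ν pos y < ⊤) (i : Idx) (p : (Fin (m + 1) → Idx) × Idx × Fin (m + 1)) :
    ∫⁻ x, ‖rateKernel V m i p.1 p.2.1 p.2.2 (pos y) fun r => pos (x r)‖ₑ
      ∂(Measure.pi fun _ : Fin m => ν) < ⊤ := by
  refine lt_of_le_of_lt ((Finset.single_le_sum (fun _ _ => zero_le) (Finset.mem_univ p)).trans
    (sum_lintegral_rateKernel_le V m ν pos i y)) ?_
  exact ENNReal.mul_lt_top (by finiteness) hy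

theorem measurable_rateKernel (hpos : Measurable pos) (V : Interaction d) (m : ℕ) (i : Idx)
    (p : (Fin (m + 1) → Idx) × Idx × Fin (m + 1)) (y : Y) :
    Measurable fun x : Fin m → Y =>
      rateKernel V m i p.1 p.2.1 p.2.2 (pos y) fun r => pos (x r) :=
  (continuous_rateKernel V m i p.1 p.2.1 p.2.2).measurable.comp
    (measurable_const.prodMk (measurable_pi_lambda _ fun r => hpos.comp (measurable_pi_apply r)))

theorem norm_rate_le {V : Interaction d} {m : ℕ} {S : Idx → Y → B} {w : ℝ}
    (hS : ∀ i, ∀ᵐ y ∂ν, ‖S i y‖ ≤ w) {v : ℝ} (hv : 0 ≤ v) {y : Y} (hy : ∀ i, ‖S i y‖ ≤ w)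
    (hyv : pointMass V m ν pos y ≤ ENNReal.ofReal v) (i : Idx) :
    ‖rate V ν pos S m i y‖ ≤ w ^ (m + 1) * ((m + 1) * v) := by
  have hw : 0 ≤ w := (norm_nonneg _).trans (hy i)
  have h1 : ‖rate V ν pos S m i y‖ₑ ≤ ENNReal.ofReal (w ^ (m + 1)) *
      ((m + 1) * pointMass V m ν pos y) := by
    rw [rate]
    refine (enorm_sum_le _ _).trans ?_
    refine le_trans ?_ (mul_le_mul_right (sum_lintegral_rateKernel_le V m ν pos i y) _)
    rw [Finset.mul_sum]
    refine Finset.sum_le_sum fun p _ => ?_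
    refine (enorm_integral_le_lintegral_enorm _).trans ?_
    rw [← lintegral_const_mul' _ _ ENNReal.ofReal_ne_top]
    refine lintegral_mono_ae ?_
    filter_upwards [ae_norm_le_insertNth hS p.2.2 hy] with x hx
    rw [enorm_smul, mul_comm]
    refine mul_le_mul_left ?_ _
    rw [← ofReal_norm]
    refine ENNReal.ofReal_le_ofReal ?_
    have := norm_word_le (normalList p.1) (A := fun c => S (Function.update p.1 p.2.2 p.2.1 c)
        (Fin.insertNth (α := fun _ => Y) p.2.2 y x c)) (r := w) (fun c => hx _ c)
    rwa [show (normalList p.1).length = m + 1 from by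
      rw [← List.toFinset_card_of_nodup (nodup_normalList _)]
      rw [show (normalList p.1).toFinset = Finset.univ from by ext; simp [mem_normalList]]
      simp] at this
  have h2 : ENNReal.ofReal (w ^ (m + 1)) * ((m + 1) * pointMass V m ν pos y) ≤
      ENNReal.ofReal (w ^ (m + 1) * ((m + 1) * v)) := by
    rw [ENNReal.ofReal_mul (by positivity), ENNReal.ofReal_mul (by positivity)]
    refine mul_le_mul_right ?_ _
    refine mul_le_mul' ?_ hyv
    rw [ENNReal.ofReal_add (by positivity) (by positivity)]
    simp
  have h3 := h1.trans h2
  rw [← ofReal_norm] at h3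
  exact (ENNReal.ofReal_le_ofReal_iff (by positivity)).mp h3

theorem norm_eval_le (T : Term d) {S : Idx → Y → B} {w : ℝ}
    (hS : ∀ i, ∀ᵐ y ∂ν, ‖S i y‖ ≤ w) :
    ‖T.eval ν pos S‖ₑ ≤ ENNReal.ofReal (w ^ T.deg) * T.mass ν pos := by
  rw [Term.eval, Term.mass, Finset.mul_sum]
  refine (enorm_sum_le _ _).trans (Finset.sum_le_sum fun k _ => ?_)
  refine (enorm_integral_le_lintegral_enorm _).trans ?_
  rw [← lintegral_const_mul' _ _ ENNReal.ofReal_ne_top]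
  refine lintegral_mono_ae ?_
  have : ∀ᵐ x ∂(Measure.pi fun _ : T.ι => ν), ∀ c i, ‖S i (x c)‖ ≤ w :=
    ae_all_iff.mpr fun r => ae_all_iff.mpr fun i => ae_pi_eval (hS i) r
  filter_upwards [this] with x hx
  rw [enorm_smul, mul_comm]
  refine mul_le_mul_left ?_ _
  rw [← ofReal_norm]
  refine ENNReal.ofReal_le_ofReal ?_
  rw [← T.length_order k]
  exact norm_word_le _ fun c => hx c _

theorem lintegral_kernel_lt_top {T : Term d} (hT : T.mass ν pos < ⊤) (k : T.κ) :
    ∫⁻ x, ‖T.kernel k fun c => pos (x c)‖ₑ ∂(Measure.pi fun _ : T.ι => ν) < ⊤ :=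
  lt_of_le_of_lt (Finset.single_le_sum (f := fun k => ∫⁻ x, ‖T.kernel k fun c => pos (x c)‖ₑ
    ∂(Measure.pi fun _ : T.ι => ν)) (fun _ _ => zero_le) (Finset.mem_univ k)) hT

theorem ae_norm_word_le (T : Term d) (k : T.κ) {S : Idx → Y → B} {w : ℝ}
    (hS : ∀ i, ∀ᵐ y ∂ν, ‖S i y‖ ≤ w) :
    ∀ᵐ x ∂(Measure.pi fun _ : T.ι => ν),
      ‖word (T.order k) fun c => S (T.label k c) (x c)‖ ≤ w ^ T.deg := by
  have : ∀ᵐ x ∂(Measure.pi fun _ : T.ι => ν), ∀ c, ‖S (T.label k c) (x c)‖ ≤ w :=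
    ae_all_iff.mpr fun c => ae_pi_eval (hS _) c
  filter_upwards [this] with x hx
  rw [← T.length_order k]
  exact norm_word_le _ hx

theorem integrable_eval {T : Term d} (hpos : Measurable pos) (hT : T.mass ν pos < ⊤) (k : T.κ)
    {S : Idx → Y → B} {w : ℝ} (hSm : ∀ i, AEStronglyMeasurable (S i) ν)
    (hS : ∀ i, ∀ᵐ y ∂ν, ‖S i y‖ ≤ w) :
    Integrable (fun x => (T.kernel k fun c => pos (x c)) •
      word (T.order k) fun c => S (T.label k c) (x c)) (Measure.pi fun _ : T.ι => ν) :=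
  integrable_smul_of_bound (measurable_kernel T hpos k).aestronglyMeasurable
    (lintegral_kernel_lt_top hT k)
    (aestronglyMeasurable_word _ fun c => aestronglyMeasurable_pi_eval (hSm _) c)
    (ae_norm_word_le T k hS)

/-- The derived term replaces one spin by its rate of change. -/
theorem eval_deriv [CompleteSpace B] {V : Interaction d} {T : Term d} (hpos : Measurable pos)
    (hT : T.mass ν pos < ⊤) {S : Idx → Y → B} {w : ℝ}
    (hSm : ∀ i, AEStronglyMeasurable (S i) ν)
    (hS : ∀ i, ∀ᵐ y ∂ν, ‖S i y‖ ≤ w) (m : ℕ) {v : ℝ≥0∞} (hvt : v < ⊤)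
    (hv : ∀ᵐ y ∂ν, pointMass V m ν pos y ≤ v) :
    (∀ k b, Integrable (fun y : T.ι → Y => (T.kernel k fun c => pos (y c)) •
      word (T.order k) (Function.update (fun c => S (T.label k c) (y c)) b
        (rate V ν pos S m (T.label k b) (y b)))) (Measure.pi fun _ => ν)) ∧
    (T.deriv V m).eval ν pos S = ∑ k, ∑ b, ∫ y, (T.kernel k fun c => pos (y c)) •
      word (T.order k) (Function.update (fun c => S (T.label k c) (y c)) b
        (rate V ν pos S m (T.label k b) (y b))) ∂(Measure.pi fun _ => ν) := by
  have hmass : (T.deriv V m).mass ν pos < ⊤ :=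
    (mass_deriv_le V T m ν hpos hv).trans_lt
      (ENNReal.mul_lt_top (by finiteness) hT)
  have hS' : ∀ᵐ y ∂ν, ∀ i, ‖S i y‖ ≤ w := ae_all_iff.mpr hS
  -- the contribution of one replacement
  let ρ : (Fin (m + 1) → Idx) × Idx × Fin (m + 1) → Idx → Y → B := fun p i y =>
    ∫ x, rateKernel V m i p.1 p.2.1 p.2.2 (pos y) (fun r => pos (x r)) •
      word (normalList p.1) (fun c => S (Function.update p.1 p.2.2 p.2.1 c)
        (Fin.insertNth (α := fun _ => Y) p.2.2 y x c)) ∂(Measure.pi fun _ : Fin m => ν)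
  have hint := fun k b p => integral_pi_sum (ι := T.ι) (ι' := Fin m)
    (integrable_eval (T := T.deriv V m) hpos hmass ((k, b), p) hSm hS)
  have hinner : ∀ k b p, ∀ᵐ y ∂(Measure.pi fun _ : T.ι => ν),
      (∫ x, ((T.deriv V m).kernel ((k, b), p) fun c => pos ((Sum.elim y x : T.ι ⊕ Fin m → Y) c)) •
        word ((T.deriv V m).order ((k, b), p)) (fun c => S ((T.deriv V m).label ((k, b), p) c)
          ((Sum.elim y x : T.ι ⊕ Fin m → Y) c)) ∂(Measure.pi fun _ : Fin m => ν)) =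
      (T.kernel k fun c => pos (y c)) •
        word (T.order k) (Function.update (fun c => S (T.label k c) (y c)) b
          (ρ p (T.label k b) (y b))) := by
    intro k b p
    filter_upwards [ae_pi_eval hv b, ae_pi_eval hS' b] with y hy hyS
    obtain ⟨P, Q, hPQ⟩ := exists_word_update (T.nodup k) (T.complete k b)
      (fun c => S (T.label k c) (y c))
    simp_rw [word_order_deriv, hPQ]
    have hin : Integrable (fun x => rateKernel V m (T.label k b) p.1 p.2.1 p.2.2 (pos (y b))
        (fun r => pos (x r)) • word (normalList p.1)
        (fun c => S (Function.update p.1 p.2.2 p.2.1 c)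
          (Fin.insertNth (α := fun _ => Y) p.2.2 (y b) x c))) (Measure.pi fun _ : Fin m => ν) := by
      refine integrable_smul_of_bound (C := w ^ (normalList p.1).length)
        (measurable_rateKernel hpos V m _ p _).aestronglyMeasurable
        (lintegral_rateKernel_lt_top (hy.trans_lt hvt) _ p) ?_ ?_
      · exact aestronglyMeasurable_word _ fun c => aestronglyMeasurable_insertNth hSm _ _ _ _
      · filter_upwards [ae_norm_le_insertNth hS p.2.2 hyS] with x hx
        exact norm_word_le _ fun c => hx _ _
    have hcomm := (ContinuousLinearMap.mulLeftRight ℂ B P Q).integral_comp_comm hin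
    simp only [ContinuousLinearMap.mulLeftRight_apply] at hcomm
    rw [show P * ρ p (T.label k b) (y b) * Q = _ from hcomm.symm, ← integral_smul]
    refine integral_congr_ae (Eventually.of_forall fun x => ?_)
    simp only [Term.deriv, Sum.elim_inl, Sum.elim_inr, mul_smul, smul_mul_assoc, mul_smul_comm]
  have hsum : ∀ k b (y : T.ι → Y), (T.kernel k fun c => pos (y c)) •
      word (T.order k) (Function.update (fun c => S (T.label k c) (y c)) b
        (rate V ν pos S m (T.label k b) (y b))) =
      ∑ p, (T.kernel k fun c => pos (y c)) •
        word (T.order k) (Function.update (fun c => S (T.label k c) (y c)) b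
          (ρ p (T.label k b) (y b))) := by
    intro k b y
    obtain ⟨P, Q, hPQ⟩ := exists_word_update (T.nodup k) (T.complete k b)
      (fun c => S (T.label k c) (y c))
    simp_rw [hPQ]
    rw [← Finset.smul_sum, ← Finset.sum_mul, ← Finset.mul_sum]
    rfl
  have hi : ∀ k b p, Integrable (fun y : T.ι → Y => (T.kernel k fun c => pos (y c)) •
        word (T.order k) (Function.update (fun c => S (T.label k c) (y c)) b
          (ρ p (T.label k b) (y b)))) (Measure.pi fun _ => ν) :=
    fun k b p => (hint k b p).1.congr (hinner k b p)
  refine ⟨fun k b => ?_, ?_⟩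
  · simp_rw [hsum]
    exact integrable_finsetSum _ fun p _ => hi k b p
  · have h1 : (T.deriv V m).eval ν pos S = ∑ kb : T.κ × T.ι,
        ∑ p : (Fin (m + 1) → Idx) × Idx × Fin (m + 1),
        ∫ z, ((T.deriv V m).kernel (kb, p) fun c => pos (z c)) •
          word ((T.deriv V m).order (kb, p)) (fun c => S ((T.deriv V m).label (kb, p) c) (z c))
            ∂(Measure.pi fun _ : (T.deriv V m).ι => ν) := Fintype.sum_prod_type _
    rw [h1, Fintype.sum_prod_type]
    refine Finset.sum_congr rfl fun k _ => Finset.sum_congr rfl fun b _ => ?_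
    simp_rw [hsum]
    rw [integral_finsetSum _ fun p _ => hi k b p]
    refine Finset.sum_congr rfl fun p _ => ?_
    exact (hint k b p).2.trans (integral_congr_ae (hinner k b p))

end Flow

section UnifDeriv

variable {Z : Type*} [MeasurableSpace Z] {ζ : Measure Z}
variable {B : Type*} [NormedRing B] [NormedAlgebra ℂ B] [NormOneClass B]

/-- Differentiability at time zero, uniformly up to null sets. -/
def UnifDeriv (ζ : Measure Z) (A : ℝ → Z → B) (A' : Z → B) : Prop :=
  ∀ c : ℝ, 0 < c → ∀ᶠ τ in 𝓝 (0 : ℝ), ∀ᵐ z ∂ζ, ‖A τ z - A 0 z - (τ : ℂ) • A' z‖ ≤ c * |τ|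

theorem UnifDeriv.exists_bound {A : ℝ → Z → B} {A' : Z → B} (h : UnifDeriv ζ A A') {a : ℝ}
    (hA : ∀ τ, ∀ᵐ z ∂ζ, ‖A τ z‖ ≤ a) : ∃ R, ∀ᵐ z ∂ζ, ‖A' z‖ ≤ R := by
  have h1 : ∀ᶠ τ in 𝓝[≠] (0 : ℝ), τ ≠ 0 := eventually_mem_nhdsWithin
  obtain ⟨τ, hτ, hτ0⟩ := (((h 1 one_pos).filter_mono nhdsWithin_le_nhds).and h1).exists
  have hτ' : 0 < |τ| := abs_pos.mpr hτ0
  refine ⟨(a + a + 1 * |τ|) / |τ|, ?_⟩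
  filter_upwards [hτ, hA τ, hA 0] with z hz h2 h3
  rw [le_div_iff₀ hτ', mul_comm]
  have h4 : |τ| * ‖A' z‖ = ‖(τ : ℂ) • A' z‖ := by rw [norm_smul, Complex.norm_real]; rfl
  have h5 : (τ : ℂ) • A' z = A τ z - A 0 z - (A τ z - A 0 z - (τ : ℂ) • A' z) := by abel
  rw [h4, h5]
  exact (norm_sub_le _ _).trans (add_le_add ((norm_sub_le _ _).trans (add_le_add h2 h3)) hz)

theorem UnifDeriv.mul {A C : ℝ → Z → B} {A' C' : Z → B} {a b : ℝ} (h : UnifDeriv ζ A A')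
    (h' : UnifDeriv ζ C C') (hA : ∀ τ, ∀ᵐ z ∂ζ, ‖A τ z‖ ≤ a) (hC : ∀ τ, ∀ᵐ z ∂ζ, ‖C τ z‖ ≤ b) :
    UnifDeriv ζ (fun τ z => A τ z * C τ z) (fun z => A' z * C 0 z + A 0 z * C' z) := by
  obtain ⟨R, hR⟩ := h.exists_bound hA
  obtain ⟨R', hR'⟩ := h'.exists_bound hC
  intro c hc
  -- the error is at most `(c₁ |b| + |a| c₁ + |R| (|R'| + 1) |τ|) |τ|`
  have hc1 : 0 < c / (2 * (|a| + |b| + 1)) := by positivity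
  have hsmall : ∀ᶠ τ in 𝓝 (0 : ℝ), |R| * (|R'| + 1) * |τ| ≤ c / 2 := by
    have : Tendsto (fun τ : ℝ => |R| * (|R'| + 1) * |τ|) (𝓝 0) (𝓝 (|R| * (|R'| + 1) * |0|)) :=
      (continuous_const.mul continuous_abs).tendsto 0
    rw [abs_zero, mul_zero] at this
    exact this.eventually_le_const (by positivity)
  filter_upwards [h _ hc1, h' _ hc1, h' 1 one_pos, hsmall] with τ h1 h2 h3 h4
  filter_upwards [h1, h2, h3, hA 0, hC τ, hR, hR'] with z h1 h2 h3 hA0 hCτ hR hR'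
  have e : A τ z * C τ z - A 0 z * C 0 z - (τ : ℂ) • (A' z * C 0 z + A 0 z * C' z) =
      (A τ z - A 0 z - (τ : ℂ) • A' z) * C τ z + A 0 z * (C τ z - C 0 z - (τ : ℂ) • C' z) +
        ((τ : ℂ) • A' z) * (C τ z - C 0 z) := by
    simp only [smul_add, sub_mul, mul_sub, smul_mul_assoc, mul_smul_comm]
    abel
  have hd : ‖C τ z - C 0 z‖ ≤ (|R'| + 1) * |τ| := by
    have : C τ z - C 0 z = (C τ z - C 0 z - (τ : ℂ) • C' z) + (τ : ℂ) • C' z := by abel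
    rw [this]
    refine (norm_add_le _ _).trans ?_
    rw [norm_smul, Complex.norm_real, Real.norm_eq_abs]
    have : |τ| * ‖C' z‖ ≤ |τ| * |R'| :=
      mul_le_mul_of_nonneg_left (hR'.trans (le_abs_self _)) (abs_nonneg _)
    linarith
  have t1 : ‖(A τ z - A 0 z - (τ : ℂ) • A' z) * C τ z‖ ≤
      c / (2 * (|a| + |b| + 1)) * |τ| * |b| :=
    (norm_mul_le _ _).trans (mul_le_mul h1 (hCτ.trans (le_abs_self _)) (norm_nonneg _)
      (by positivity))
  have t2 : ‖A 0 z * (C τ z - C 0 z - (τ : ℂ) • C' z)‖ ≤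
      |a| * (c / (2 * (|a| + |b| + 1)) * |τ|) :=
    (norm_mul_le _ _).trans (mul_le_mul (hA0.trans (le_abs_self _)) h2 (norm_nonneg _)
      (by positivity))
  have t3 : ‖((τ : ℂ) • A' z) * (C τ z - C 0 z)‖ ≤ |τ| * |R| * ((|R'| + 1) * |τ|) := by
    refine (norm_mul_le _ _).trans (mul_le_mul ?_ hd (norm_nonneg _) (by positivity))
    rw [norm_smul, Complex.norm_real, Real.norm_eq_abs]
    exact mul_le_mul_of_nonneg_left (hR.trans (le_abs_self _)) (abs_nonneg _)
  rw [e]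
  refine (norm_add_le _ _).trans ((add_le_add ((norm_add_le _ _).trans (add_le_add t1 t2))
    t3).trans ?_)
  have h5 : |τ| * |R| * ((|R'| + 1) * |τ|) ≤ c / 2 * |τ| := by
    have := mul_le_mul_of_nonneg_right h4 (abs_nonneg τ)
    nlinarith
  have h6 : c / (2 * (|a| + |b| + 1)) * |τ| * |b| + |a| * (c / (2 * (|a| + |b| + 1)) * |τ|) ≤
      c / 2 * |τ| := by
    have h7 : c / (2 * (|a| + |b| + 1)) * (|a| + |b|) ≤ c / 2 := by
      rw [div_mul_eq_mul_div, div_le_div_iff₀ (by positivity) (by positivity)]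
      nlinarith [abs_nonneg a, abs_nonneg b]
    have := mul_le_mul_of_nonneg_right h7 (abs_nonneg τ)
    nlinarith
  linarith

theorem UnifDeriv.word {ι : Type*} (l : List ι) {A : ℝ → Z → ι → B} {A' : Z → ι → B} {r : ℝ}
    (h : ∀ c, UnifDeriv ζ (fun τ z => A τ z c) (fun z => A' z c))
    (hA : ∀ τ, ∀ᵐ z ∂ζ, ∀ c, ‖A τ z c‖ ≤ r) :
    UnifDeriv ζ (fun τ z => word l (A τ z)) (fun z => wordD l (A 0 z) (A' z)) := by
  induction l with
  | nil =>
    intro c hc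
    refine Eventually.of_forall fun τ => Eventually.of_forall fun z => ?_
    simp only [word_nil, wordD, sub_self, smul_zero, norm_zero]
    positivity
  | cons c l ih =>
    simp only [word_cons, wordD]
    refine UnifDeriv.mul (a := r) (b := r ^ l.length) (h c) ih (fun τ => ?_) fun τ => ?_
    · filter_upwards [hA τ] with z hz using hz c
    · filter_upwards [hA τ] with z hz using norm_word_le l hz

theorem UnifDeriv.hasDerivAt_integral {A : ℝ → Z → B} {A' : Z → B} (h : UnifDeriv ζ A A')
    {g : Z → ℂ} (hg : Integrable g ζ) (hA : ∀ τ, Integrable (fun z => g z • A τ z) ζ)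
    (hA' : Integrable (fun z => g z • A' z) ζ) :
    HasDerivAt (fun τ : ℝ => ∫ z, g z • A τ z ∂ζ) (∫ z, g z • A' z ∂ζ) 0 := by
  rw [hasDerivAt_iff_isLittleO, Asymptotics.isLittleO_iff]
  intro c hc
  have hG : (0 : ℝ) < ∫ z, ‖g z‖ ∂ζ + 1 := by
    have : 0 ≤ ∫ z, ‖g z‖ ∂ζ := integral_nonneg fun _ => norm_nonneg _
    linarith
  filter_upwards [h (c / (∫ z, ‖g z‖ ∂ζ + 1)) (by positivity)] with τ hτ
  rw [sub_zero, ← integral_sub (hA τ) (hA 0), ← integral_smul, ← integral_sub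
    (f := fun z => g z • A τ z - g z • A 0 z) (g := fun z => τ • g z • A' z)
    ((hA τ).sub (hA 0)) (hA'.smul τ)]
  have h1 : ∀ z, g z • A τ z - g z • A 0 z - τ • g z • A' z =
      g z • (A τ z - A 0 z - (τ : ℂ) • A' z) := by
    intro z
    rw [smul_sub, smul_sub, ← Complex.coe_smul, smul_comm (g z) (τ : ℂ)]
  simp_rw [h1]
  refine (norm_integral_le_of_norm_le (hg.norm.mul_const
    (c / (∫ z, ‖g z‖ ∂ζ + 1) * |τ|)) ?_).trans ?_
  · filter_upwards [hτ] with z hz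
    rw [norm_smul]
    exact mul_le_mul_of_nonneg_left hz (norm_nonneg _)
  · rw [integral_mul_const, Real.norm_eq_abs, ← mul_assoc]
    refine mul_le_mul_of_nonneg_right ?_ (abs_nonneg _)
    rw [mul_div_assoc', div_le_iff₀ hG]
    nlinarith

end UnifDeriv

section SpinFlow

variable {d : ℕ} {Y : Type*} [MeasurableSpace Y]
variable {B : Type*} [NormedRing B] [NormedAlgebra ℂ B] [NormOneClass B]

/-- The bound for the masses of the interaction kernels. -/
def massBound (K : ℝ) (m : ℕ) : ℝ := K * Real.exp (-((m : ℝ) + 1)) / ((m : ℝ) + 1)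

theorem massBound_nonneg {K : ℝ} (hK : 0 ≤ K) (m : ℕ) : 0 ≤ massBound K m := by
  rw [massBound]; positivity

theorem mul_massBound (K : ℝ) (m : ℕ) :
    ((m : ℝ) + 1) * massBound K m = K * Real.exp (-((m : ℝ) + 1)) := by
  rw [massBound]; field_simp

/-- A field of spins with values in the algebra `B` over the space `Y`, which evolves according to
the interaction `V`. -/
structure SpinFlow (V : Interaction d) (K : ℝ) (ν : Measure Y) (pos : Y → Pt d)
    (S S' : ℝ → Idx → Y → B) : Prop where
  measurable_pos : Measurable pos
  aesm : ∀ t i, AEStronglyMeasurable (S t i) ν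
  norm_le : ∀ t i, ∀ᵐ y ∂ν, ‖S t i y‖ ≤ Real.sqrt 2
  mass_le : ∀ m, ∀ᵐ y ∂ν, pointMass V m ν pos y ≤ ENNReal.ofReal (massBound K m)
  deriv : ∀ t i, UnifDeriv ν (fun τ => S (t + τ) i) (S' t i)
  rate_eq : ∀ t i, ∀ᵐ y ∂ν, S' t i y = ∑' m, rate V ν pos (S t) m i y

theorem sqrt_two_le_exp_half : Real.sqrt 2 ≤ Real.exp (1 / 2) := by
  refine Real.sqrt_le_iff.mpr ⟨(Real.exp_pos _).le, ?_⟩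
  rw [← Real.exp_nat_mul]
  have := Real.add_one_le_exp (1 : ℝ)
  norm_num
  linarith

theorem norm_word_update_le {ι : Type*} [DecidableEq ι] {l : List ι} (hl : l.Nodup) {b : ι}
    (hb : b ∈ l) {A : ι → B} {r : ℝ} (hr : 1 ≤ r) (h : ∀ c, ‖A c‖ ≤ r) (x : B) :
    ‖word l (Function.update A b x)‖ ≤ r ^ l.length * ‖x‖ := by
  obtain ⟨s, t, rfl⟩ := List.append_of_mem hb
  rw [List.nodup_middle, List.nodup_cons] at hl
  have hs : b ∉ s := fun h => hl.1 (List.mem_append_left _ h)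
  have ht : b ∉ t := fun h => hl.1 (List.mem_append_right _ h)
  rw [word_append, word_cons, Function.update_self,
    word_congr (A' := A) (fun c hc => Function.update_of_ne (by rintro rfl; exact hs hc) _ _),
    word_congr (l := t) (A' := A)
      (fun c hc => Function.update_of_ne (by rintro rfl; exact ht hc) _ _)]
  have h1 := norm_word_le s h
  have h2 := norm_word_le t h
  calc ‖word s A * (x * word t A)‖ ≤ ‖word s A‖ * (‖x‖ * ‖word t A‖) :=
        (norm_mul_le _ _).trans (mul_le_mul_of_nonneg_left (norm_mul_le _ _) (norm_nonneg _))
    _ ≤ r ^ s.length * (‖x‖ * r ^ t.length) := by gcongr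
    _ = r ^ (s.length + t.length) * ‖x‖ := by ring
    _ ≤ _ := by
        refine mul_le_mul_of_nonneg_right (pow_le_pow_right₀ hr ?_) (norm_nonneg _)
        simp

theorem summable_rate_bound (K : ℝ) :
    Summable fun m : ℕ => Real.sqrt 2 ^ (m + 1) * (((m : ℝ) + 1) * massBound K m) := by
  have h : ∀ m : ℕ, Real.sqrt 2 ^ (m + 1) * (((m : ℝ) + 1) * massBound K m) =
      K * (Real.sqrt 2 * Real.exp (-1)) ^ (m + 1) := by
    intro m
    rw [mul_massBound, mul_pow, ← Real.exp_nat_mul]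
    push_cast
    ring_nf
  simp_rw [h]
  refine Summable.mul_left _ ((summable_nat_add_iff 1).mpr
    (summable_geometric_of_lt_one (by positivity) ?_))
  calc Real.sqrt 2 * Real.exp (-1) ≤ Real.exp (1 / 2) * Real.exp (-1) :=
        mul_le_mul_of_nonneg_right sqrt_two_le_exp_half (Real.exp_pos _).le
    _ = Real.exp (-(1 / 2)) := by rw [← Real.exp_add]; norm_num
    _ < 1 := by rw [Real.exp_lt_one_iff]; norm_num

variable {V : Interaction d} {K : ℝ} {ν : Measure Y} [IsFiniteMeasure ν] {pos : Y → Pt d}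
  {S S' : ℝ → Idx → Y → B}

theorem SpinFlow.hasSum_eval_deriv [CompleteSpace B] (hF : SpinFlow V K ν pos S S') (hK : 0 ≤ K)
    {T : Term d} (hT : T.mass ν pos < ⊤) (t : ℝ) (k : T.κ) (b : T.ι) :
    Integrable (fun y : T.ι → Y => (T.kernel k fun c => pos (y c)) •
      word (T.order k) (Function.update (fun c => S t (T.label k c) (y c)) b
        (S' t (T.label k b) (y b)))) (Measure.pi fun _ => ν) ∧
    HasSum (fun m => ∫ y, (T.kernel k fun c => pos (y c)) •
      word (T.order k) (Function.update (fun c => S t (T.label k c) (y c)) b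
        (rate V ν pos (S t) m (T.label k b) (y b))) ∂(Measure.pi fun _ => ν))
      (∫ y, (T.kernel k fun c => pos (y c)) •
      word (T.order k) (Function.update (fun c => S t (T.label k c) (y c)) b
        (S' t (T.label k b) (y b))) ∂(Measure.pi fun _ => ν)) := by
  have h2 : (1 : ℝ) ≤ Real.sqrt 2 := Real.one_le_sqrt.mpr (by norm_num)
  have hint := fun m => (eval_deriv hF.measurable_pos hT (hF.aesm t) (hF.norm_le t) m
    ENNReal.ofReal_lt_top (hF.mass_le m)).1 k b
  have hS : ∀ᵐ y ∂ν, ∀ i, ‖S t i y‖ ≤ Real.sqrt 2 := ae_all_iff.mpr (hF.norm_le t)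
  have hSa : ∀ᵐ y ∂(Measure.pi fun _ : T.ι => ν), ∀ c i, ‖S t i (y c)‖ ≤ Real.sqrt 2 :=
    ae_all_iff.mpr fun c => ae_pi_eval hS c
  have hva : ∀ᵐ y ∂(Measure.pi fun _ : T.ι => ν), ∀ m,
      pointMass V m ν pos (y b) ≤ ENNReal.ofReal (massBound K m) :=
    ae_pi_eval (ae_all_iff.mpr hF.mass_le) b
  have hrate : ∀ᵐ y ∂(Measure.pi fun _ : T.ι => ν), ∀ m,
      ‖rate V ν pos (S t) m (T.label k b) (y b)‖ ≤
        Real.sqrt 2 ^ (m + 1) * (((m : ℝ) + 1) * massBound K m) := by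
    filter_upwards [hSa, hva] with y hy hy' m
    exact norm_rate_le (hF.norm_le t) (massBound_nonneg hK m) (hy b) (hy' m) _
  have hgi : Integrable (fun y : T.ι → Y => T.kernel k fun c => pos (y c))
      (Measure.pi fun _ => ν) :=
    ⟨(measurable_kernel T hF.measurable_pos k).aestronglyMeasurable, lintegral_kernel_lt_top hT k⟩
  have hbound : ∀ᵐ y ∂(Measure.pi fun _ : T.ι => ν), ∀ m,
      ‖(T.kernel k fun c => pos (y c)) •
        word (T.order k) (Function.update (fun c => S t (T.label k c) (y c)) b
        (rate V ν pos (S t) m (T.label k b) (y b)))‖ ≤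
      ‖T.kernel k fun c => pos (y c)‖ * (Real.sqrt 2 ^ T.deg *
        (Real.sqrt 2 ^ (m + 1) * (((m : ℝ) + 1) * massBound K m))) := by
    filter_upwards [hSa, hrate] with y hy hr m
    rw [norm_smul, ← T.length_order k]
    refine mul_le_mul_of_nonneg_left ?_ (norm_nonneg _)
    refine (norm_word_update_le (T.nodup k) (T.complete k b) h2 (fun c => hy c _) _).trans ?_
    exact mul_le_mul_of_nonneg_left (hr m) (by positivity)
  have hsum := hasSum_integral_of_summable_integral_norm hint (by
    refine Summable.of_nonneg_of_le (fun m => integral_nonneg fun _ => norm_nonneg _)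
      (fun m => ?_) (((summable_rate_bound K).mul_left (Real.sqrt 2 ^ T.deg)).mul_left
        (∫ y, ‖T.kernel k fun c => pos (y c)‖ ∂(Measure.pi fun _ : T.ι => ν)))
    rw [← integral_mul_const]
    refine integral_mono_ae (hint m).norm (hgi.norm.mul_const _) ?_
    filter_upwards [hbound] with y hy using hy m)
  have hae : ∀ᵐ y ∂(Measure.pi fun _ : T.ι => ν),
      (∑' m, (T.kernel k fun c => pos (y c)) •
        word (T.order k) (Function.update (fun c => S t (T.label k c) (y c)) b
        (rate V ν pos (S t) m (T.label k b) (y b)))) = (T.kernel k fun c => pos (y c)) •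
      word (T.order k) (Function.update (fun c => S t (T.label k c) (y c)) b
        (S' t (T.label k b) (y b))) := by
    filter_upwards [hrate, ae_pi_eval (hF.rate_eq t (T.label k b)) b] with y hr he
    obtain ⟨P, Q, hPQ⟩ := exists_word_update (T.nodup k) (T.complete k b)
      (fun c => S t (T.label k c) (y c))
    have hs : Summable fun m => rate V ν pos (S t) m (T.label k b) (y b) :=
      Summable.of_norm_bounded (summable_rate_bound K) hr
    simp_rw [hPQ, he]
    exact (((hs.hasSum.mul_left P).mul_right Q).const_smul _).tsum_eq
  refine ⟨?_, ?_⟩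
  · have hb : ∀ᵐ y ∂(Measure.pi fun _ : T.ι => ν), ‖(T.kernel k fun c => pos (y c)) •
      word (T.order k) (Function.update (fun c => S t (T.label k c) (y c)) b
        (S' t (T.label k b) (y b)))‖ ≤ ‖T.kernel k fun c => pos (y c)‖ * (Real.sqrt 2 ^ T.deg *
        ∑' m : ℕ, (Real.sqrt 2 ^ (m + 1) * (((m : ℝ) + 1) * massBound K m))) := by
      filter_upwards [hbound, hae] with y hy he
      rw [← he, ← tsum_mul_left, ← tsum_mul_left]
      exact tsum_of_norm_bounded
        (((summable_rate_bound K).mul_left _).mul_left _).hasSum hy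
    refine Integrable.mono' (hgi.norm.mul_const _) ?_ hb
    refine (aestronglyMeasurable_of_tendsto_ae (u := atTop)
      (f := fun (s : ℕ) (y : T.ι → Y) => ∑ m ∈ Finset.range s, (T.kernel k fun c => pos (y c)) •
        word (T.order k) (Function.update (fun c => S t (T.label k c) (y c)) b
        (rate V ν pos (S t) m (T.label k b) (y b))))
      (fun s => (integrable_finsetSum _ fun m _ => hint m).aestronglyMeasurable) ?_)
    filter_upwards [hbound, hae] with y hy he
    rw [← he]
    exact (Summable.of_norm_bounded
      (((summable_rate_bound K).mul_left _).mul_left _) hy).hasSum.tendsto_sum_nat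
  · rw [integral_congr_ae hae] at hsum
    exact hsum

theorem SpinFlow.unifDeriv_word (hF : SpinFlow V K ν pos S S') (T : Term d) (t : ℝ) (k : T.κ) :
    UnifDeriv (Measure.pi fun _ : T.ι => ν)
      (fun τ y => word (T.order k) fun c => S (t + τ) (T.label k c) (y c))
      (fun y => ∑ b, word (T.order k) (Function.update
        (fun c => S t (T.label k c) (y c)) b (S' t (T.label k b) (y b)))) := by
  have h1 : ∀ c, UnifDeriv (Measure.pi fun _ : T.ι => ν)
      (fun τ y => S (t + τ) (T.label k c) (y c)) (fun y => S' t (T.label k c) (y c)) := by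
    intro c ε hε
    filter_upwards [hF.deriv t (T.label k c) ε hε] with τ hτ using ae_pi_eval hτ c
  have h2 : ∀ τ : ℝ, ∀ᵐ y ∂(Measure.pi fun _ : T.ι => ν), ∀ c,
      ‖S (t + τ) (T.label k c) (y c)‖ ≤ Real.sqrt 2 :=
    fun τ => ae_all_iff.mpr fun c => ae_pi_eval (hF.norm_le _ _) c
  have h3 := UnifDeriv.word (T.order k) h1 h2
  have hw : ∀ y : T.ι → Y, wordD (T.order k) (fun c => S (t + 0) (T.label k c) (y c))
      (fun c => S' t (T.label k c) (y c)) = ∑ b, word (T.order k) (Function.update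
        (fun c => S t (T.label k c) (y c)) b (S' t (T.label k b) (y b))) := by
    intro y
    rw [add_zero]
    exact wordD_eq_sum_univ (T.nodup k) (T.complete k) _ _
  exact (funext hw) ▸ h3

theorem SpinFlow.hasDerivAt_eval_shift [CompleteSpace B] (hF : SpinFlow V K ν pos S S')
    (hK : 0 ≤ K) {T : Term d} (hT : T.mass ν pos < ⊤) (t : ℝ) (k : T.κ) :
    HasDerivAt (fun τ => ∫ y, (T.kernel k fun c => pos (y c)) • word (T.order k)
        (fun c => S (t + τ) (T.label k c) (y c)) ∂(Measure.pi fun _ : T.ι => ν))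
      (∑ b, ∫ y, (T.kernel k fun c => pos (y c)) •
      word (T.order k) (Function.update (fun c => S t (T.label k c) (y c)) b
        (S' t (T.label k b) (y b))) ∂(Measure.pi fun _ => ν)) 0 := by
  have hi := fun b => (hF.hasSum_eval_deriv hK hT t k b).1
  rw [← integral_finsetSum _ fun b _ => hi b]
  simp_rw [← Finset.smul_sum]
  refine (hF.unifDeriv_word T t k).hasDerivAt_integral
    ⟨(measurable_kernel T hF.measurable_pos k).aestronglyMeasurable,
      lintegral_kernel_lt_top hT k⟩
    (fun τ => integrable_eval hF.measurable_pos hT k (hF.aesm _) (hF.norm_le _)) ?_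
  simp_rw [Finset.smul_sum]
  exact integrable_finsetSum _ fun b _ => hi b

/-- The time derivative of the value of a term. -/
theorem SpinFlow.hasDerivAt_eval [CompleteSpace B] (hF : SpinFlow V K ν pos S S') (hK : 0 ≤ K)
    {T : Term d} (hT : T.mass ν pos < ⊤) (t : ℝ) :
    Summable (fun m => (T.deriv V m).eval ν pos (S t)) ∧
    HasDerivAt (fun s => T.eval ν pos (S s)) (∑' m, (T.deriv V m).eval ν pos (S t)) t := by
  have hsum : HasSum (fun m => (T.deriv V m).eval ν pos (S t)) (∑ k, ∑ b,
      ∫ y, (T.kernel k fun c => pos (y c)) •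
      word (T.order k) (Function.update (fun c => S t (T.label k c) (y c)) b
        (S' t (T.label k b) (y b))) ∂(Measure.pi fun _ => ν)) := by
    simp_rw [fun m => (eval_deriv hF.measurable_pos hT (hF.aesm t) (hF.norm_le t) m
      ENNReal.ofReal_lt_top (hF.mass_le m)).2]
    exact hasSum_sum fun k _ => hasSum_sum fun b _ => (hF.hasSum_eval_deriv hK hT t k b).2
  refine ⟨hsum.summable, ?_⟩
  rw [hsum.tsum_eq]
  have hshift : HasDerivAt (fun τ => T.eval ν pos (S (t + τ))) (∑ k, ∑ b,
      ∫ y, (T.kernel k fun c => pos (y c)) •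
      word (T.order k) (Function.update (fun c => S t (T.label k c) (y c)) b
        (S' t (T.label k b) (y b))) ∂(Measure.pi fun _ => ν)) 0 :=
    HasDerivAt.fun_sum fun k _ => hF.hasDerivAt_eval_shift hK hT t k
  have h := HasDerivAt.comp_sub_const (f := fun τ => T.eval ν pos (S (t + τ))) t t
    (by rwa [sub_self])
  simpa using h

end SpinFlow

/-! ## Taylor expansion in time -/

section Taylor

variable {E : Type*} [NormedAddCommGroup E] [NormedSpace ℝ E]

theorem norm_taylor_le_of_nonneg (n : ℕ) {C : ℝ} (f : ℕ → ℝ → E)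
    (hf : ∀ j t, HasDerivAt (f j) (f (j + 1) t) t) (hC : ∀ t, ‖f n t‖ ≤ C) {t : ℝ} (ht : 0 ≤ t) :
    ‖f 0 t - ∑ j ∈ Finset.range n, (t ^ j / (j.factorial : ℝ)) • f j 0‖ ≤
      C * (t ^ n / (n.factorial : ℝ)) := by
  induction n generalizing f t with
  | zero => simpa using hC t
  | succ n ih =>
    let g : ℝ → E := fun t => f 0 t - ∑ j ∈ Finset.range (n + 1), (t ^ j / (j.factorial : ℝ)) • f j 0
    let g' : ℝ → E := fun t => f 1 t - ∑ j ∈ Finset.range n, (t ^ j / (j.factorial : ℝ)) • f (j + 1) 0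
    have hg : ∀ x, HasDerivAt g (g' x) x := by
      intro x
      refine (hf 0 x).sub ?_
      have h1 : (∑ j ∈ Finset.range n, (x ^ j / (j.factorial : ℝ)) • f (j + 1) 0) =
          ∑ j ∈ Finset.range (n + 1), ((j : ℝ) * x ^ (j - 1) / (j.factorial : ℝ)) • f j 0 := by
        rw [Finset.sum_range_succ']
        simp only [Nat.cast_zero, zero_mul, zero_div, zero_smul, add_zero]
        refine Finset.sum_congr rfl fun j _ => ?_
        congr 1
        rw [Nat.add_sub_cancel, Nat.factorial_succ]
        push_cast
        have : (j.factorial : ℝ) ≠ 0 := by positivity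
        field_simp
      rw [h1]
      refine HasDerivAt.fun_sum fun j _ => ?_
      exact ((hasDerivAt_pow j x).div_const _).smul_const _
    have hg' : ∀ x, 0 ≤ x → ‖g' x‖ ≤ C * (x ^ n / (n.factorial : ℝ)) := fun x hx =>
      ih (fun j => f (j + 1)) (fun j t => hf (j + 1) t) hC hx
    have hB : ∀ x, HasDerivAt (fun x : ℝ => C * (x ^ (n + 1) / ((n + 1).factorial : ℝ)))
        (C * (x ^ n / (n.factorial : ℝ))) x := by
      intro x
      have h2 := ((hasDerivAt_pow (n + 1) x).div_const ((n + 1).factorial : ℝ)).const_mul C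
      refine h2.congr_deriv ?_
      rw [Nat.factorial_succ]
      push_cast
      have : (n.factorial : ℝ) ≠ 0 := by positivity
      have : (n : ℝ) + 1 ≠ 0 := by positivity
      field_simp
    have h0 : g 0 = 0 := by
      simp [g, Finset.sum_range_succ']
    refine image_norm_le_of_norm_deriv_right_le_deriv_boundary (a := 0) (b := t) (f := g)
      (f' := g') (fun x _ => (hg x).continuousAt.continuousWithinAt)
      (fun x _ => (hg x).hasDerivWithinAt) (by simp [h0]) hB
      (fun x hx => hg' x hx.1) ⟨ht, le_rfl⟩

theorem norm_taylor_le (n : ℕ) {C : ℝ} (f : ℕ → ℝ → E)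
    (hf : ∀ j t, HasDerivAt (f j) (f (j + 1) t) t) (hC : ∀ t, ‖f n t‖ ≤ C) (t : ℝ) :
    ‖f 0 t - ∑ j ∈ Finset.range n, (t ^ j / (j.factorial : ℝ)) • f j 0‖ ≤
      C * (|t| ^ n / (n.factorial : ℝ)) := by
  rcases le_total 0 t with ht | ht
  · rw [abs_of_nonneg ht]
    exact norm_taylor_le_of_nonneg n f hf hC ht
  · have h := norm_taylor_le_of_nonneg n (C := C) (fun j s => (-1 : ℝ) ^ j • f j (-s))
      (fun j s => ?_) (fun s => ?_) (neg_nonneg.mpr ht)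
    · simp only [pow_zero, neg_neg, one_smul, neg_zero, smul_smul] at h
      rw [abs_of_nonpos ht]
      convert h using 5 with j
      rw [div_mul_eq_mul_div, ← mul_pow]
      simp
    · have h1 := (HasDerivAt.scomp s (hf j (-s)) (hasDerivAt_neg s)).const_smul ((-1 : ℝ) ^ j)
      refine h1.congr_deriv ?_
      rw [smul_smul, pow_succ]
    · rw [norm_smul, norm_pow, norm_neg, norm_one, one_pow, one_mul]
      exact hC _

end Taylor

section Family

variable {d : ℕ}

/-- A family of terms together with bounds for their masses. -/
structure Family (d : ℕ) where
  Ω : Type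
  term : Ω → Term d
  bd : Ω → ℝ≥0∞

namespace Family

/-- The weighted mass of a family. -/
def weight (r : ℝ) (F : Family d) : ℝ≥0∞ :=
  ∑' ω, ENNReal.ofReal (Real.exp (r * (F.term ω).deg)) * F.bd ω

/-- The family of the derived terms. -/
def deriv (V : Interaction d) (K : ℝ) (F : Family d) : Family d where
  Ω := F.Ω × ℕ
  term p := (F.term p.1).deriv V p.2
  bd p := (F.term p.1).deg * ((p.2 + 1) * ENNReal.ofReal (massBound K p.2)) * F.bd p.1

theorem tsum_ofReal_exp_le {r : ℝ} (hr : r ≤ 3 / 4) {K : ℝ} (hK : 0 ≤ K) :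
    ∑' m : ℕ, ENNReal.ofReal (Real.exp (r * m)) * ((m + 1) * ENNReal.ofReal (massBound K m)) ≤
      ENNReal.ofReal (5 * K) := by
  have h45 : Real.exp (-(1 / 4)) ≤ 4 / 5 := by
    have h1 := Real.add_one_le_exp (1 / 4 : ℝ)
    rw [Real.exp_neg, inv_le_comm₀ (Real.exp_pos _) (by norm_num)]
    linarith
  have h : ∀ m : ℕ, ENNReal.ofReal (Real.exp (r * m)) *
      ((m + 1) * ENNReal.ofReal (massBound K m)) ≤ ENNReal.ofReal (K * (4 / 5) ^ m) := by
    intro m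
    have e : ((m : ℝ≥0∞) + 1) = ENNReal.ofReal ((m : ℝ) + 1) := by
      rw [ENNReal.ofReal_add (by positivity) (by positivity)]; simp
    rw [e, ← ENNReal.ofReal_mul (by positivity), ← ENNReal.ofReal_mul (by positivity),
      mul_massBound, mul_left_comm, ← Real.exp_add]
    refine ENNReal.ofReal_le_ofReal (mul_le_mul_of_nonneg_left ?_ hK)
    refine le_trans ?_ (pow_le_pow_left₀ (Real.exp_pos _).le h45 m)
    rw [← Real.exp_nat_mul]
    refine Real.exp_le_exp.mpr ?_
    have : r * m ≤ 3 / 4 * m := mul_le_mul_of_nonneg_right hr (Nat.cast_nonneg m)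
    linarith
  refine (ENNReal.tsum_le_tsum h).trans ?_
  rw [← ENNReal.ofReal_tsum_of_nonneg (fun m => by positivity)
    ((summable_geometric_of_lt_one (by norm_num) (by norm_num)).mul_left K), tsum_mul_left,
    tsum_geometric_of_lt_one (by norm_num) (by norm_num)]
  refine ENNReal.ofReal_le_ofReal ?_
  linarith

theorem weight_deriv_le (V : Interaction d) {K : ℝ} (hK : 0 ≤ K) (F : Family d) {r δ : ℝ}
    (hr : r ≤ 3 / 4) (hδ : 0 < δ) :
    (F.deriv V K).weight r ≤ ENNReal.ofReal (5 * K / δ) * F.weight (r + δ) := by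
  have h1 : (F.deriv V K).weight r = ∑' ω, (∑' m : ℕ, ENNReal.ofReal (Real.exp (r * m)) *
      ((m + 1) * ENNReal.ofReal (massBound K m))) *
        (ENNReal.ofReal (Real.exp (r * (F.term ω).deg)) * ((F.term ω).deg * F.bd ω)) := by
    simp_rw [← ENNReal.tsum_mul_right]
    refine (ENNReal.tsum_prod' (f := fun p : F.Ω × ℕ => _)).trans ?_
    refine tsum_congr fun ω => tsum_congr fun m => ?_
    simp only [deriv]
    rw [Term.deg_deriv]
    push_cast
    rw [mul_add, Real.exp_add, ENNReal.ofReal_mul (Real.exp_pos _).le]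
    ring
  rw [h1, weight, ← ENNReal.tsum_mul_left]
  refine ENNReal.tsum_le_tsum fun ω => ?_
  have h2 : ENNReal.ofReal (Real.exp (r * (F.term ω).deg)) * (F.term ω).deg ≤
      ENNReal.ofReal (δ⁻¹) * ENNReal.ofReal (Real.exp ((r + δ) * (F.term ω).deg)) := by
    rw [← ENNReal.ofReal_natCast, ← ENNReal.ofReal_mul (Real.exp_pos _).le,
      ← ENNReal.ofReal_mul (by positivity)]
    refine ENNReal.ofReal_le_ofReal ?_
    rw [add_mul, Real.exp_add, mul_left_comm]
    refine mul_le_mul_of_nonneg_left ?_ (Real.exp_pos _).le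
    rw [le_inv_mul_iff₀ hδ]
    have := Real.add_one_le_exp (δ * (F.term ω).deg)
    linarith
  calc _ ≤ ENNReal.ofReal (5 * K) * ((ENNReal.ofReal δ⁻¹ *
        ENNReal.ofReal (Real.exp ((r + δ) * (F.term ω).deg))) * F.bd ω) := by
        refine mul_le_mul' (tsum_ofReal_exp_le hr hK) ?_
        rw [← mul_assoc]
        exact mul_le_mul_left h2 _
    _ = _ := by
        rw [div_eq_mul_inv, ENNReal.ofReal_mul (p := 5 * K) (q := δ⁻¹) (by positivity)]
        ring

/-- The iterated derivatives of a family. -/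
def iterDeriv (V : Interaction d) (K : ℝ) (F : Family d) : ℕ → Family d
  | 0 => F
  | n + 1 => (iterDeriv V K F n).deriv V K

theorem weight_mono (F : Family d) {r r' : ℝ} (h : r ≤ r') : F.weight r ≤ F.weight r' := by
  refine ENNReal.tsum_le_tsum fun ω => mul_le_mul_left (ENNReal.ofReal_le_ofReal
    (Real.exp_le_exp.mpr (mul_le_mul_of_nonneg_right h (Nat.cast_nonneg _)))) _

theorem weight_iterDeriv_le (V : Interaction d) {K : ℝ} (hK : 0 ≤ K) (F : Family d) (n : ℕ) :
    (F.iterDeriv V K n).weight (1 / 2) ≤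
      ENNReal.ofReal ((20 * K * n) ^ n) * F.weight (3 / 4) := by
  rcases Nat.eq_zero_or_pos n with rfl | hn
  · simpa [iterDeriv] using F.weight_mono (by norm_num)
  have hn' : (0 : ℝ) < n := by exact_mod_cast hn
  have h : ∀ j : ℕ, (F.iterDeriv V K j).weight (3 / 4 - j * (1 / (4 * n))) ≤
      ENNReal.ofReal ((20 * K * n) ^ j) * F.weight (3 / 4) := by
    intro j
    induction j with
    | zero => simp [iterDeriv]
    | succ j ih =>
      have h0 : (0 : ℝ) < 1 / (4 * n) := by positivity
      refine (weight_deriv_le V hK _ (δ := 1 / (4 * n)) ?_ h0).trans ?_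
      · have : 0 ≤ ((j + 1 : ℕ) : ℝ) * (1 / (4 * n)) := by positivity
        linarith
      · have e : 3 / 4 - ((j + 1 : ℕ) : ℝ) * (1 / (4 * n)) + 1 / (4 * n) =
            3 / 4 - j * (1 / (4 * n)) := by push_cast; ring
        rw [e, pow_succ', ENNReal.ofReal_mul (by positivity), mul_assoc]
        refine mul_le_mul' (ENNReal.ofReal_le_ofReal ?_) ih
        rw [div_div_eq_mul_div]
        linarith
  have := h n
  rwa [show (3 / 4 - (n : ℝ) * (1 / (4 * n))) = 1 / 2 by field_simp; norm_num] at this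

variable {Y : Type*} [MeasurableSpace Y]
variable {B : Type*} [NormedRing B] [NormedAlgebra ℂ B]

/-- The value of a family of terms. -/
def eval (F : Family d) (ν : Measure Y) (pos : Y → Pt d) (S : Idx → Y → B) : B :=
  ∑' ω, (F.term ω).eval ν pos S

/-- The bounds of the family hold for the given points. -/
def IsBoundedOn (F : Family d) (ν : Measure Y) (pos : Y → Pt d) : Prop :=
  ∀ ω, (F.term ω).mass ν pos ≤ F.bd ω

variable {V : Interaction d} {K : ℝ} {ν : Measure Y} [IsFiniteMeasure ν] {pos : Y → Pt d}

theorem IsBoundedOn.deriv {F : Family d} (h : F.IsBoundedOn ν pos) (hpos : Measurable pos)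
    (hV : ∀ m, ∀ᵐ y ∂ν, pointMass V m ν pos y ≤ ENNReal.ofReal (massBound K m)) :
    (F.deriv V K).IsBoundedOn ν pos := by
  intro p
  exact (mass_deriv_le V (F.term p.1) p.2 ν hpos (hV p.2)).trans (mul_le_mul_right (h p.1) _)

theorem IsBoundedOn.iterDeriv {F : Family d} (h : F.IsBoundedOn ν pos) (hpos : Measurable pos)
    (hV : ∀ m, ∀ᵐ y ∂ν, pointMass V m ν pos y ≤ ENNReal.ofReal (massBound K m)) (n : ℕ) :
    (F.iterDeriv V K n).IsBoundedOn ν pos := by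
  induction n with
  | zero => exact h
  | succ n ih => exact ih.deriv hpos hV

variable [NormOneClass B]

/-- The bound for the value of a term of a family. -/
def valueBound (F : Family d) (ω : F.Ω) : ℝ :=
  (ENNReal.ofReal (Real.exp (1 / 2 * (F.term ω).deg)) * F.bd ω).toReal

theorem summable_valueBound {F : Family d} (h : F.weight (1 / 2) < ⊤) : Summable F.valueBound :=
  ENNReal.summable_toReal h.ne

theorem tsum_valueBound {F : Family d} (h : F.weight (1 / 2) < ⊤) :
    ∑' ω, F.valueBound ω = (F.weight (1 / 2)).toReal :=
  (ENNReal.tsum_toReal_eq fun ω => (ENNReal.ne_top_of_tsum_ne_top h.ne ω)).symm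

theorem bd_lt_top {F : Family d} (h : F.weight (1 / 2) < ⊤) (ω : F.Ω) : F.bd ω < ⊤ := by
  have h1 := ENNReal.ne_top_of_tsum_ne_top h.ne ω
  rw [lt_top_iff_ne_top]
  intro h2
  rw [h2, ENNReal.mul_top (by simpa using Real.exp_pos _)] at h1
  exact h1 rfl

theorem norm_eval_term_le {F : Family d} (h : F.weight (1 / 2) < ⊤) (hF : F.IsBoundedOn ν pos)
    {S : Idx → Y → B} (hS : ∀ i, ∀ᵐ y ∂ν, ‖S i y‖ ≤ Real.sqrt 2) (ω : F.Ω) :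
    ‖(F.term ω).eval ν pos S‖ ≤ F.valueBound ω := by
  rw [valueBound, ← ENNReal.ofReal_le_iff_le_toReal (ENNReal.ne_top_of_tsum_ne_top h.ne ω),
    ofReal_norm]
  refine (norm_eval_le (F.term ω) hS).trans (mul_le_mul' (ENNReal.ofReal_le_ofReal ?_) (hF ω))
  rw [mul_comm, Real.exp_nat_mul]
  exact pow_le_pow_left₀ (Real.sqrt_nonneg _) sqrt_two_le_exp_half _

theorem norm_eval_le {F : Family d} (h : F.weight (1 / 2) < ⊤) (hF : F.IsBoundedOn ν pos)
    {S : Idx → Y → B} (hS : ∀ i, ∀ᵐ y ∂ν, ‖S i y‖ ≤ Real.sqrt 2) :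
    ‖F.eval ν pos S‖ ≤ (F.weight (1 / 2)).toReal := by
  rw [← tsum_valueBound h]
  exact tsum_of_norm_bounded (summable_valueBound h).hasSum (norm_eval_term_le h hF hS)

theorem hasDerivAt_eval [CompleteSpace B] {S S' : ℝ → Idx → Y → B}
    (hS : SpinFlow V K ν pos S S') (hK : 0 ≤ K) {F : Family d} (hF : F.IsBoundedOn ν pos)
    (h : F.weight (1 / 2) < ⊤) (h' : (F.deriv V K).weight (1 / 2) < ⊤) (t : ℝ) :
    HasDerivAt (fun s => F.eval ν pos (S s)) ((F.deriv V K).eval ν pos (S t)) t := by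
  have hF' := hF.deriv hS.measurable_pos hS.mass_le
  have hsum := summable_valueBound h'
  have hterm := fun ω s => (hS.hasDerivAt_eval hK ((hF ω).trans_lt (bd_lt_top h ω)) s)
  have hsum2 : ∀ ω, Summable fun m => (F.deriv V K).valueBound (ω, m) :=
    fun ω => hsum.prod_factor ω
  have hb : ∀ ω s, ‖∑' m, ((F.term ω).deriv V m).eval ν pos (S s)‖ ≤
      ∑' m, (F.deriv V K).valueBound (ω, m) := fun ω s =>
    tsum_of_norm_bounded (hsum2 ω).hasSum fun m => norm_eval_term_le h' hF' (hS.norm_le s) (ω, m)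
  have h1 := hasDerivAt_tsum (𝕜 := ℝ) (u := fun ω => ∑' m, (F.deriv V K).valueBound (ω, m))
    hsum.prod (fun ω s => (hterm ω s).2) hb (y₀ := t)
    (Summable.of_norm_bounded (summable_valueBound h) (norm_eval_term_le h hF (hS.norm_le t))) t
  refine h1.congr_deriv ?_
  have h2 : Summable fun p : F.Ω × ℕ => ((F.term p.1).deriv V p.2).eval ν pos (S t) :=
    Summable.of_norm_bounded hsum (norm_eval_term_le h' hF' (hS.norm_le t))
  exact (h2.tsum_prod).symm

/-- The Taylor remainder of the value of a family. -/
theorem norm_eval_sub_taylor_le [CompleteSpace B] {S S' : ℝ → Idx → Y → B}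
    (hS : SpinFlow V K ν pos S S') (hK : 0 ≤ K) {F : Family d} (hF : F.IsBoundedOn ν pos)
    (h : F.weight (3 / 4) < ⊤) (n : ℕ) (t : ℝ) :
    ‖F.eval ν pos (S t) - ∑ j ∈ Finset.range n, (t ^ j / (j.factorial : ℝ)) •
      (F.iterDeriv V K j).eval ν pos (S 0)‖ ≤
        (20 * K * Real.exp 1 * |t|) ^ n * (F.weight (3 / 4)).toReal := by
  have hw : ∀ j, (F.iterDeriv V K j).weight (1 / 2) < ⊤ := fun j =>
    (weight_iterDeriv_le V hK F j).trans_lt (ENNReal.mul_lt_top ENNReal.ofReal_lt_top h)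
  have hb := fun j => hF.iterDeriv hS.measurable_pos hS.mass_le j
  refine (norm_taylor_le n (C := (20 * K * n) ^ n * (F.weight (3 / 4)).toReal)
    (fun j s => (F.iterDeriv V K j).eval ν pos (S s))
    (fun j s => hasDerivAt_eval hS hK (hb j) (hw j) (hw (j + 1)) s) (fun s => ?_) t).trans ?_
  · refine (norm_eval_le (hw n) (hb n) (hS.norm_le s)).trans ?_
    have := ENNReal.toReal_mono (ENNReal.mul_lt_top ENNReal.ofReal_lt_top h).ne
      (weight_iterDeriv_le V hK F n)
    rwa [ENNReal.toReal_mul, ENNReal.toReal_ofReal (by positivity)] at this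
  · have h1 := Real.pow_div_factorial_le_exp (n : ℝ) (Nat.cast_nonneg n) n
    calc (20 * K * n) ^ n * (F.weight (3 / 4)).toReal * (|t| ^ n / (n.factorial : ℝ))
        = (20 * K * |t|) ^ n * ((n : ℝ) ^ n / (n.factorial : ℝ)) * (F.weight (3 / 4)).toReal := by
          rw [mul_pow, mul_pow (20 * K) |t|]; ring
      _ ≤ (20 * K * |t|) ^ n * Real.exp n * (F.weight (3 / 4)).toReal := by gcongr
      _ = _ := by
          rw [← Real.exp_one_pow, ← mul_pow]
          ring_nf

end Family

end Family

/-! ## Lattice sums as integrals -/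

section Lattice

variable {d : ℕ}

/-- The measure which gives mass `h ^ d` to each site. -/
def latticeMeasure (h : ℝ) (X : Finset (Fin d → ℤ)) : Measure X :=
  ENNReal.ofReal (h ^ d) • Measure.count

instance (h : ℝ) (X : Finset (Fin d → ℤ)) : IsFiniteMeasure (latticeMeasure h X) :=
  ⟨by
    rw [latticeMeasure, Measure.smul_apply, smul_eq_mul]
    exact ENNReal.mul_lt_top ENNReal.ofReal_lt_top (measure_lt_top _ _)⟩

/-- The position of a site. -/
def sitePt (h : ℝ) {X : Finset (Fin d → ℤ)} (k : X) : Pt d := latticePt h (k : Fin d → ℤ)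

theorem latticeMeasure_pi_singleton {ι : Type*} [Fintype ι] (h : ℝ) (X : Finset (Fin d → ℤ))
    (x : ι → X) : (Measure.pi fun _ : ι => latticeMeasure h X) {x} =
      ENNReal.ofReal (h ^ d) ^ Fintype.card ι := by
  rw [Measure.pi_singleton]
  simp [latticeMeasure]

theorem lintegral_lattice {ι : Type*} [Fintype ι] [DecidableEq ι] (h : ℝ)
    {X : Finset (Fin d → ℤ)} (f : (ι → X) → ℝ≥0∞) :
    ∫⁻ x, f x ∂(Measure.pi fun _ : ι => latticeMeasure h X) =
      ENNReal.ofReal (h ^ d) ^ Fintype.card ι * ∑ x, f x := by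
  rw [lintegral_fintype, Finset.mul_sum]
  refine Finset.sum_congr rfl fun x _ => ?_
  rw [latticeMeasure_pi_singleton, mul_comm]

theorem integral_lattice {ι : Type*} [Fintype ι] [DecidableEq ι] {h : ℝ} (hh : 0 < h)
    {X : Finset (Fin d → ℤ)} {B : Type*} [NormedAddCommGroup B] [NormedSpace ℂ B]
    [CompleteSpace B] (f : (ι → X) → B) :
    ∫ x, f x ∂(Measure.pi fun _ : ι => latticeMeasure h X) =
      ((h ^ d : ℝ) : ℂ) ^ Fintype.card ι • ∑ x, f x := by
  rw [integral_fintype Integrable.of_finite, Finset.smul_sum]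
  refine Finset.sum_congr rfl fun x _ => ?_
  rw [measureReal_def, latticeMeasure_pi_singleton, ENNReal.toReal_pow,
    ENNReal.toReal_ofReal (by positivity), ← Complex.ofReal_pow, Complex.coe_smul]

theorem pointMass_lattice_le (V : Interaction d) (m : ℕ) {h : ℝ} (hh : 0 < h)
    {X : Finset (Fin d → ℤ)} (y : X) :
    pointMass V m (latticeMeasure h X) (sitePt h) y ≤ normSup1 h (V m) := by
  refine le_trans ?_ (le_iSup _ (y : Fin d → ℤ))
  refine Finset.sum_le_sum fun l _ => ?_
  rw [lintegral_lattice, Fintype.card_fin, ← ENNReal.ofReal_pow (by positivity), ← pow_mul,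
    mul_comm d m]
  refine mul_le_mul_right ?_ _
  rw [← tsum_fintype (L := .unconditional _)]
  exact ENNReal.tsum_comp_le_tsum_of_injective (f := fun x : Fin m → X => fun a => (x a : Fin d → ℤ))
    (fun x x' hx => funext fun a => Subtype.ext (congrFun hx a))
    fun k => ‖(V m).toFun l (Fin.cons (sitePt h y) fun a => latticePt h (k a))‖ₑ

theorem normSup1_le_massBound {V : Interaction d} {h K : ℝ} (hK : V.normAt h ≤ ENNReal.ofReal K)
    (m : ℕ) : normSup1 h (V m) ≤ ENNReal.ofReal (massBound K m) := by
  have h1 := (ENNReal.le_tsum m).trans hK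
  have h2 : (0 : ℝ) < ((m : ℝ) + 1) * Real.exp ((m : ℝ) + 1) := by positivity
  rw [massBound, Real.exp_neg, mul_div_assoc, div_eq_mul_inv, ← mul_inv, mul_comm (Real.exp _),
    ← div_eq_mul_inv, ENNReal.ofReal_div_of_pos h2, ENNReal.le_div_iff_mul_le
      (Or.inl (by simpa using h2)) (Or.inl ENNReal.ofReal_ne_top), mul_comm]
  exact h1

end Lattice

/-! ## The quantum spins -/

section Quantum

variable {d N : ℕ} {X : Finset (Fin d → ℤ)}

/-- The spin operators at time zero, without the factor `h ^ d`. -/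
def quantumSpin (N : ℕ) (X : Finset (Fin d → ℤ)) (i : Idx) (k : X) : Op N X :=
  siteOp k (unitSpin N i)

theorem spinOp_eq (h : ℝ) (i : Idx) (k : X) :
    spinOp h i k = ((h ^ d : ℝ) : ℂ) • quantumSpin N X i k := by
  rw [spinOp, quantumSpin, unitSpin, siteOp_smul, smul_smul]
  push_cast
  rfl

theorem norm_quantumSpin_le (hN : 0 < N) (i : Idx) (k : X) :
    ‖quantumSpin N X i k‖ ≤ Real.sqrt 2 :=
  (norm_siteOp_le _ _).trans (norm_unitSpin_le hN i)

theorem length_normalList {p : ℕ} (l : Fin p → Idx) : (normalList l).length = p := by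
  rw [← List.toFinset_card_of_nodup (nodup_normalList l)]
  have : (normalList l).toFinset = Finset.univ := by
    ext c
    simp [mem_normalList]
  rw [this, Finset.card_univ, Fintype.card_fin]

theorem word_smul {ι B : Type*} [Ring B] [Algebra ℂ B] (c : ℂ) (l : List ι) (A : ι → B) :
    word l (fun a => c • A a) = c ^ l.length • word l A := by
  induction l with
  | nil => simp
  | cons a l ih =>
    rw [word_cons, word_cons, ih, smul_mul_smul_comm, List.length_cons, pow_succ']

theorem normalOrdered_eq_smul_word {p : ℕ} (h : ℝ) (l : Fin p → Idx) (x : Fin p → X) :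
    normalOrdered (N := N) h l x = ((h ^ d : ℝ) : ℂ) ^ p •
      word (normalList l) fun a => quantumSpin N X (l a) (x a) := by
  rw [normalOrdered_eq_word]
  simp_rw [spinOp_eq]
  rw [word_smul, length_normalList]

theorem quantumMonomial_eq_integral {h : ℝ} (hh : 0 < h) (Λ : Set (Pt d)) {p : ℕ}
    (f : Smearing d p) :
    quantumMonomial N h Λ f = ∑ l, ∫ x, f.toFun l (fun a => sitePt h (x a)) •
      word (normalList l) (fun a => quantumSpin N (sites h Λ) (l a) (x a))
        ∂(Measure.pi fun _ : Fin p => latticeMeasure h (sites h Λ)) := by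
  refine Finset.sum_congr rfl fun l _ => ?_
  rw [integral_lattice hh, Finset.smul_sum, Fintype.card_fin]
  refine Finset.sum_congr rfl fun x _ => ?_
  rw [normalOrdered_eq_smul_word, smul_comm]
  rfl

theorem norm_quantumMonomial_le (hN : 0 < N) {h : ℝ} (hh : 0 < h) (Λ : Set (Pt d)) {p : ℕ}
    (f : Smearing d p) :
    ‖quantumMonomial N h Λ f‖ₑ ≤ ENNReal.ofReal (Real.sqrt 2 ^ p) *
      ∑ l, ∫⁻ x, ‖f.toFun l (fun a => sitePt h (x a))‖ₑ
        ∂(Measure.pi fun _ : Fin p => latticeMeasure h (sites h Λ)) := by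
  rw [quantumMonomial_eq_integral hh, Finset.mul_sum]
  refine (enorm_sum_le _ _).trans (Finset.sum_le_sum fun l _ => ?_)
  refine (enorm_integral_le_lintegral_enorm _).trans ?_
  rw [← lintegral_const_mul' _ _ ENNReal.ofReal_ne_top]
  refine lintegral_mono fun x => ?_
  rw [enorm_smul, mul_comm]
  refine mul_le_mul_left ?_ _
  rw [← ofReal_norm]
  refine ENNReal.ofReal_le_ofReal ((norm_word_le _ fun c => norm_quantumSpin_le hN _ _).trans ?_)
  rw [length_normalList]

theorem sum_lintegral_succ_eq (V : Interaction d) (m : ℕ) (h : ℝ) (X : Finset (Fin d → ℤ)) :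
    ∑ l, ∫⁻ x, ‖(V m).toFun l (fun a => sitePt h (x a))‖ₑ
        ∂(Measure.pi fun _ : Fin (m + 1) => latticeMeasure h X) =
      ENNReal.ofReal (h ^ d) * ∑ y, pointMass V m (latticeMeasure h X) (sitePt h) y := by
  simp_rw [pointMass]
  rw [Finset.sum_comm, Finset.mul_sum]
  refine Finset.sum_congr rfl fun l _ => ?_
  rw [lintegral_lattice, Fintype.card_fin, pow_succ', mul_assoc]
  congr 1
  simp_rw [lintegral_lattice, Fintype.card_fin]
  rw [← Finset.mul_sum, ← (Fin.consEquiv fun _ : Fin (m + 1) => X).sum_comp,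
    Fintype.sum_prod_type]
  congr 1
  refine Finset.sum_congr rfl fun y _ => Finset.sum_congr rfl fun x _ => ?_
  congr 2
  ext1 a
  refine Fin.cases ?_ (fun a => ?_) a <;> simp

theorem summable_quantumMonomial (hN : 0 < N) {V : Interaction d} {h K : ℝ} (hh : 0 < h)
    (hK : 0 ≤ K) (hV : V.normAt h ≤ ENNReal.ofReal K) (Λ : Set (Pt d)) :
    Summable fun m => quantumMonomial N h Λ (V m) := by
  have hs := (summable_rate_bound K).mul_left (h ^ d * Fintype.card (sites h Λ))
  refine Summable.of_norm_bounded hs fun m => ?_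
  have hb := massBound_nonneg hK m
  have h1 : ‖quantumMonomial N h Λ (V m)‖ₑ ≤ ENNReal.ofReal (h ^ d * Fintype.card (sites h Λ) *
      (Real.sqrt 2 ^ (m + 1) * massBound K m)) := by
    refine (norm_quantumMonomial_le hN hh Λ (V m)).trans ?_
    rw [sum_lintegral_succ_eq]
    have h2 : ∑ y, pointMass V m (latticeMeasure h (sites h Λ)) (sitePt h) y ≤
        ENNReal.ofReal (Fintype.card (sites h Λ) * massBound K m) := by
      refine (Finset.sum_le_sum fun y _ => (pointMass_lattice_le V m hh y).trans
        (normSup1_le_massBound hV m)).trans ?_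
      rw [Finset.sum_const, Finset.card_univ, nsmul_eq_mul, ENNReal.ofReal_mul (by positivity)]
      simp
    refine (mul_le_mul_right (mul_le_mul_right h2 _) _).trans ?_
    rw [← ENNReal.ofReal_mul (by positivity), ← ENNReal.ofReal_mul (by positivity)]
    exact ENNReal.ofReal_le_ofReal (by linarith)
  rw [← ofReal_norm, ENNReal.ofReal_le_ofReal_iff (by positivity)] at h1
  refine h1.trans ?_
  have : massBound K m ≤ ((m : ℝ) + 1) * massBound K m := by
    nlinarith [(Nat.cast_nonneg m : (0 : ℝ) ≤ m)]
  gcongr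

end Quantum

/-! ## Normal-ordered operators as tensor products -/

section NormalMat

variable {d N : ℕ} {X : Finset (Fin d → ℤ)}

/-- The normal-ordered one-site monomial with exponents `n`. -/
def normalMat (N : ℕ) (n : Idx → ℕ) : SiteMat N :=
  unitSpin N .plus ^ n .plus * unitSpin N .z ^ n .z * unitSpin N .minus ^ n .minus

/-- The number of factors with a given index at a given point. -/
def siteCount {ι Y : Type*} [Fintype ι] [DecidableEq Y] (l : ι → Idx) (x : ι → Y) (k : Y)
    (j : Idx) : ℕ :=
  (Finset.univ.filter fun a => l a = j ∧ x a = k).card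

/-- The normal-ordered product of spins at given sites. -/
def normalOp {ι : Type*} [Fintype ι] (N : ℕ) (l : ι → Idx) (x : ι → X) : Op N X :=
  tensorOp fun k => normalMat N (siteCount l x k)

theorem siteCount_comp {ι ι' Y : Type*} [Fintype ι] [Fintype ι'] [DecidableEq Y] (e : ι' ≃ ι)
    (l : ι → Idx) (x : ι → Y) (k : Y) (j : Idx) :
    siteCount (l ∘ e) (x ∘ e) k j = siteCount l x k j :=
  Finset.card_equiv e fun a => by simp

theorem normalOp_comp {ι ι' : Type*} [Fintype ι] [Fintype ι'] (e : ι' ≃ ι)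
    (l : ι → Idx) (x : ι → X) : normalOp N (l ∘ e) (x ∘ e) = normalOp N l x :=
  congrArg tensorOp (funext fun k => congrArg (normalMat N) (funext fun j => siteCount_comp e l x k j))

theorem word_normalList_unitSpin {Y : Type*} [DecidableEq Y] {p : ℕ} (l : Fin p → Idx)
    (x : Fin p → Y) (k : Y) :
    (((normalList l).filter fun c => x c = k).map fun c => unitSpin N (l c)).prod =
      normalMat N (siteCount l x k) := by
  have h : ∀ j, ((((List.finRange p).filter fun a => l a = j).filter fun c => x c = k).map
      fun c => unitSpin N (l c)).prod = unitSpin N j ^ siteCount l x k j := by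
    intro j
    rw [List.filter_filter]
    have h1 : ∀ L : List (Fin p), (∀ c ∈ L, l c = j) → (L.map fun c => unitSpin N (l c)).prod =
        unitSpin N j ^ L.length := by
      intro L hL
      rw [List.map_congr_left (g := fun _ => unitSpin N j) fun c hc => by rw [hL c hc],
        List.map_const', List.prod_replicate]
    rw [h1 _ (by intro c hc; simp at hc; exact hc.2)]
    congr 1
    rw [siteCount, ← List.toFinset_card_of_nodup ((List.nodup_finRange p).filter _)]
    congr 1
    ext c
    simp [and_comm]
  rw [normalList, List.filter_append, List.filter_append, List.map_append, List.map_append,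
    List.prod_append, List.prod_append, h, h, h, normalMat]

theorem word_normalList_quantumSpin {p : ℕ} (l : Fin p → Idx) (x : Fin p → X) :
    word (normalList l) (fun a => quantumSpin N X (l a) (x a)) = normalOp N l x := by
  refine (list_prod_siteOp (normalList l) x fun a => unitSpin N (l a)).trans ?_
  exact congrArg tensorOp (funext fun k => word_normalList_unitSpin l x k)

theorem normalOrdered_eq_normalOp {p : ℕ} (h : ℝ) (l : Fin p → Idx) (x : Fin p → X) :
    normalOrdered (N := N) h l x = ((h ^ d : ℝ) : ℂ) ^ p • normalOp N l x := by
  rw [normalOrdered_eq_smul_word, word_normalList_quantumSpin]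

theorem tensorOp_conjTranspose (w : X → SiteMat N) : (tensorOp w)ᴴ = tensorOp fun k => (w k)ᴴ := by
  ext σ τ
  simp [tensorOp, Matrix.conjTranspose_apply]

theorem unitSpin_conjTranspose (i : Idx) : (unitSpin N i)ᴴ = unitSpin N i.conj := by
  rw [unitSpin, unitSpin, Matrix.conjTranspose_smul, spinMatrix_conjTranspose]
  simp

theorem Idx.conj_conj (i : Idx) : i.conj.conj = i := by cases i <;> rfl

theorem normalMat_conjTranspose (n : Idx → ℕ) :
    (normalMat N n)ᴴ = normalMat N fun i => n i.conj := by
  simp only [normalMat, Matrix.conjTranspose_mul, Matrix.conjTranspose_pow,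
    unitSpin_conjTranspose, Idx.conj, mul_assoc]

theorem normalOp_conjTranspose {ι : Type*} [Fintype ι] (l : ι → Idx) (x : ι → X) :
    (normalOp N l x)ᴴ = normalOp N (fun a => (l a).conj) x := by
  rw [normalOp, tensorOp_conjTranspose]
  refine congrArg tensorOp (funext fun k => ?_)
  rw [normalMat_conjTranspose]
  congr 1
  ext j
  refine congrArg Finset.card (Finset.filter_congr fun a _ => and_congr_left fun _ => ?_)
  exact ⟨fun h => by simp only [h, Idx.conj_conj], fun h => by simp only [← h, Idx.conj_conj]⟩

end NormalMat

/-! ## The Hamiltonian and the propagator -/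

section Hamiltonian

variable {d N : ℕ}

theorem quantumMonomial_conjTranspose {V : Interaction d} (hV : V.IsReal) (h : ℝ)
    (Λ : Set (Pt d)) (m : ℕ) :
    (quantumMonomial N h Λ (V m))ᴴ = quantumMonomial N h Λ (V m) := by
  have hinv : Function.Involutive fun (l : Fin (m + 1) → Idx) (a : Fin (m + 1)) => (l a).conj :=
    fun l => funext fun a => Idx.conj_conj _
  rw [quantumMonomial, Matrix.conjTranspose_sum, ← Equiv.sum_comp (hinv.toPerm _)]
  refine Finset.sum_congr rfl fun l _ => ?_
  rw [Matrix.conjTranspose_sum]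
  refine Finset.sum_congr rfl fun x _ => ?_
  rw [Matrix.conjTranspose_smul, normalOrdered_eq_normalOp, normalOrdered_eq_normalOp,
    Matrix.conjTranspose_smul, normalOp_conjTranspose]
  change starRingEnd ℂ _ • star (_ ^ _) • _ = _
  rw [hV, star_pow, Complex.star_def, Complex.conj_ofReal]
  have h1 : (fun a => (hinv.toPerm _ l a).conj) = l := hinv l
  rw [h1]

theorem hamiltonian_conjTranspose {V : Interaction d} (hV : V.IsReal) (h : ℝ)
    (Λ : Set (Pt d)) : (hamiltonian N h V Λ)ᴴ = hamiltonian N h V Λ := by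
  rw [hamiltonian, Matrix.conjTranspose_tsum]
  exact tsum_congr fun m => quantumMonomial_conjTranspose hV h Λ m

/-- The generator `-i s h^{-d} Ĥ` of the propagator. -/
def generator (N : ℕ) (h : ℝ) (V : Interaction d) (Λ : Set (Pt d)) : Op N (sites h Λ) :=
  (-Complex.I * (((N : ℝ) / 2 * (h ^ d)⁻¹ : ℝ) : ℂ)) • hamiltonian N h V Λ

theorem propagator_eq (h : ℝ) (V : Interaction d) (Λ : Set (Pt d)) (t : ℝ) :
    propagator N h V Λ t = NormedSpace.exp ((t : ℂ) • generator N h V Λ) := by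
  rw [propagator, generator, smul_smul]
  congr 2
  push_cast
  ring

theorem propagator_conjTranspose {V : Interaction d} (hV : V.IsReal) (h : ℝ) (Λ : Set (Pt d))
    (t : ℝ) : (propagator N h V Λ t)ᴴ = propagator N h V Λ (-t) := by
  rw [propagator, propagator, ← Matrix.exp_conjTranspose, Matrix.conjTranspose_smul,
    hamiltonian_conjTranspose hV]
  congr 2
  change starRingEnd ℂ _ = _
  rw [map_mul, map_neg, Complex.conj_I, Complex.conj_ofReal]
  push_cast
  ring

theorem propagator_zero (h : ℝ) (V : Interaction d) (Λ : Set (Pt d)) :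
    propagator N h V Λ 0 = 1 := by
  rw [propagator_eq, Complex.ofReal_zero, zero_smul, NormedSpace.exp_zero]

theorem propagator_add (h : ℝ) (V : Interaction d) (Λ : Set (Pt d)) (t r : ℝ) :
    propagator N h V Λ (t + r) = propagator N h V Λ t * propagator N h V Λ r := by
  rw [propagator_eq, propagator_eq, propagator_eq, Complex.ofReal_add, add_smul]
  exact Matrix.exp_add_of_commute _ _ (((Commute.refl _).smul_left _).smul_right _)

theorem propagator_neg_mul (h : ℝ) (V : Interaction d) (Λ : Set (Pt d)) (t : ℝ) :
    propagator N h V Λ (-t) * propagator N h V Λ t = 1 := by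
  rw [← propagator_add, neg_add_cancel, propagator_zero]

theorem propagator_mul_neg (h : ℝ) (V : Interaction d) (Λ : Set (Pt d)) (t : ℝ) :
    propagator N h V Λ t * propagator N h V Λ (-t) = 1 := by
  rw [← propagator_add, add_neg_cancel, propagator_zero]

theorem quantumEvolution_eq {V : Interaction d} (hV : V.IsReal) (h : ℝ) (Λ : Set (Pt d)) (t : ℝ)
    (B : Op N (sites h Λ)) :
    quantumEvolution N h V Λ t B = propagator N h V Λ (-t) * B * propagator N h V Λ t := by
  rw [quantumEvolution, propagator_conjTranspose hV]

theorem quantumEvolution_add_time {V : Interaction d} (hV : V.IsReal) (h : ℝ) (Λ : Set (Pt d))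
    (t r : ℝ) (B : Op N (sites h Λ)) :
    quantumEvolution N h V Λ (t + r) B =
      quantumEvolution N h V Λ t (quantumEvolution N h V Λ r B) := by
  simp only [quantumEvolution_eq hV]
  rw [add_comm t r, propagator_add, neg_add_rev, propagator_add]
  simp only [mul_assoc]

theorem norm_propagator_le {V : Interaction d} (hV : V.IsReal) (h : ℝ) (Λ : Set (Pt d)) (t : ℝ) :
    ‖propagator N h V Λ t‖ ≤ 1 := by
  have h1 : ‖(propagator N h V Λ t)ᴴ * propagator N h V Λ t‖ =
      ‖propagator N h V Λ t‖ * ‖propagator N h V Λ t‖ := CStarRing.norm_star_mul_self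
  rw [propagator_conjTranspose hV, propagator_neg_mul, norm_one] at h1
  nlinarith [norm_nonneg (propagator N h V Λ t)]

theorem norm_quantumEvolution_le {V : Interaction d} (hV : V.IsReal) (h : ℝ) (Λ : Set (Pt d))
    (t : ℝ) (B : Op N (sites h Λ)) : ‖quantumEvolution N h V Λ t B‖ ≤ ‖B‖ := by
  rw [quantumEvolution_eq hV]
  have h1 := norm_propagator_le (N := N) hV h Λ t
  have h2 := norm_propagator_le (N := N) hV h Λ (-t)
  calc _ ≤ ‖propagator N h V Λ (-t)‖ * ‖B‖ * ‖propagator N h V Λ t‖ :=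
        (norm_mul_le _ _).trans (mul_le_mul_of_nonneg_right (norm_mul_le _ _) (norm_nonneg _))
    _ ≤ 1 * ‖B‖ * 1 := by gcongr
    _ = ‖B‖ := by ring

theorem quantumEvolution_sub (V : Interaction d) (h : ℝ) (Λ : Set (Pt d))
    (t : ℝ) (B B' : Op N (sites h Λ)) : quantumEvolution N h V Λ t (B - B') =
      quantumEvolution N h V Λ t B - quantumEvolution N h V Λ t B' := by
  simp only [quantumEvolution, mul_sub, sub_mul]

theorem hasDerivAt_exp_conj {A : Type*} [NormedRing A] [NormedAlgebra ℂ A] [CompleteSpace A]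
    (Z B : A) (t : ℝ) :
    HasDerivAt (fun r : ℝ => NormedSpace.exp (((-r : ℝ) : ℂ) • Z) * B *
        NormedSpace.exp ((r : ℂ) • Z))
      (NormedSpace.exp (((-t : ℝ) : ℂ) • Z) * (B * Z - Z * B) * NormedSpace.exp ((t : ℂ) • Z)) t := by
  have hr : ∀ t : ℝ, HasDerivAt (fun r : ℝ => (r : ℂ)) 1 t := fun t =>
    Complex.ofRealCLM.hasDerivAt
  have hU : HasDerivAt (fun r : ℝ => NormedSpace.exp ((r : ℂ) • Z))
      (Z * NormedSpace.exp ((t : ℂ) • Z)) t := by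
    simpa [Function.comp_def] using
      (hasDerivAt_exp_smul_const' (𝕂 := ℂ) Z (t : ℂ)).scomp t (hr t)
  have hU' : HasDerivAt (fun r : ℝ => NormedSpace.exp (((-r : ℝ) : ℂ) • Z))
      (-(NormedSpace.exp (((-t : ℝ) : ℂ) • Z) * Z)) t := by
    have h1 : HasDerivAt (fun r : ℝ => ((-r : ℝ) : ℂ)) (-1) t := by
      simpa using (hr t).fun_neg
    simpa [Function.comp_def] using
      (hasDerivAt_exp_smul_const (𝕂 := ℂ) Z ((-t : ℝ) : ℂ)).scomp t h1
  refine ((hU'.mul_const B).mul hU).congr_deriv ?_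
  noncomm_ring

theorem hasDerivAt_quantumEvolution {V : Interaction d} (hV : V.IsReal) (h : ℝ) (Λ : Set (Pt d))
    (B : Op N (sites h Λ)) (t : ℝ) :
    HasDerivAt (fun r => quantumEvolution N h V Λ r B)
      (quantumEvolution N h V Λ t (B * generator N h V Λ - generator N h V Λ * B)) t := by
  simp_rw [quantumEvolution_eq hV, propagator_eq]
  exact hasDerivAt_exp_conj _ _ _

end Hamiltonian

/-! ## The quantum spins form a spin flow -/

section QuantumFlow

variable {d N : ℕ}

theorem quantumSpin_commutator {X : Finset (Fin d → ℤ)} (i j : Idx) (x k : X) :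
    quantumSpin N X i x * quantumSpin N X j k - quantumSpin N X j k * quantumSpin N X i x =
      if x = k then ((((N : ℝ) / 2)⁻¹ : ℝ) : ℂ) • ∑ r, eps i j r • quantumSpin N X r k else 0 := by
  split_ifs with hxk
  · subst hxk
    have h1 : quantumSpin N X i x * quantumSpin N X j x -
        quantumSpin N X j x * quantumSpin N X i x =
          siteHom x (unitSpin N i * unitSpin N j - unitSpin N j * unitSpin N i) := by
      rw [map_sub, map_mul, map_mul]
      rfl
    have h2 : unitSpin N i * unitSpin N j - unitSpin N j * unitSpin N i =
        ((((N : ℝ) / 2)⁻¹ : ℝ) : ℂ) • ∑ r, eps i j r • unitSpin N r := by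
      simp only [unitSpin, smul_mul_smul_comm]
      rw [← smul_sub, spinMatrix_commutator, Finset.smul_sum, Finset.smul_sum]
      refine Finset.sum_congr rfl fun r _ => ?_
      rw [smul_smul, smul_smul, smul_smul]
      congr 1
      ring
    rw [h1, h2, map_smul, map_sum]
    simp only [map_smul]
    rfl
  · exact sub_eq_zero.mpr (siteOp_commute hxk _ _).eq

theorem quantumMonomial_commutator (hN : 0 < N) (V : Interaction d) {h : ℝ} (hh : 0 < h)
    (Λ : Set (Pt d)) (m : ℕ) (i : Idx) (k : sites h Λ) :
    (Complex.I * (((N : ℝ) / 2 * (h ^ d)⁻¹ : ℝ) : ℂ)) •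
      (quantumMonomial N h Λ (V m) * quantumSpin N (sites h Λ) i k -
        quantumSpin N (sites h Λ) i k * quantumMonomial N h Λ (V m)) =
      rate V (latticeMeasure h (sites h Λ)) (sitePt h) (quantumSpin N (sites h Λ)) m i k := by
  set u : ℂ := ((h ^ d : ℝ) : ℂ) with hu
  have hu0 : u ≠ 0 := by rw [hu]; exact_mod_cast (pow_pos hh d).ne'
  have hN0 : (N : ℂ) ≠ 0 := by exact_mod_cast hN.ne'
  set W : (Fin (m + 1) → Idx) → (Fin (m + 1) → sites h Λ) → Op N (sites h Λ) := fun l x =>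
    word (normalList l) fun a => quantumSpin N (sites h Λ) (l a) (x a) with hW
  have h1 : quantumMonomial N h Λ (V m) = ∑ l, ∑ x : Fin (m + 1) → sites h Λ,
      ((V m).toFun l (fun a => sitePt h (x a)) * u ^ (m + 1)) • W l x := by
    refine Finset.sum_congr rfl fun l _ => Finset.sum_congr rfl fun x _ => ?_
    rw [normalOrdered_eq_smul_word, smul_smul]
    rfl
  have h2 : ∀ l (x : Fin (m + 1) → sites h Λ),
      W l x * quantumSpin N (sites h Λ) i k - quantumSpin N (sites h Λ) i k * W l x =
        ∑ a, if x a = k then ((((N : ℝ) / 2)⁻¹ : ℝ) : ℂ) • ∑ j, eps (l a) i j •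
          word (normalList l) (fun c => quantumSpin N (sites h Λ) (Function.update l a j c) (x c))
          else 0 := by
    intro l x
    rw [hW, word_commutator, wordD_eq_sum_univ (nodup_normalList l) (mem_normalList l)]
    refine Finset.sum_congr rfl fun a _ => ?_
    obtain ⟨P, Q, hPQ⟩ := exists_word_update (nodup_normalList l) (mem_normalList l a)
      (fun c => quantumSpin N (sites h Λ) (l c) (x c))
    rw [hPQ, quantumSpin_commutator]
    split_ifs with hxa
    · rw [mul_smul_comm, smul_mul_assoc, Finset.mul_sum, Finset.sum_mul]
      congr 1
      refine Finset.sum_congr rfl fun j _ => ?_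
      rw [mul_smul_comm, smul_mul_assoc, ← hPQ]
      congr 1
      refine word_congr fun c _ => ?_
      by_cases hc : c = a
      · subst hc; simp [hxa]
      · simp [hc]
    · simp
  rw [h1]
  simp only [Finset.sum_mul, Finset.mul_sum, ← Finset.sum_sub_distrib, smul_mul_assoc,
    mul_smul_comm, ← smul_sub, h2]
  rw [rate, Fintype.sum_prod_type, Finset.smul_sum]
  refine Finset.sum_congr rfl fun l _ => ?_
  rw [Fintype.sum_prod_type, Finset.sum_comm, Finset.smul_sum]
  simp only [Finset.smul_sum]
  rw [Finset.sum_comm]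
  refine Finset.sum_congr rfl fun a _ => ?_
  rw [← (Fin.insertNthEquiv (fun _ => sites h Λ) a).sum_comp, Fintype.sum_prod_type,
    Finset.sum_eq_single k]
  · simp only [integral_lattice hh, Fintype.card_fin, Fin.insertNthEquiv_apply,
      Fin.insertNth_apply_same, if_true, Finset.smul_sum]
    rw [Finset.sum_comm]
    refine Finset.sum_congr rfl fun j _ => Finset.sum_congr rfl fun x _ => ?_
    rw [smul_smul, smul_smul, smul_smul, smul_smul, rateKernel]
    have h3 : (fun c => sitePt h (Fin.insertNth (α := fun _ => sites h Λ) a k x c)) =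
        Fin.insertNth (α := fun _ => Pt d) a (sitePt h k) fun r => sitePt h (x r) := by
      ext1 c
      refine Fin.succAboveCases a ?_ (fun c => ?_) c <;> simp
    rw [h3]
    congr 1
    push_cast
    rw [hu] at hu0 ⊢
    push_cast at hu0 ⊢
    field_simp
    ring
  · intro y _ hy
    simp [hy]
  · simp

/-- The evolved spin operators. -/
def quantumField (N : ℕ) (h : ℝ) (V : Interaction d) (Λ : Set (Pt d)) (t : ℝ) (i : Idx)
    (k : sites h Λ) : Op N (sites h Λ) :=
  quantumEvolution N h V Λ t (quantumSpin N (sites h Λ) i k)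

/-- The evolution as a continuous linear map. -/
def quantumEvolutionCLM (N : ℕ) (h : ℝ) (V : Interaction d) (Λ : Set (Pt d)) (t : ℝ) :
    Op N (sites h Λ) →L[ℂ] Op N (sites h Λ) :=
  LinearMap.toContinuousLinearMap
    { toFun := quantumEvolution N h V Λ t
      map_add' := fun A B => by simp only [quantumEvolution, mul_add, add_mul]
      map_smul' := fun c A => by
        simp only [quantumEvolution, mul_smul_comm, smul_mul_assoc, RingHom.id_apply] }

theorem quantumEvolutionCLM_apply (h : ℝ) (V : Interaction d) (Λ : Set (Pt d)) (t : ℝ)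
    (B : Op N (sites h Λ)) :
    quantumEvolutionCLM N h V Λ t B = quantumEvolution N h V Λ t B := rfl

theorem word_quantumEvolution {V : Interaction d} (hV : V.IsReal) (h : ℝ) (Λ : Set (Pt d)) (t : ℝ)
    {ι : Type*} (l : List ι) (A : ι → Op N (sites h Λ)) :
    word l (fun c => quantumEvolutionCLM N h V Λ t (A c)) =
      quantumEvolutionCLM N h V Λ t (word l A) := by
  simp only [quantumEvolutionCLM_apply, quantumEvolution_eq hV]
  induction l with
  | nil => rw [word_nil, word_nil, mul_one, propagator_neg_mul]
  | cons c l ih =>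
    rw [word_cons, word_cons, ih]
    calc _ = propagator N h V Λ (-t) * A c * (propagator N h V Λ t * propagator N h V Λ (-t)) *
          word l A * propagator N h V Λ t := by simp only [mul_assoc]
      _ = _ := by rw [propagator_mul_neg, mul_one]; simp only [mul_assoc]

theorem rate_quantumField {V : Interaction d} (hV : V.IsReal) {h : ℝ} (hh : 0 < h)
    (Λ : Set (Pt d)) (t : ℝ) (m : ℕ) (i : Idx) (k : sites h Λ) :
    rate V (latticeMeasure h (sites h Λ)) (sitePt h) (quantumField N h V Λ t) m i k =
      quantumEvolution N h V Λ t
        (rate V (latticeMeasure h (sites h Λ)) (sitePt h) (quantumSpin N (sites h Λ)) m i k) := by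
  simp only [rate, integral_lattice hh, quantumField,
    ← quantumEvolutionCLM_apply, word_quantumEvolution hV]
  simp only [map_sum, map_smul]

theorem eval_quantumField {V : Interaction d} (hV : V.IsReal) {h : ℝ} (hh : 0 < h)
    (Λ : Set (Pt d)) (t : ℝ) (T : Term d) :
    T.eval (latticeMeasure h (sites h Λ)) (sitePt h) (quantumField N h V Λ t) =
      quantumEvolution N h V Λ t
        (T.eval (latticeMeasure h (sites h Λ)) (sitePt h) (quantumSpin N (sites h Λ))) := by
  simp only [Term.eval, integral_lattice hh, quantumField,
    ← quantumEvolutionCLM_apply, word_quantumEvolution hV]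
  simp only [map_sum, map_smul]

theorem unifDeriv_of_hasDerivAt {Z B : Type*} [MeasurableSpace Z] [Finite Z] {ζ : Measure Z}
    [NormedRing B] [NormedAlgebra ℂ B] [NormOneClass B] {A : ℝ → Z → B} {A' : Z → B}
    (h : ∀ z, HasDerivAt (fun τ => A τ z) (A' z) 0) : UnifDeriv ζ A A' := by
  intro c hc
  have h1 : ∀ᶠ τ in 𝓝 (0 : ℝ), ∀ z, ‖A τ z - A 0 z - (τ : ℂ) • A' z‖ ≤ c * |τ| := by
    rw [eventually_all]
    intro z
    have h2 := (hasDerivAt_iff_isLittleO.mp (h z)).def hc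
    filter_upwards [h2] with τ hτ
    simpa using hτ
  filter_upwards [h1] with τ hτ using Eventually.of_forall hτ

theorem spinFlow_quantumField (hN : 0 < N) {V : Interaction d} (hV : V.IsReal) {h K : ℝ}
    (hh : 0 < h) (hK : 0 ≤ K) (hb : V.normAt h ≤ ENNReal.ofReal K) (Λ : Set (Pt d)) :
    SpinFlow V K (latticeMeasure h (sites h Λ)) (sitePt h) (quantumField N h V Λ)
      (fun t i k => ∑' m, rate V (latticeMeasure h (sites h Λ)) (sitePt h)
        (quantumField N h V Λ t) m i k) where
  measurable_pos := measurable_of_finite _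
  aesm t i := StronglyMeasurable.of_discrete.aestronglyMeasurable
  norm_le t i := Eventually.of_forall fun k =>
    (norm_quantumEvolution_le hV h Λ t _).trans (norm_quantumSpin_le hN i k)
  mass_le m := Eventually.of_forall fun k =>
    (pointMass_lattice_le V m hh k).trans (normSup1_le_massBound hb m)
  rate_eq t i := Eventually.of_forall fun k => rfl
  deriv t i := by
    refine unifDeriv_of_hasDerivAt fun k => ?_
    have h1 := (hasDerivAt_quantumEvolution hV h Λ (quantumSpin N (sites h Λ) i k) (t + 0)).comp_const_add t 0
    refine h1.congr_deriv ?_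
    rw [add_zero]
    simp only [rate_quantumField hV hh, ← quantumMonomial_commutator hN V hh,
      ← quantumEvolutionCLM_apply]
    have hs := (summable_quantumMonomial hN hh hK hb Λ).hasSum
    have h2 := ((((hs.mul_right (quantumSpin N (sites h Λ) i k)).sub
      (hs.mul_left (quantumSpin N (sites h Λ) i k))).const_smul
        (Complex.I * (((N : ℝ) / 2 * (h ^ d)⁻¹ : ℝ) : ℂ)))).mapL (quantumEvolutionCLM N h V Λ t)
    rw [h2.tsum_eq]
    congr 1
    rw [generator, hamiltonian, mul_smul_comm, smul_mul_assoc, smul_sub, neg_mul, neg_smul,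
      neg_smul]
    abel

end QuantumFlow

/-! ## Lattice approximation of Lebesgue measure -/

section Floor

variable {d : ℕ}

/-- The label of the lattice point to the lower left of `y`. -/
def floorSite (h : ℝ) (y : Pt d) : Fin d → ℤ := fun a => ⌊y a / h⌋

theorem measurable_floorSite (h : ℝ) : Measurable (floorSite h : Pt d → Fin d → ℤ) :=
  measurable_pi_lambda _ fun a =>
    show Measurable fun y : Pt d => ⌊y a / h⌋ from
      Int.measurable_floor.comp (by fun_prop)

theorem norm_latticePt_floorSite_sub_le {h : ℝ} (hh : 0 < h) (y : Pt d) :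
    ‖latticePt h (floorSite h y) - y‖ ≤ h := by
  rw [pi_norm_le_iff_of_nonneg hh.le]
  intro a
  have h1 := Int.floor_le (y a / h)
  have h2 := Int.lt_floor_add_one (y a / h)
  rw [le_div_iff₀ hh] at h1
  rw [div_lt_iff₀ hh] at h2
  rw [Pi.sub_apply, latticePt, floorSite, Real.norm_eq_abs, abs_le]
  constructor <;> nlinarith

theorem preimage_floorSite_singleton {h : ℝ} (hh : 0 < h) (k : Fin d → ℤ) :
    floorSite h ⁻¹' {k} = Set.univ.pi fun a => Set.Ico (h * (k a : ℝ)) (h * (k a : ℝ) + h) := by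
  ext y
  simp only [Set.mem_preimage, Set.mem_singleton_iff, Set.mem_univ_pi, Set.mem_Ico, funext_iff,
    floorSite, Int.floor_eq_iff, le_div_iff₀ hh, div_lt_iff₀ hh]
  refine forall_congr' fun a => and_congr ?_ ?_
  · rw [mul_comm]
  · rw [add_mul, one_mul, mul_comm]

theorem volume_preimage_floorSite {h : ℝ} (hh : 0 < h) (k : Fin d → ℤ) :
    volume (floorSite h ⁻¹' {k}) = ENNReal.ofReal (h ^ d) := by
  rw [preimage_floorSite_singleton hh, Real.volume_pi_Ico]
  simp [ENNReal.ofReal_pow hh.le]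

theorem volume_preimage_floorSite_pi {ι : Type*} [Fintype ι] {h : ℝ} (hh : 0 < h)
    (k : ι → Fin d → ℤ) :
    (Measure.pi fun _ : ι => (volume : Measure (Pt d)))
      ((fun (y : ι → Pt d) r => floorSite h (y r)) ⁻¹' {k}) =
        ENNReal.ofReal (h ^ d) ^ Fintype.card ι := by
  have h1 : (fun (y : ι → Pt d) r => floorSite h (y r)) ⁻¹' {k} =
      Set.univ.pi fun r => floorSite h ⁻¹' {k r} := by
    ext y
    simp [funext_iff]
  rw [h1, Measure.pi_pi]
  simp [volume_preimage_floorSite hh]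

theorem lintegral_floorSite {ι : Type*} [Fintype ι] {h : ℝ} (hh : 0 < h)
    (g : (ι → Fin d → ℤ) → ℝ≥0∞) :
    ∫⁻ y, g (fun r => floorSite h (y r)) ∂(Measure.pi fun _ : ι => (volume : Measure (Pt d))) =
      ENNReal.ofReal (h ^ d) ^ Fintype.card ι * ∑' k, g k := by
  have hm : Measurable fun (y : ι → Pt d) r => floorSite h (y r) :=
    measurable_pi_lambda _ fun r => (measurable_floorSite h).comp (measurable_pi_apply r)
  rw [← lintegral_map (f := g) Measurable.of_discrete hm, lintegral_countable', mul_comm,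
    ← ENNReal.tsum_mul_right]
  refine tsum_congr fun k => ?_
  rw [Measure.map_apply hm (measurableSet_singleton k), volume_preimage_floorSite_pi hh]

theorem tendsto_latticePt_floorSite {h : ℕ → ℝ} (hh : ∀ n, 0 < h n)
    (h0 : Tendsto h atTop (𝓝 0)) (y : Pt d) :
    Tendsto (fun n => latticePt (h n) (floorSite (h n) y)) atTop (𝓝 y) :=
  tendsto_iff_norm_sub_tendsto_zero.mpr
    (squeeze_zero (fun _ => norm_nonneg _) (fun n => norm_latticePt_floorSite_sub_le (hh n) y) h0)

theorem pointMass_restrict_le (V : Interaction d) (m : ℕ) {v : ℝ≥0∞} {h₀ : ℝ} (hh₀ : 0 < h₀)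
    (hv : ∀ h, 0 < h → h < h₀ → normSup1 h (V m) ≤ v) (Λ : Set (Pt d)) (x : Pt d) :
    pointMass V m ((volume : Measure (Pt d)).restrict Λ) id x ≤ v := by
  obtain ⟨h, -, hh, h0⟩ := exists_seq_strictAnti_tendsto' hh₀
  have hcont : ∀ l, Continuous fun z : Pt d × (Fin m → Pt d) =>
      ‖(V m).toFun l (Fin.cons (α := fun _ => Pt d) z.1 z.2)‖ₑ := fun l =>
    (((V m).continuous_toFun l).comp (by
      refine continuous_pi fun c => ?_
      refine Fin.cases ?_ (fun c => ?_) c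
      · simpa using continuous_fst
      · simpa [Function.comp_def] using (continuous_apply c).comp continuous_snd)).enorm
  let F : ℕ → (Fin m → Pt d) → ℝ≥0∞ := fun n y => ∑ l, ‖(V m).toFun l
    (Fin.cons (α := fun _ => Pt d) (latticePt (h n) (floorSite (h n) x))
      fun r => latticePt (h n) (floorSite (h n) (y r)))‖ₑ
  have hF : ∀ n, ∫⁻ y, F n y ∂(Measure.pi fun _ => volume) ≤ v := by
    intro n
    refine le_trans (le_of_eq ?_)
      ((le_iSup _ (floorSite (h n) x)).trans (hv (h n) (hh n).1 (hh n).2))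
    rw [lintegral_floorSite (hh n).1 fun k => ∑ l, ‖(V m).toFun l
      (Fin.cons (α := fun _ => Pt d) (latticePt (h n) (floorSite (h n) x))
        fun r => latticePt (h n) (k r))‖ₑ]
    rw [Summable.tsum_finsetSum fun _ _ => ENNReal.summable, Finset.mul_sum]
    refine Finset.sum_congr rfl fun l _ => ?_
    rw [Fintype.card_fin, ← ENNReal.ofReal_pow (pow_nonneg (hh n).1.le _), ← pow_mul, mul_comm d m]
  have hFm : ∀ n, Measurable (F n) := by
    intro n
    have h1 : Measurable fun y : Fin m → Pt d => fun r => floorSite (h n) (y r) :=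
      measurable_pi_lambda _ fun r => (measurable_floorSite _).comp (measurable_pi_apply r)
    exact (Measurable.of_discrete (f := fun k : Fin m → Fin d → ℤ => ∑ l, ‖(V m).toFun l
      (Fin.cons (α := fun _ => Pt d) (latticePt (h n) (floorSite (h n) x))
        fun r => latticePt (h n) (k r))‖ₑ)).comp h1
  have hlim : ∀ y, Tendsto (fun n => F n y) atTop (𝓝 (∑ l, ‖(V m).toFun l
      (Fin.cons (α := fun _ => Pt d) x y)‖ₑ)) := by
    intro y
    have hy : Tendsto (fun n r => latticePt (h n) (floorSite (h n) (y r))) atTop (𝓝 y) :=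
      tendsto_pi_nhds.mpr fun r => tendsto_latticePt_floorSite (fun n => (hh n).1) h0 (y r)
    have hxy := (tendsto_latticePt_floorSite (fun n => (hh n).1) h0 x).prodMk_nhds hy
    refine tendsto_finsetSum _ fun l _ => ?_
    have h1 := ((hcont l).tendsto (x, y)).comp hxy
    simp only [Function.comp_def] at h1
    exact h1
  calc pointMass V m ((volume : Measure (Pt d)).restrict Λ) id x
      = ∫⁻ y, ∑ l, ‖(V m).toFun l (Fin.cons (α := fun _ => Pt d) x y)‖ₑ
          ∂(Measure.pi fun _ => (volume : Measure (Pt d)).restrict Λ) := by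
        rw [pointMass, lintegral_finsetSum]
        · rfl
        · exact fun l _ => ((hcont l).comp (Continuous.prodMk_right x)).measurable
    _ ≤ ∫⁻ y, ∑ l, ‖(V m).toFun l (Fin.cons (α := fun _ => Pt d) x y)‖ₑ
          ∂(Measure.pi fun _ => (volume : Measure (Pt d))) := by
        rw [← Measure.restrict_pi_pi]
        exact setLIntegral_le_lintegral _ _
    _ = ∫⁻ y, liminf (fun n => F n y) atTop ∂(Measure.pi fun _ => (volume : Measure (Pt d))) :=
        lintegral_congr fun y => (hlim y).liminf_eq.symm
    _ ≤ liminf (fun n => ∫⁻ y, F n y ∂(Measure.pi fun _ => volume)) atTop :=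
        lintegral_liminf_le hFm
    _ ≤ v := by
        refine liminf_le_of_frequently_le' (Frequently.of_forall hF)

end Floor

/-! ## Vectors and ladder components -/

section Vectors

theorem norm_sq_three (v : EuclideanSpace ℝ (Fin 3)) : ‖v‖ ^ 2 = v 0 ^ 2 + v 1 ^ 2 + v 2 ^ 2 := by
  rw [EuclideanSpace.norm_sq_eq, Fin.sum_univ_three]
  simp

/-- The cross product. -/
def cross (a b : EuclideanSpace ℝ (Fin 3)) : EuclideanSpace ℝ (Fin 3) :=
  !₂[a 1 * b 2 - a 2 * b 1, a 2 * b 0 - a 0 * b 2, a 0 * b 1 - a 1 * b 0]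

theorem norm_cross_le (a b : EuclideanSpace ℝ (Fin 3)) : ‖cross a b‖ ≤ ‖a‖ * ‖b‖ := by
  refine abs_le_of_sq_le_sq' ?_ (by positivity) |>.2
  rw [mul_pow, norm_sq_three, norm_sq_three, norm_sq_three]
  simp [cross]
  nlinarith [sq_nonneg (a 0 * b 0 + a 1 * b 1 + a 2 * b 2)]

theorem cross_sub_cross (a b a' b' : EuclideanSpace ℝ (Fin 3)) :
    cross a b - cross a' b' = cross (a - a') b + cross a' (b - b') := by
  ext i
  fin_cases i <;> simp [cross] <;> ring

theorem inner_cross_smul (a b : EuclideanSpace ℝ (Fin 3)) (c : ℝ) : inner ℝ b (cross a (c • b)) = 0 := by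
  simp [cross, PiLp.inner_apply, Fin.sum_univ_three]
  ring

theorem continuous_cross : Continuous fun z : EuclideanSpace ℝ (Fin 3) × EuclideanSpace ℝ (Fin 3) => cross z.1 z.2 := by
  refine (PiLp.continuous_toLp 2 _).comp (continuous_pi fun i => ?_)
  fin_cases i <;> simp <;> fun_prop

/-- The radial retraction onto the unit ball. -/
def retract (v : EuclideanSpace ℝ (Fin 3)) : EuclideanSpace ℝ (Fin 3) := (max 1 ‖v‖)⁻¹ • v

theorem retract_eq_self {v : EuclideanSpace ℝ (Fin 3)} (h : ‖v‖ ≤ 1) : retract v = v := by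
  rw [retract, max_eq_left h, inv_one, one_smul]

theorem norm_retract_le (v : EuclideanSpace ℝ (Fin 3)) : ‖retract v‖ ≤ 1 := by
  rw [retract, norm_smul, norm_inv, Real.norm_eq_abs, abs_of_nonneg (by positivity)]
  exact (inv_mul_le_iff₀ (by positivity)).mpr (by simp)

theorem norm_retract_sub_le (v w : EuclideanSpace ℝ (Fin 3)) : ‖retract v - retract w‖ ≤ 2 * ‖v - w‖ := by
  set a := max 1 ‖v‖ with ha
  set b := max 1 ‖w‖ with hb
  have ha1 : 1 ≤ a := le_max_left _ _
  have hb1 : 1 ≤ b := le_max_left _ _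
  have hw : ‖w‖ ≤ b := le_max_right _ _
  have hab : |b - a| ≤ ‖v - w‖ := by
    have h1 := abs_max_sub_max_le_max 1 ‖w‖ 1 ‖v‖
    rw [sub_self, abs_zero, max_eq_right (abs_nonneg (‖w‖ - ‖v‖))] at h1
    rw [norm_sub_rev]
    exact h1.trans (abs_norm_sub_norm_le w v)
  have h1 : retract v - retract w = a⁻¹ • (v - w) + ((b - a) * (a⁻¹ * b⁻¹)) • w := by
    rw [retract, retract, ← ha, ← hb, smul_sub, sub_mul]
    have h2 : b * (a⁻¹ * b⁻¹) = a⁻¹ := by field_simp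
    have h3 : a * (a⁻¹ * b⁻¹) = b⁻¹ := by field_simp
    rw [h2, h3, sub_smul]
    abel
  rw [h1]
  refine (norm_add_le _ _).trans ?_
  rw [norm_smul, norm_smul, norm_mul, Real.norm_eq_abs, Real.norm_eq_abs, Real.norm_eq_abs,
    abs_of_nonneg (by positivity : (0 : ℝ) ≤ a⁻¹), abs_of_nonneg (by positivity : 0 ≤ a⁻¹ * b⁻¹)]
  have h4 : a⁻¹ ≤ 1 := inv_le_one_of_one_le₀ ha1
  have h5 : a⁻¹ * b⁻¹ * ‖w‖ ≤ 1 := by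
    rw [mul_assoc]
    refine mul_le_one₀ h4 (by positivity) ((inv_mul_le_iff₀ (by positivity)).mpr (by linarith))
  have h6 := mul_le_mul h4 le_rfl (norm_nonneg (v - w)) zero_le_one
  have h7 := mul_le_mul hab h5 (by positivity) (norm_nonneg _)
  linarith [mul_assoc |b - a| (a⁻¹ * b⁻¹) ‖w‖]

theorem continuous_retract : Continuous retract :=
  ((continuous_const.max continuous_norm).inv₀ fun v => by
    have : (0 : ℝ) < max 1 ‖v‖ := by positivity
    exact this.ne').smul continuous_id

theorem ladder_sub (v w : EuclideanSpace ℝ (Fin 3)) (i : Idx) : ladder (v - w) i = ladder v i - ladder w i := by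
  cases i <;> simp [ladder] <;> ring

theorem ladder_smul (c : ℝ) (v : EuclideanSpace ℝ (Fin 3)) (i : Idx) : ladder (c • v) i = (c : ℂ) * ladder v i := by
  cases i <;> simp [ladder] <;> ring

theorem continuous_ladder (i : Idx) : Continuous fun v : EuclideanSpace ℝ (Fin 3) => ladder v i := by
  cases i <;> simp only [ladder] <;> fun_prop

theorem norm_ladder_le (v : EuclideanSpace ℝ (Fin 3)) (i : Idx) : ‖ladder v i‖ ≤ ‖v‖ := by
  refine abs_le_of_sq_le_sq' ?_ (norm_nonneg v) |>.2
  rw [norm_sq_three, ← Complex.normSq_eq_norm_sq]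
  cases i
  · simp [ladder, Complex.normSq_apply]
    nlinarith [sq_nonneg (v 0), sq_nonneg (v 1), sq_nonneg (v 2)]
  · simp [ladder, Complex.normSq_apply]
    nlinarith [sq_nonneg (v 0), sq_nonneg (v 1)]
  · simp [ladder, Complex.normSq_apply]
    nlinarith [sq_nonneg (v 0), sq_nonneg (v 1), sq_nonneg (v 2)]

/-- The vector with given values of the components `-` and `z`. -/
def ofLadder (a b : ℂ) : EuclideanSpace ℝ (Fin 3) := !₂[Real.sqrt 2 * a.re, -(Real.sqrt 2 * a.im), b.re]

theorem norm_ofLadder_le (a b : ℂ) : ‖ofLadder a b‖ ≤ 2 * (‖a‖ + ‖b‖) := by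
  refine abs_le_of_sq_le_sq' ?_ (by positivity) |>.2
  have h1 := Complex.normSq_eq_norm_sq a
  have h2 := Complex.normSq_eq_norm_sq b
  rw [Complex.normSq_apply] at h1 h2
  rw [norm_sq_three]
  simp [ofLadder, mul_pow]
  nlinarith [mul_nonneg (norm_nonneg a) (norm_nonneg b), sq_nonneg b.im, sq_nonneg ‖a‖,
    sq_nonneg ‖b‖]

theorem ofLadder_sub (a b a' b' : ℂ) :
    ofLadder a b - ofLadder a' b' = ofLadder (a - a') (b - b') := by
  ext i
  fin_cases i <;> simp [ofLadder] <;> ring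

theorem continuous_ofLadder : Continuous fun z : ℂ × ℂ => ofLadder z.1 z.2 := by
  refine (PiLp.continuous_toLp 2 _).comp (continuous_pi fun i => ?_)
  fin_cases i <;> simp <;> fun_prop

/-- The cross product in ladder components. -/
theorem ladder_cross {G : Idx → ℂ} (hG : ∀ p, starRingEnd ℂ (G p) = G p.conj) (v : EuclideanSpace ℝ (Fin 3)) (i : Idx) :
    ladder (cross (ofLadder (G .plus) (G .z)) v) i =
      Complex.I * ∑ p, ∑ j, eps p i j * G p * ladder v j := by
  have hz : ((G .z).re : ℂ) = G .z := Complex.conj_eq_iff_re.mp (hG .z)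
  have hm : G .minus = starRingEnd ℂ (G .plus) := (hG .plus).symm
  have hp : G .plus = (G .plus).re + (G .plus).im * Complex.I := (Complex.re_add_im _).symm
  have hm' : G .minus = (G .plus).re - (G .plus).im * Complex.I := by
    rw [hm]; apply Complex.ext <;> simp
  have h2 : (Real.sqrt 2 : ℂ) ≠ 0 := by simp
  have h2' : (Real.sqrt 2 : ℂ) ^ 2 = 2 := by
    rw [← Complex.ofReal_pow, Real.sq_sqrt (by norm_num)]; norm_num
  rw [sum_Idx]
  simp only [sum_Idx]
  rw [hm']
  generalize (G .plus).re = p at *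
  generalize (G .plus).im = q at *
  rw [hp]
  generalize G .z = c at *
  cases i
  · simp [eps, ladder, cross, ofLadder]
    rw [hz]
    field_simp
    linear_combination (-c * v 1 - Real.sqrt 2 * q * v 2) * Complex.I_sq
  · simp [eps, ladder, cross, ofLadder]
    field_simp
    linear_combination (p * v 1 + q * v 0) * h2' + 2 * (p * v 1 + q * v 0) * Complex.I_sq
  · simp [eps, ladder, cross, ofLadder]
    rw [hz]
    field_simp
    linear_combination (-c * v 1 - Real.sqrt 2 * q * v 2) * Complex.I_sq

end Vectors

/-! ## The gradient of the classical Hamiltonian -/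

section Gradient

variable {d : ℕ} {V : Interaction d} {μ : Measure (Pt d)} [IsFiniteMeasure μ]

/-- The contribution of `V m` to the gradient of the Hamiltonian, up to the factor `m + 1`. -/
def gradTerm (V : Interaction d) (μ : Measure (Pt d)) (u : Idx → Pt d → ℂ) (m : ℕ) (p : Idx)
    (x : Pt d) : ℂ :=
  ∑ l : Fin m → Idx, ∫ y, (V m).toFun (Fin.cons (α := fun _ => Idx) p l)
    (Fin.cons (α := fun _ => Pt d) x y) * ∏ a, u (l a) (y a) ∂(Measure.pi fun _ : Fin m => μ)

/-- The gradient of the Hamiltonian. -/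
def grad (V : Interaction d) (μ : Measure (Pt d)) (u : Idx → Pt d → ℂ) (p : Idx) (x : Pt d) : ℂ :=
  ∑' m : ℕ, ((m : ℂ) + 1) * gradTerm V μ u m p x

theorem continuous_toFun_cons (V : Interaction d) (m : ℕ) (l : Fin (m + 1) → Idx) :
    Continuous fun z : Pt d × (Fin m → Pt d) =>
      (V m).toFun l (Fin.cons (α := fun _ => Pt d) z.1 z.2) :=
  ((V m).continuous_toFun l).comp <| by
    refine continuous_pi fun c => ?_
    refine Fin.cases ?_ (fun c => ?_) c
    · simpa using continuous_fst
    · simpa [Function.comp_def] using (continuous_apply c).comp continuous_snd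

theorem sum_lintegral_cons_le (V : Interaction d) (μ : Measure (Pt d)) (m : ℕ) (p : Idx)
    (x : Pt d) : ∑ l : Fin m → Idx, ∫⁻ y, ‖(V m).toFun (Fin.cons (α := fun _ => Idx) p l)
      (Fin.cons (α := fun _ => Pt d) x y)‖ₑ ∂(Measure.pi fun _ : Fin m => μ) ≤
        pointMass V m μ id x := by
  rw [pointMass, ← (Fin.consEquiv fun _ : Fin (m + 1) => Idx).sum_comp, Fintype.sum_prod_type]
  exact Finset.single_le_sum (f := fun p => ∑ l : Fin m → Idx, ∫⁻ y,
    ‖(V m).toFun (Fin.cons (α := fun _ => Idx) p l) (Fin.cons (α := fun _ => Pt d) x y)‖ₑ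
      ∂(Measure.pi fun _ : Fin m => μ)) (fun _ _ => zero_le) (Finset.mem_univ p)

theorem norm_sum_integral_mul_le {m : ℕ} {p : Idx} {x : Pt d} {v : ℝ} (hv : 0 ≤ v)
    (hx : pointMass V m μ id x ≤ ENNReal.ofReal v) {w : (Fin m → Idx) → (Fin m → Pt d) → ℂ}
    {c : ℝ} (hc : 0 ≤ c) (hw : ∀ l, ∀ᵐ y ∂(Measure.pi fun _ : Fin m => μ), ‖w l y‖ ≤ c) :
    ‖∑ l : Fin m → Idx, ∫ y, (V m).toFun (Fin.cons (α := fun _ => Idx) p l)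
      (Fin.cons (α := fun _ => Pt d) x y) * w l y ∂(Measure.pi fun _ : Fin m => μ)‖ ≤ c * v := by
  rw [← ENNReal.ofReal_le_ofReal_iff (by positivity), ofReal_norm, ENNReal.ofReal_mul hc]
  refine (enorm_sum_le _ _).trans ((Finset.sum_le_sum fun l _ => ?_).trans
    ((Finset.mul_sum _ _ _).symm.le.trans (mul_le_mul_right
      ((sum_lintegral_cons_le V μ m p x).trans hx) _)))
  refine (enorm_integral_le_lintegral_enorm _).trans ?_
  rw [← lintegral_const_mul' _ _ ENNReal.ofReal_ne_top]
  refine lintegral_mono_ae ?_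
  filter_upwards [hw l] with y hy
  rw [enorm_mul, mul_comm]
  refine mul_le_mul_left ?_ _
  rw [← ofReal_norm]
  exact ENNReal.ofReal_le_ofReal hy

theorem norm_prod_le_one {m : ℕ} {a : Fin m → ℂ} (h : ∀ r, ‖a r‖ ≤ 1) : ‖∏ r, a r‖ ≤ 1 := by
  rw [norm_prod]
  exact Finset.prod_le_one (fun _ _ => norm_nonneg _) fun r _ => h r

theorem norm_prod_sub_prod_le {m : ℕ} {a b : Fin m → ℂ} {δ : ℝ} (ha : ∀ r, ‖a r‖ ≤ 1)
    (hb : ∀ r, ‖b r‖ ≤ 1) (hab : ∀ r, ‖a r - b r‖ ≤ δ) : ‖∏ r, a r - ∏ r, b r‖ ≤ m * δ := by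
  induction m with
  | zero => simp
  | succ m ih =>
    rw [Fin.prod_univ_succ, Fin.prod_univ_succ]
    have h1 := ih (fun r => ha r.succ) (fun r => hb r.succ) fun r => hab r.succ
    have h2 := norm_prod_le_one fun r : Fin m => hb r.succ
    have h3 : a 0 * ∏ r : Fin m, a r.succ - b 0 * ∏ r : Fin m, b r.succ =
        a 0 * (∏ r : Fin m, a r.succ - ∏ r : Fin m, b r.succ) +
          (a 0 - b 0) * ∏ r : Fin m, b r.succ := by ring
    rw [h3]
    refine (norm_add_le _ _).trans ?_
    rw [norm_mul, norm_mul]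
    have h4 := mul_le_mul (ha 0) h1 (norm_nonneg _) zero_le_one
    have h5 := mul_le_mul (hab 0) h2 (norm_nonneg _) ((norm_nonneg _).trans (hab 0))
    push_cast
    linarith

theorem integrable_gradTerm {m : ℕ} {p : Idx} {x : Pt d} (hx : pointMass V m μ id x < ⊤)
    {u : Idx → Pt d → ℂ} (hu : ∀ i, AEStronglyMeasurable (u i) μ) (hu1 : ∀ i y, ‖u i y‖ ≤ 1)
    (l : Fin m → Idx) :
    Integrable (fun y => (V m).toFun (Fin.cons (α := fun _ => Idx) p l)
      (Fin.cons (α := fun _ => Pt d) x y) * ∏ a, u (l a) (y a)) (Measure.pi fun _ : Fin m => μ) := by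
  refine integrable_smul_of_bound (B := ℂ) (C := 1)
    (((continuous_toFun_cons V m _).comp (Continuous.prodMk_right x)).aestronglyMeasurable) ?_ ?_
    (Eventually.of_forall fun y => norm_prod_le_one fun r => hu1 _ _)
  · refine lt_of_le_of_lt ((Finset.single_le_sum (f := fun l => ∫⁻ y,
      ‖(V m).toFun (Fin.cons (α := fun _ => Idx) p l) (Fin.cons (α := fun _ => Pt d) x y)‖ₑ
        ∂(Measure.pi fun _ : Fin m => μ)) (fun _ _ => zero_le) (Finset.mem_univ l)).trans
      (sum_lintegral_cons_le V μ m p x)) hx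
  · exact Finset.aestronglyMeasurable_fun_prod _ fun a _ => aestronglyMeasurable_pi_eval (hu _) a

theorem aestronglyMeasurable_gradTerm (m : ℕ) (p : Idx)
    {u : Idx → Pt d → ℂ} (hu : ∀ i, AEStronglyMeasurable (u i) μ) :
    AEStronglyMeasurable (gradTerm V μ u m p) μ := by
  refine Finset.aestronglyMeasurable_fun_sum _ fun l _ => ?_
  have h1 : AEStronglyMeasurable (fun z : Pt d × (Fin m → Pt d) =>
      (V m).toFun (Fin.cons (α := fun _ => Idx) p l) (Fin.cons (α := fun _ => Pt d) z.1 z.2) *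
        ∏ a, u (l a) (z.2 a)) (μ.prod (Measure.pi fun _ : Fin m => μ)) := by
    refine ((continuous_toFun_cons V m _).aestronglyMeasurable).mul ?_
    have h2 : AEStronglyMeasurable (fun y : Fin m → Pt d => ∏ a, u (l a) (y a))
        (Measure.pi fun _ : Fin m => μ) :=
      Finset.aestronglyMeasurable_fun_prod _ fun a _ => aestronglyMeasurable_pi_eval (hu _) a
    exact h2.comp_snd
  exact h1.integral_prod_right'

variable {K : ℝ} (hK : 0 ≤ K)
  (hV : ∀ m x, pointMass V m μ id x ≤ ENNReal.ofReal (massBound K m))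
include hK hV

theorem norm_gradTerm_le {u : Idx → Pt d → ℂ} (hu1 : ∀ i y, ‖u i y‖ ≤ 1) (m : ℕ) (p : Idx)
    (x : Pt d) : ‖((m : ℂ) + 1) * gradTerm V μ u m p x‖ ≤ K * Real.exp (-((m : ℝ) + 1)) := by
  rw [norm_mul, ← mul_massBound]
  have h1 : ‖((m : ℂ) + 1)‖ = (m : ℝ) + 1 := by
    rw [← Nat.cast_succ, Complex.norm_natCast, Nat.cast_succ]
  rw [h1]
  refine mul_le_mul_of_nonneg_left ?_ (by positivity)
  have := norm_sum_integral_mul_le (p := p) (massBound_nonneg hK m) (hV m x)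
    (w := fun l y => ∏ a, u (l a) (y a)) zero_le_one
    fun l => Eventually.of_forall fun y => norm_prod_le_one fun r => hu1 _ _
  rwa [one_mul] at this


omit hK hV in
theorem summable_mul_exp (K : ℝ) (k : ℕ) :
    Summable fun m : ℕ => (m : ℝ) ^ k * (K * Real.exp (-((m : ℝ) + 1))) := by
  refine ((Real.summable_pow_mul_exp_neg_nat_mul k zero_lt_one).mul_left
    (K * Real.exp (-1))).congr fun m => ?_
  rw [neg_add, Real.exp_add, neg_mul, one_mul]
  ring

theorem norm_grad_le {u : Idx → Pt d → ℂ} (hu1 : ∀ i y, ‖u i y‖ ≤ 1) (p : Idx) (x : Pt d) :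
    ‖grad V μ u p x‖ ≤ ∑' m : ℕ, K * Real.exp (-((m : ℝ) + 1)) := by
  have hs := summable_mul_exp K 0
  simp only [pow_zero, one_mul] at hs
  exact tsum_of_norm_bounded hs.hasSum fun m => norm_gradTerm_le hK hV hu1 m p x

theorem summable_gradTerm {u : Idx → Pt d → ℂ} (hu1 : ∀ i y, ‖u i y‖ ≤ 1) (p : Idx) (x : Pt d) :
    Summable fun m : ℕ => ((m : ℂ) + 1) * gradTerm V μ u m p x := by
  have hs := summable_mul_exp K 0
  simp only [pow_zero, one_mul] at hs
  exact Summable.of_norm_bounded hs fun m => norm_gradTerm_le hK hV hu1 m p x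

theorem aestronglyMeasurable_grad (p : Idx) {u : Idx → Pt d → ℂ}
    (hu : ∀ i, AEStronglyMeasurable (u i) μ) (hu1 : ∀ i y, ‖u i y‖ ≤ 1) :
    AEStronglyMeasurable (grad V μ u p) μ := by
  refine aestronglyMeasurable_of_tendsto_ae atTop (f := fun n x =>
    ∑ m ∈ Finset.range n, ((m : ℂ) + 1) * gradTerm V μ u m p x) (fun n => ?_)
    (Eventually.of_forall fun x => (summable_gradTerm hK hV hu1 p x).hasSum.tendsto_sum_nat)
  exact Finset.aestronglyMeasurable_fun_sum _ fun m _ =>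
    aestronglyMeasurable_const.mul (aestronglyMeasurable_gradTerm m p hu)

theorem norm_grad_sub_le {u u' : Idx → Pt d → ℂ} (hu : ∀ i, AEStronglyMeasurable (u i) μ)
    (hu' : ∀ i, AEStronglyMeasurable (u' i) μ) (hu1 : ∀ i y, ‖u i y‖ ≤ 1)
    (hu1' : ∀ i y, ‖u' i y‖ ≤ 1) {δ : ℝ} (hδ : 0 ≤ δ) (h : ∀ i, ∀ᵐ y ∂μ, ‖u i y - u' i y‖ ≤ δ)
    (p : Idx) (x : Pt d) :
    ‖grad V μ u p x - grad V μ u' p x‖ ≤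
      (∑' m : ℕ, (m : ℝ) * (K * Real.exp (-((m : ℝ) + 1)))) * δ := by
  have hs := summable_mul_exp K 1
  simp only [pow_one] at hs
  rw [grad, grad, ← (summable_gradTerm hK hV hu1 p x).tsum_sub (summable_gradTerm hK hV hu1' p x),
    ← tsum_mul_right]
  refine tsum_of_norm_bounded (hs.mul_right δ).hasSum fun m => ?_
  rw [← mul_sub, norm_mul, ← mul_massBound]
  have h1 : ‖((m : ℂ) + 1)‖ = (m : ℝ) + 1 := by
    rw [← Nat.cast_succ, Complex.norm_natCast, Nat.cast_succ]
  rw [h1, gradTerm, gradTerm, ← Finset.sum_sub_distrib]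
  have h2 := norm_sum_integral_mul_le (p := p) (massBound_nonneg hK m) (hV m x)
    (w := fun l y => ∏ a, u (l a) (y a) - ∏ a, u' (l a) (y a)) (c := m * δ) (by positivity)
    fun l => by
      have h3 : ∀ᵐ y ∂(Measure.pi fun _ : Fin m => μ), ∀ r, ‖u (l r) (y r) - u' (l r) (y r)‖ ≤ δ :=
        ae_all_iff.mpr fun r => ae_pi_eval (h (l r)) r
      filter_upwards [h3] with y hy
      exact norm_prod_sub_prod_le (fun r => hu1 _ _) (fun r => hu1' _ _) hy
  have h4 : ∀ l : Fin m → Idx, ∫ y, (V m).toFun (Fin.cons (α := fun _ => Idx) p l)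
      (Fin.cons (α := fun _ => Pt d) x y) * (∏ a, u (l a) (y a) - ∏ a, u' (l a) (y a))
        ∂(Measure.pi fun _ : Fin m => μ) =
      ∫ y, (V m).toFun (Fin.cons (α := fun _ => Idx) p l)
      (Fin.cons (α := fun _ => Pt d) x y) * ∏ a, u (l a) (y a) ∂(Measure.pi fun _ : Fin m => μ) -
      ∫ y, (V m).toFun (Fin.cons (α := fun _ => Idx) p l)
      (Fin.cons (α := fun _ => Pt d) x y) * ∏ a, u' (l a) (y a) ∂(Measure.pi fun _ : Fin m => μ) := by
    intro l
    have hx := (hV m x).trans_lt ENNReal.ofReal_lt_top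
    rw [← integral_sub (integrable_gradTerm hx hu hu1 l) (integrable_gradTerm hx hu' hu1' l)]
    simp only [mul_sub]
  simp only [h4] at h2
  calc _ ≤ ((m : ℝ) + 1) * (m * δ * massBound K m) := by gcongr
    _ = _ := by ring

omit hK hV in
theorem conj_grad (hVr : V.IsReal) {u : Idx → Pt d → ℂ}
    (hu : ∀ i y, starRingEnd ℂ (u i y) = u i.conj y) (p : Idx) (x : Pt d) :
    starRingEnd ℂ (grad V μ u p x) = grad V μ u p.conj x := by
  rw [grad, Complex.conj_tsum]
  refine tsum_congr fun m => ?_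
  rw [map_mul, map_add, map_one, Complex.conj_natCast, gradTerm, map_sum, gradTerm]
  have hinv : Function.Involutive fun (l : Fin m → Idx) (a : Fin m) => (l a).conj :=
    fun l => funext fun a => Idx.conj_conj _
  congr 1
  rw [← Equiv.sum_comp (hinv.toPerm _)]
  refine Finset.sum_congr rfl fun l _ => ?_
  rw [← integral_conj]
  refine integral_congr_ae (Eventually.of_forall fun y => ?_)
  simp only [map_mul, map_prod, hVr m, hu, Function.Involutive.coe_toPerm, Idx.conj_conj]
  congr 2
  ext a
  refine Fin.cases ?_ (fun a => ?_) a <;> simp [Idx.conj_conj]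

omit hK hV in
/-- The vector field of the equation of motion in terms of the gradient. -/
theorem sum_integral_eq_gradTerm {m : ℕ} {x : Pt d} (w : Idx → ℂ) (u : Idx → Pt d → ℂ) (i : Idx) :
    ∑ l : Fin (m + 1) → Idx, ∑ j : Idx, ∫ y, (V m).toFun l (Fin.cons (α := fun _ => Pt d) x y) *
      eps (l 0) i j * w j * ∏ a : Fin m, u (l a.succ) (y a) ∂(Measure.pi fun _ : Fin m => μ) =
        ∑ p, ∑ j, eps p i j * gradTerm V μ u m p x * w j := by
  rw [← (Fin.consEquiv fun _ : Fin (m + 1) => Idx).sum_comp, Fintype.sum_prod_type]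
  refine Finset.sum_congr rfl fun p _ => ?_
  rw [Finset.sum_comm]
  refine Finset.sum_congr rfl fun j _ => ?_
  rw [gradTerm, Finset.mul_sum, Finset.sum_mul]
  refine Finset.sum_congr rfl fun l _ => ?_
  rw [← integral_const_mul, ← integral_mul_const]
  refine integral_congr_ae (Eventually.of_forall fun y => ?_)
  have h1 : (Fin.consEquiv fun _ : Fin (m + 1) => Idx) (p, l) =
      Fin.cons (α := fun _ => Idx) p l := rfl
  simp only [h1, Fin.cons_zero, Fin.cons_succ]
  ring

theorem tsum_sum_eps_gradTerm {u : Idx → Pt d → ℂ} (hu1 : ∀ i y, ‖u i y‖ ≤ 1) (w : Idx → ℂ)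
    (i : Idx) (x : Pt d) :
    ∑' m : ℕ, ((m : ℂ) + 1) * ∑ p, ∑ j, eps p i j * gradTerm V μ u m p x * w j =
      ∑ p, ∑ j, eps p i j * grad V μ u p x * w j := by
  have hs : ∀ p j, HasSum (fun m : ℕ => eps p i j * (((m : ℂ) + 1) * gradTerm V μ u m p x) * w j)
      (eps p i j * grad V μ u p x * w j) := fun p j =>
    ((summable_gradTerm hK hV hu1 p x).hasSum.mul_left _).mul_right _
  have h := hasSum_sum (s := Finset.univ) fun p _ => hasSum_sum (s := Finset.univ)
    fun j _ => hs p j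
  rw [← h.tsum_eq]
  refine tsum_congr fun m => ?_
  simp only [Finset.mul_sum]
  refine Finset.sum_congr rfl fun p _ => Finset.sum_congr rfl fun j _ => ?_
  ring

omit hK hV in
theorem word_eq_prod {ι : Type*} [Fintype ι] {l : List ι} (hl : l.Nodup) (hc : ∀ c, c ∈ l)
    (A : ι → ℂ) : word l A = ∏ c, A c := by
  classical
  rw [word, ← List.prod_toFinset _ hl]
  congr 1
  ext c
  simp [hc]

omit hK hV in
theorem rate_eq_gradTerm (u : Idx → Pt d → ℂ) (m : ℕ) (i : Idx) (x : Pt d) :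
    rate V μ id u m i x =
      Complex.I * (((m : ℂ) + 1) * ∑ p, ∑ j, eps p i j * gradTerm V μ u m p x * u j x) := by
  rw [rate, Fintype.sum_prod_type]
  simp only [Fintype.sum_prod_type]
  have h1 : ∀ a : Fin (m + 1), ∑ l : Fin (m + 1) → Idx, ∑ j, ∫ y,
      rateKernel V m i l j a (id x) (fun r => id (y r)) • word (normalList l) (fun c =>
        u (Function.update l a j c) (Fin.insertNth (α := fun _ => Pt d) a x y c))
        ∂(Measure.pi fun _ : Fin m => μ) =
      Complex.I * ∑ p, ∑ j, eps p i j * gradTerm V μ u m p x * u j x := by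
    intro a
    rw [← (Fin.insertNthEquiv (fun _ : Fin (m + 1) => Idx) a).sum_comp, Fintype.sum_prod_type,
      Finset.mul_sum]
    refine Finset.sum_congr rfl fun p _ => ?_
    rw [Finset.sum_comm, Finset.mul_sum]
    refine Finset.sum_congr rfl fun j _ => ?_
    rw [gradTerm, Finset.mul_sum, Finset.sum_mul, Finset.mul_sum]
    refine Finset.sum_congr rfl fun l _ => ?_
    rw [← integral_const_mul, ← integral_mul_const, ← integral_const_mul]
    refine integral_congr_ae (Eventually.of_forall fun y => ?_)
    have h2 : (Fin.insertNth (α := fun _ => Idx) a p l) ∘ a.cycleRange.symm =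
        Fin.cons (α := fun _ => Idx) p l := Fin.insertNth_comp_cycleRange_symm a p l
    have h3 : (Fin.insertNthEquiv (fun _ : Fin (m + 1) => Idx) a) (p, l) =
      Fin.insertNth (α := fun _ => Idx) a p l := rfl
    simp only [id, smul_eq_mul, rateKernel, h3, Fin.insertNth_apply_same]
    rw [toFun_insertNth, word_eq_prod (nodup_normalList _) (mem_normalList _),
      Fin.prod_univ_succAbove _ a, h2]
    simp
    ring
  rw [Finset.sum_congr rfl fun l _ => Finset.sum_comm, Finset.sum_comm,
    Finset.sum_congr rfl fun a _ => h1 a]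
  rw [Finset.sum_const, Finset.card_univ, Fintype.card_fin, nsmul_eq_mul]
  push_cast
  ring

end Gradient

/-! ## Global solutions of Lipschitz equations -/

section GlobalODE

variable {E : Type*} [NormedAddCommGroup E] [NormedSpace ℝ E] [CompleteSpace E]

theorem exists_global_solution {f : E → E} {L : ℝ≥0} (hf : LipschitzWith L f) {C : ℝ≥0}
    (hC : ∀ x, ‖f x‖ ≤ C) (x₀ : E) :
    ∃ α : ℝ → E, α 0 = x₀ ∧ ∀ t, HasDerivAt α (f (α t)) t := by
  have h1 : ∀ n : ℕ, ∃ α : ℝ → E, α 0 = x₀ ∧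
      ∀ t ∈ Set.Ioo (-((n : ℝ) + 1)) ((n : ℝ) + 1), HasDerivAt α (f (α t)) t := by
    intro n
    have h0 : (0 : ℝ) ∈ Set.Icc (-((n : ℝ) + 1)) ((n : ℝ) + 1) := by
      constructor <;> linarith [(Nat.cast_nonneg n : (0 : ℝ) ≤ n)]
    have hPL : IsPicardLindelof (fun _ => f) (tmin := -((n : ℝ) + 1)) (tmax := (n : ℝ) + 1)
        ⟨0, h0⟩ x₀ (C * (n + 1)) 0 C L :=
      { lipschitzOnWith := fun t _ => hf.lipschitzOnWith
        continuousOn := fun x _ => continuousOn_const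
        norm_le := fun t _ x _ => hC x
        mul_max_le := by simp }
    obtain ⟨α, hα, hα'⟩ := hPL.exists_eq_forall_mem_Icc_hasDerivWithinAt₀
    exact ⟨α, hα, fun t ht => (hα' t (Set.Ioo_subset_Icc_self ht)).hasDerivAt
      (Icc_mem_nhds ht.1 ht.2)⟩
  choose α hα hα' using h1
  have h2 : ∀ n k : ℕ, n ≤ k → Set.EqOn (α n) (α k) (Set.Ioo (-((n : ℝ) + 1)) ((n : ℝ) + 1)) := by
    intro n k hnk
    have hnk' : (n : ℝ) ≤ k := by exact_mod_cast hnk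
    have hn : (0 : ℝ) ≤ n := Nat.cast_nonneg n
    refine ODE_solution_unique_of_mem_Ioo (v := fun _ => f) (s := fun _ => Set.univ) (t₀ := 0)
      (fun t _ => hf.lipschitzOnWith) ⟨by linarith, by linarith⟩
      (fun t ht => ⟨hα' n t ht, trivial⟩) (fun t ht => ⟨hα' k t ⟨?_, ?_⟩, trivial⟩)
      ((hα n).trans (hα k).symm)
    · linarith [ht.1]
    · linarith [ht.2]
  have hmem : ∀ t : ℝ, t ∈ Set.Ioo (-((⌈|t|⌉₊ : ℝ) + 1)) ((⌈|t|⌉₊ : ℝ) + 1) := by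
    intro t
    have := Nat.le_ceil |t|
    constructor <;> linarith [neg_abs_le t, le_abs_self t]
  have h3 : ∀ (n : ℕ) (t : ℝ), t ∈ Set.Ioo (-((n : ℝ) + 1)) ((n : ℝ) + 1) →
      α ⌈|t|⌉₊ t = α n t := by
    intro n t ht
    rcases le_total n ⌈|t|⌉₊ with h | h
    · exact (h2 n _ h ht).symm
    · exact h2 _ n h (hmem t)
  refine ⟨fun t => α ⌈|t|⌉₊ t, hα _, fun t => ?_⟩
  refine (hα' _ t (hmem t)).congr_of_eventuallyEq ?_
  filter_upwards [Ioo_mem_nhds (hmem t).1 (hmem t).2] with r hr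
  exact h3 _ r hr

end GlobalODE

/-! ## The classical flow -/

section ClassicalFlow

variable {d : ℕ} {V : Interaction d} {Λ : Set (Pt d)}

/-- The ladder components of the retraction of a spin field. -/
def retractLadder (M : SpinField Λ) (i : Idx) (y : Pt d) : ℂ := ladder (retract (M y)) i

theorem norm_retractLadder_le (M : SpinField Λ) (i : Idx) (y : Pt d) :
    ‖retractLadder M i y‖ ≤ 1 := (norm_ladder_le _ _).trans (norm_retract_le _)

theorem aestronglyMeasurable_retractLadder (M : SpinField Λ) (i : Idx) :
    AEStronglyMeasurable (retractLadder M i) ((volume : Measure (Pt d)).restrict Λ) :=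
  ((continuous_ladder i).comp continuous_retract).comp_aestronglyMeasurable
    (Lp.aestronglyMeasurable M)

theorem ae_norm_le (M : SpinField Λ) :
    ∀ᵐ y ∂((volume : Measure (Pt d)).restrict Λ), ‖M y‖ ≤ ‖M‖ := by
  have h1 := ae_le_eLpNormEssSup (f := M) (μ := (volume : Measure (Pt d)).restrict Λ)
  filter_upwards [h1] with y hy
  rw [Lp.norm_def, eLpNorm_exponent_top, ← ENNReal.ofReal_le_iff_le_toReal, ofReal_norm]
  · exact hy
  · rw [← eLpNorm_exponent_top]
    exact Lp.eLpNorm_ne_top M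

theorem norm_le_of_ae_norm_le {M : SpinField Λ} {c : ℝ} (hc : 0 ≤ c)
    (h : ∀ᵐ y ∂((volume : Measure (Pt d)).restrict Λ), ‖M y‖ ≤ c) : ‖M‖ ≤ c := by
  rw [Lp.norm_def, eLpNorm_exponent_top]
  refine ENNReal.toReal_le_of_le_ofReal hc (eLpNormEssSup_le_of_ae_bound h)

theorem ae_norm_sub_le (M M' : SpinField Λ) :
    ∀ᵐ y ∂((volume : Measure (Pt d)).restrict Λ), ‖M y - M' y‖ ≤ ‖M - M'‖ := by
  filter_upwards [ae_norm_le (M - M'), Lp.coeFn_sub M M'] with y h1 h2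
  rwa [h2] at h1

/-- The gradient of the Hamiltonian as a vector. -/
def gradVec (V : Interaction d) (M : SpinField Λ) (x : Pt d) : EuclideanSpace ℝ (Fin 3) :=
  ofLadder (grad V ((volume : Measure (Pt d)).restrict Λ) (retractLadder M) .plus x)
    (grad V ((volume : Measure (Pt d)).restrict Λ) (retractLadder M) .z x)

/-- The vector field of the equation of motion, extended from the unit ball to all fields. -/
def fieldFun (V : Interaction d) (M : SpinField Λ) (x : Pt d) : EuclideanSpace ℝ (Fin 3) :=
  cross (gradVec V M x) (retract (M x))

theorem inner_fieldFun (V : Interaction d) (M : SpinField Λ) (x : Pt d) :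
    inner ℝ (M x) (fieldFun V M x) = 0 := inner_cross_smul _ _ _

theorem conj_ladder (v : EuclideanSpace ℝ (Fin 3)) (i : Idx) :
    starRingEnd ℂ (ladder v i) = ladder v i.conj := by
  cases i <;> simp [ladder, Idx.conj, sub_eq_add_neg]

variable [IsFiniteMeasure ((volume : Measure (Pt d)).restrict Λ)] {K : ℝ} (hK : 0 ≤ K)
  (hV : ∀ m x, pointMass V m ((volume : Measure (Pt d)).restrict Λ) id x ≤
    ENNReal.ofReal (massBound K m))

include hK hV

theorem norm_gradVec_le (M : SpinField Λ) (x : Pt d) :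
    ‖gradVec V M x‖ ≤ 4 * ∑' m : ℕ, K * Real.exp (-((m : ℝ) + 1)) := by
  refine (norm_ofLadder_le _ _).trans ?_
  linarith [norm_grad_le hK hV (norm_retractLadder_le M) .plus x,
    norm_grad_le hK hV (norm_retractLadder_le M) .z x]

theorem norm_gradVec_sub_le (M M' : SpinField Λ) (x : Pt d) :
    ‖gradVec V M x - gradVec V M' x‖ ≤
      8 * (∑' m : ℕ, (m : ℝ) * (K * Real.exp (-((m : ℝ) + 1)))) * ‖M - M'‖ := by
  have h1 : ∀ i, ∀ᵐ y ∂((volume : Measure (Pt d)).restrict Λ),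
      ‖retractLadder M i y - retractLadder M' i y‖ ≤ 2 * ‖M - M'‖ := by
    intro i
    filter_upwards [ae_norm_sub_le M M'] with y hy
    rw [retractLadder, retractLadder, ← ladder_sub]
    linarith [norm_ladder_le (retract (M y) - retract (M' y)) i, norm_retract_sub_le (M y) (M' y)]
  have h2 := norm_grad_sub_le hK hV (aestronglyMeasurable_retractLadder M)
    (aestronglyMeasurable_retractLadder M') (norm_retractLadder_le M) (norm_retractLadder_le M')
    (by positivity) h1
  rw [gradVec, gradVec, ofLadder_sub]
  refine (norm_ofLadder_le _ _).trans ?_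
  linarith [h2 .plus x, h2 .z x]

theorem norm_fieldFun_le (M : SpinField Λ) (x : Pt d) :
    ‖fieldFun V M x‖ ≤ 4 * ∑' m : ℕ, K * Real.exp (-((m : ℝ) + 1)) := by
  refine (norm_cross_le _ _).trans ?_
  have h1 := norm_gradVec_le hK hV M x
  have h2 := mul_le_mul h1 (norm_retract_le (M x)) (norm_nonneg _) ((norm_nonneg _).trans h1)
  linarith

theorem memLp_fieldFun (M : SpinField Λ) :
    MemLp (fieldFun V M) ∞ ((volume : Measure (Pt d)).restrict Λ) := by
  have hg := fun p => aestronglyMeasurable_grad hK hV p (aestronglyMeasurable_retractLadder M)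
    (norm_retractLadder_le M)
  refine memLp_top_of_bound ?_ _ (Eventually.of_forall (norm_fieldFun_le hK hV M))
  exact continuous_cross.comp_aestronglyMeasurable
    ((continuous_ofLadder.comp_aestronglyMeasurable ((hg _).prodMk (hg _))).prodMk
      (continuous_retract.comp_aestronglyMeasurable (Lp.aestronglyMeasurable M)))

/-- The vector field of the equation of motion on spin fields. -/
def vectorField (M : SpinField Λ) : SpinField Λ := (memLp_fieldFun hK hV M).toLp _

theorem coeFn_vectorField (M : SpinField Λ) :
    vectorField hK hV M =ᵐ[(volume : Measure (Pt d)).restrict Λ] fieldFun V M :=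
  MemLp.coeFn_toLp _

theorem norm_vectorField_le (M : SpinField Λ) :
    ‖vectorField hK hV M‖ ≤ 4 * ∑' m : ℕ, K * Real.exp (-((m : ℝ) + 1)) := by
  refine norm_le_of_ae_norm_le (by positivity) ?_
  filter_upwards [coeFn_vectorField hK hV M] with x hx
  rw [hx]
  exact norm_fieldFun_le hK hV M x

theorem lipschitzWith_vectorField : ∃ L, LipschitzWith L (vectorField (Λ := Λ) hK hV) := by
  set c₀ := ∑' m : ℕ, K * Real.exp (-((m : ℝ) + 1)) with hc₀
  set c₁ := ∑' m : ℕ, (m : ℝ) * (K * Real.exp (-((m : ℝ) + 1))) with hc₁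
  have h0 : 0 ≤ c₀ := tsum_nonneg fun m => by positivity
  have h1 : 0 ≤ c₁ := tsum_nonneg fun m => by positivity
  refine ⟨(8 * c₁ + 8 * c₀).toNNReal, LipschitzWith.of_dist_le_mul fun M M' => ?_⟩
  rw [dist_eq_norm, dist_eq_norm, Real.coe_toNNReal _ (by positivity)]
  refine norm_le_of_ae_norm_le (by positivity) ?_
  filter_upwards [coeFn_vectorField hK hV M, coeFn_vectorField hK hV M',
    Lp.coeFn_sub (vectorField hK hV M) (vectorField hK hV M'), ae_norm_sub_le M M']
    with x h2 h3 h4 h5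
  rw [h4, Pi.sub_apply, h2, h3, fieldFun, fieldFun, cross_sub_cross]
  refine (norm_add_le _ _).trans ((add_le_add (norm_cross_le _ _) (norm_cross_le _ _)).trans ?_)
  have h6 := norm_gradVec_sub_le hK hV M M' x
  have h7 := norm_gradVec_le hK hV M' x
  have h8 := mul_le_mul h6 (norm_retract_le (M x)) (norm_nonneg _) (by positivity)
  have h9 := mul_le_mul h7 ((norm_retract_sub_le (M x) (M' x)).trans
    (mul_le_mul_of_nonneg_left h5 zero_le_two)) (norm_nonneg _) (by positivity)
  rw [← hc₀] at h9
  rw [← hc₁] at h8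
  nlinarith

end ClassicalFlow

section ClassicalFlow

variable {d : ℕ} {V : Interaction d} {Λ : Set (Pt d)}
variable [IsFiniteMeasure ((volume : Measure (Pt d)).restrict Λ)]

theorem ladder_fieldFun (hVr : V.IsReal) (M : SpinField Λ) (x : Pt d) (i : Idx) :
    ladder (fieldFun V M x) i = Complex.I * ∑ p, ∑ j, eps p i j *
      grad V ((volume : Measure (Pt d)).restrict Λ) (retractLadder M) p x * retractLadder M j x := by
  have hu : ∀ i y, starRingEnd ℂ (retractLadder M i y) = retractLadder M i.conj y :=
    fun i y => conj_ladder (retract (M y)) i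
  have hG := fun p =>
    conj_grad (μ := (volume : Measure (Pt d)).restrict Λ) hVr hu p x
  rw [fieldFun, gradVec]
  generalize grad V ((volume : Measure (Pt d)).restrict Λ) (retractLadder M) = g at hG ⊢
  exact ladder_cross (G := fun p => g p x) hG (retract (M x)) i

theorem ladder_injective {v w : EuclideanSpace ℝ (Fin 3)} (h : ∀ i, ladder v i = ladder w i) :
    v = w := by
  have h2 : (Real.sqrt 2 : ℂ) ≠ 0 := by simp
  have hp := h .plus
  have hz := h .z
  simp only [ladder] at hp hz
  rw [div_left_inj' h2] at hp
  have h0 : v 0 = w 0 := by simpa using congrArg Complex.re hp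
  have h1 : v 1 = w 1 := by simpa using congrArg Complex.im hp
  have h3 : v 2 = w 2 := by exact_mod_cast hz
  ext i
  fin_cases i <;> assumption

theorem retract_ae_eq {M : SpinField Λ} (hM : ‖M‖ ≤ 1) :
    ∀ᵐ y ∂((volume : Measure (Pt d)).restrict Λ), retract (M y) = M y := by
  filter_upwards [ae_norm_le M] with y hy using retract_eq_self (hy.trans hM)

theorem ae_eq_retractLadder {M : SpinField Λ} (hM : ‖M‖ ≤ 1) :
    ∀ᵐ y ∂((volume : Measure (Pt d)).restrict Λ), ∀ i, ladder (M y) i = retractLadder M i y := by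
  filter_upwards [retract_ae_eq hM] with y hy i
  rw [retractLadder, hy]

variable {K : ℝ} (hK : 0 ≤ K)
  (hV : ∀ m x, pointMass V m ((volume : Measure (Pt d)).restrict Λ) id x ≤
    ENNReal.ofReal (massBound K m))
include hK hV

theorem llField_eq (hVr : V.IsReal) {M : SpinField Λ} (hM : ‖M‖ ≤ 1) :
    ∀ᵐ x ∂((volume : Measure (Pt d)).restrict Λ), ∀ i,
      llField V Λ M x i = ladder (fieldFun V M x) i := by
  have hr := ae_eq_retractLadder hM
  filter_upwards [hr] with x hx i
  rw [ladder_fieldFun hVr, llField,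
    ← tsum_sum_eps_gradTerm hK hV (norm_retractLadder_le M)]
  congr 1
  refine tsum_congr fun m => ?_
  congr 1
  rw [← sum_integral_eq_gradTerm]
  refine Finset.sum_congr rfl fun l _ => Finset.sum_congr rfl fun j _ => integral_congr_ae ?_
  have h1 : ∀ᵐ y ∂(Measure.pi fun _ : Fin m => (volume : Measure (Pt d)).restrict Λ),
      ∀ a i, ladder (M (y a)) i = retractLadder M i (y a) := ae_all_iff.mpr fun a => ae_pi_eval hr a
  filter_upwards [h1] with y hy
  simp only [hx, hy]

theorem hasDerivAt_of_isSolution (hVr : V.IsReal) {M : ℝ → Phase Λ} (h : IsSolution V Λ M) (t : ℝ) :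
    HasDerivAt (fun t => (M t : SpinField Λ)) (vectorField hK hV (M t : SpinField Λ)) t := by
  have h1 := (h.1.differentiable one_ne_zero t).hasDerivAt
  refine h1.congr_deriv (Lp.ext ?_)
  filter_upwards [h.2 t, llField_eq hK hV hVr (M t).2, coeFn_vectorField hK hV (M t : SpinField Λ)]
    with x h2 h3 h4
  rw [h4]
  exact ladder_injective fun i => (h2 i).trans (h3 i)

theorem isSolution_of_hasDerivAt (hVr : V.IsReal) {M : ℝ → Phase Λ}
    (h : ∀ t, HasDerivAt (fun t => (M t : SpinField Λ)) (vectorField hK hV (M t : SpinField Λ)) t) :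
    IsSolution V Λ M := by
  obtain ⟨L, hL⟩ := lipschitzWith_vectorField (Λ := Λ) hK hV
  have hd : Differentiable ℝ fun t => (M t : SpinField Λ) := fun t => (h t).differentiableAt
  refine ⟨contDiff_one_iff_deriv.mpr ⟨hd, ?_⟩, fun t => ?_⟩
  · rw [deriv_eq h]
    exact hL.continuous.comp hd.continuous
  · rw [(h t).deriv]
    filter_upwards [llField_eq hK hV hVr (M t).2,
      coeFn_vectorField hK hV (M t : SpinField Λ)] with x h3 h4 i
    rw [h4, h3]

theorem norm_solution_le {α : ℝ → SpinField Λ}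
    (h : ∀ t, HasDerivAt α (vectorField hK hV (α t)) t) (t : ℝ) : ‖α t‖ ≤ ‖α 0‖ := by
  have hq : ∀ t, MemLp (fun x => ‖α t x‖ ^ 2) ∞ ((volume : Measure (Pt d)).restrict Λ) := by
    intro t
    refine memLp_top_of_bound ((Lp.aestronglyMeasurable (α t)).norm.pow 2) (‖α t‖ ^ 2) ?_
    filter_upwards [ae_norm_le (α t)] with x hx
    rw [norm_pow, norm_norm]
    gcongr
  let q : ℝ → Lp ℝ ∞ ((volume : Measure (Pt d)).restrict Λ) := fun t => (hq t).toLp _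
  have hqd : ∀ t, HasDerivAt q 0 t := by
    intro t
    set X := vectorField hK hV (α t) with hX
    have h1 : ∀ t', ‖q t' - q t‖ ≤
        2 * ‖α t‖ * ‖α t' - α t - (t' - t) • X‖ + ‖α t' - α t‖ * ‖α t' - α t‖ := by
      intro t'
      rw [Lp.norm_def, eLpNorm_exponent_top]
      refine ENNReal.toReal_le_of_le_ofReal (by positivity) (eLpNormEssSup_le_of_ae_bound ?_)
      filter_upwards [Lp.coeFn_sub (q t') (q t), (hq t').coeFn_toLp, (hq t).coeFn_toLp,
        ae_norm_le (α t), ae_norm_le (α t' - α t - (t' - t) • X), ae_norm_le (α t' - α t),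
        Lp.coeFn_sub (α t' - α t) ((t' - t) • X), Lp.coeFn_sub (α t') (α t),
        Lp.coeFn_smul (t' - t) X, coeFn_vectorField hK hV (α t)] with x e1 e2 e3 e4 e5 e6 e7 e8 e9 e10
      rw [e1, Pi.sub_apply]
      change ‖(hq t').toLp _ x - (hq t).toLp _ x‖ ≤ _
      rw [e2, e3]
      rw [e7, Pi.sub_apply, e9, Pi.smul_apply, e8, Pi.sub_apply, e10] at e5
      rw [e8, Pi.sub_apply] at e6
      set v := α t x with hv
      set w := α t' x with hw
      set Y := fieldFun V (α t) x with hY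
      have hin : inner ℝ v Y = 0 := inner_fieldFun V (α t) x
      have e11 : ‖w‖ ^ 2 - ‖v‖ ^ 2 = 2 * inner ℝ v (w - v - (t' - t) • Y) + ‖w - v‖ ^ 2 := by
        have h3 : w = v + (w - v) := by abel
        have h4 := norm_add_sq_real v (w - v)
        rw [← h3] at h4
        rw [h4, inner_sub_right v (w - v), inner_smul_right, hin]
        ring
      rw [e11, Real.norm_eq_abs]
      refine (abs_add_le _ _).trans ?_
      have h5 := (abs_real_inner_le_norm v (w - v - (t' - t) • Y)).trans
        (mul_le_mul e4 e5 (norm_nonneg _) (norm_nonneg _))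
      rw [abs_mul, abs_two, abs_of_nonneg (sq_nonneg ‖w - v‖)]
      have h6 := mul_le_mul e6 e6 (norm_nonneg _) (norm_nonneg _)
      nlinarith
    rw [hasDerivAt_iff_isLittleO]
    simp only [smul_zero, sub_zero]
    have h2 := hasDerivAt_iff_isLittleO.mp (h t)
    have h3 : (fun t' => α t' - α t) =O[𝓝 t] fun t' => t' - t := (h t).isBigO_sub
    have h4 : (fun t' => α t' - α t) =o[𝓝 t] fun _ => (1 : ℝ) := by
      rw [Asymptotics.isLittleO_one_iff]
      have := (h t).continuousAt.tendsto.sub_const (α t)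
      rwa [sub_self] at this
    have h5 : (fun t' => 2 * ‖α t‖ * ‖α t' - α t - (t' - t) • X‖ + ‖α t' - α t‖ * ‖α t' - α t‖)
        =o[𝓝 t] fun t' => t' - t := by
      refine (h2.norm_left.const_mul_left _).add ?_
      have := h3.norm_left.mul_isLittleO h4.norm_left
      simpa using this
    exact (Asymptotics.isBigO_of_le _ fun t' =>
      (h1 t').trans (le_abs_self _)).trans_isLittleO h5
  have hconst := is_const_of_deriv_eq_zero (fun t => (hqd t).differentiableAt)
    (fun t => (hqd t).deriv) t 0
  refine norm_le_of_ae_norm_le (norm_nonneg _) ?_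
  filter_upwards [(hq t).coeFn_toLp, (hq 0).coeFn_toLp, ae_norm_le (α 0)] with x e1 e2 e3
  have e4 : ‖α t x‖ ^ 2 = ‖α 0 x‖ ^ 2 := by
    rw [← e1, ← e2]
    change (q t) x = (q 0) x
    rw [hconst]
  rw [sq_eq_sq₀ (norm_nonneg _) (norm_nonneg _)] at e4
  exact e4.le.trans e3

theorem exists_isHamiltonianFlow (hVr : V.IsReal) :
    ∃ φ : ℝ → Phase Λ → Phase Λ, IsHamiltonianFlow V Λ φ := by
  obtain ⟨L, hL⟩ := lipschitzWith_vectorField (Λ := Λ) hK hV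
  set c := 4 * ∑' m : ℕ, K * Real.exp (-((m : ℝ) + 1)) with hc
  have hc0 : 0 ≤ c := by
    have : 0 ≤ ∑' m : ℕ, K * Real.exp (-((m : ℝ) + 1)) := tsum_nonneg fun m => by positivity
    positivity
  have h1 := fun M₀ : Phase Λ => exists_global_solution hL (C := ⟨c, hc0⟩)
    (norm_vectorField_le hK hV) (M₀ : SpinField Λ)
  choose α hα hα' using h1
  refine ⟨fun t M₀ => ⟨α M₀ t, (norm_solution_le hK hV (hα' M₀) t).trans (by
    rw [hα]; exact M₀.2)⟩, fun M₀ => ⟨Subtype.ext (hα M₀), ?_, fun M hM hM0 => ?_⟩⟩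
  · exact isSolution_of_hasDerivAt hK hV hVr (hα' M₀)
  · have h2 : (fun t => (M t : SpinField Λ)) = α M₀ := by
      refine ODE_solution_unique_univ (v := fun _ => vectorField hK hV) (s := fun _ => Set.univ)
        (t₀ := 0) (K := L) (fun t => hL.lipschitzOnWith)
        (fun t => ⟨hasDerivAt_of_isSolution hK hV hVr hM t, trivial⟩)
        (fun t => ⟨hα' M₀ t, trivial⟩) ?_
      rw [hα]
      exact congrArg Subtype.val hM0
    ext1 t
    exact Subtype.ext (congrFun h2 t)

theorem spinFlow_classical (hVr : V.IsReal) {M : ℝ → Phase Λ} (h : IsSolution V Λ M) :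
    SpinFlow V K ((volume : Measure (Pt d)).restrict Λ) id
      (fun t => retractLadder (M t : SpinField Λ))
      (fun t i x => ladder (fieldFun V (M t : SpinField Λ) x) i) where
  measurable_pos := measurable_id
  aesm t i := aestronglyMeasurable_retractLadder _ i
  norm_le t i := Eventually.of_forall fun y => (norm_retractLadder_le _ i y).trans
    (Real.one_le_sqrt.mpr one_le_two)
  mass_le m := Eventually.of_forall fun y => hV m y
  rate_eq t i := Eventually.of_forall fun y => by
    simp only [rate_eq_gradTerm]
    rw [tsum_mul_left, tsum_sum_eps_gradTerm hK hV (norm_retractLadder_le _), ladder_fieldFun hVr]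
  deriv t i := by
    intro c hc
    have h1 := ((hasDerivAt_of_isSolution hK hV hVr h (t + 0)).comp_const_add t 0)
    have h2 := (hasDerivAt_iff_isLittleO.mp h1).def hc
    filter_upwards [h2] with τ hτ
    have hdiff := ae_norm_le ((M (t + τ) : SpinField Λ) - (M (t + 0) : SpinField Λ) -
      (τ - 0) • vectorField hK hV (M (t + 0) : SpinField Λ))
    filter_upwards [hdiff, ae_eq_retractLadder (M (t + τ)).2, ae_eq_retractLadder (M (t + 0)).2,
      Lp.coeFn_sub ((M (t + τ) : SpinField Λ) - (M (t + 0) : SpinField Λ))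
        ((τ - 0) • vectorField hK hV (M (t + 0) : SpinField Λ)),
      Lp.coeFn_sub (M (t + τ) : SpinField Λ) (M (t + 0) : SpinField Λ),
      Lp.coeFn_smul (τ - 0) (vectorField hK hV (M (t + 0) : SpinField Λ)),
      coeFn_vectorField hK hV (M (t + 0) : SpinField Λ)] with x e1 e2 e3 e4 e5 e6 e7
    rw [e4, Pi.sub_apply, e5, Pi.sub_apply, e6, Pi.smul_apply, e7] at e1
    rw [← e2, ← e3, ← ladder_sub, smul_eq_mul, ← ladder_smul, ← ladder_sub]
    rw [add_zero, sub_zero] at *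
    exact (norm_ladder_le _ i).trans (e1.trans hτ)

end ClassicalFlow

/-! ## Linear combinations of observables -/

section Observables

variable {d p : ℕ}

theorem Smearing.isSummable_iff {f : Smearing d p} :
    f.IsSummable ↔ ∃ C : ℝ≥0∞, C < ⊤ ∧ ∀ᶠ h in 𝓝[>] (0 : ℝ), norm1 h f ≤ C := by
  constructor
  · intro hf
    obtain ⟨C, hC, hC'⟩ := exists_between hf
    exact ⟨C, hC', (eventually_lt_of_limsup_lt hC).mono fun _ => le_of_lt⟩
  · rintro ⟨C, hC, hf⟩
    exact (limsup_le_of_le (by isBoundedDefault) hf).trans_lt hC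

instance : Zero (Smearing d p) :=
  ⟨⟨fun _ _ => 0, fun _ => continuous_const, fun _ _ _ => rfl⟩⟩

instance : Add (Smearing d p) :=
  ⟨fun f g => ⟨fun i x => f.toFun i x + g.toFun i x,
    fun i => (f.continuous_toFun i).add (g.continuous_toFun i),
    fun σ i x => by rw [f.symm, g.symm]⟩⟩

instance : SMul ℂ (Smearing d p) :=
  ⟨fun c f => ⟨fun i x => c * f.toFun i x, fun i => continuous_const.mul (f.continuous_toFun i),
    fun σ i x => by rw [f.symm]⟩⟩

theorem Smearing.zero_toFun (i : Fin p → Idx) (x : Fin p → Pt d) :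
    (0 : Smearing d p).toFun i x = 0 := rfl

theorem Smearing.add_toFun (f g : Smearing d p) (i : Fin p → Idx) (x : Fin p → Pt d) :
    (f + g).toFun i x = f.toFun i x + g.toFun i x := rfl

theorem Smearing.smul_toFun (c : ℂ) (f : Smearing d p) (i : Fin p → Idx) (x : Fin p → Pt d) :
    (c • f).toFun i x = c * f.toFun i x := rfl

theorem Smearing.isSummable_zero : (0 : Smearing d p).IsSummable :=
  Smearing.isSummable_iff.mpr ⟨0, ENNReal.zero_lt_top, Eventually.of_forall fun h => by
    simp [norm1, Smearing.zero_toFun]⟩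

theorem Smearing.IsSummable.add {f g : Smearing d p} (hf : f.IsSummable) (hg : g.IsSummable) :
    (f + g).IsSummable := by
  obtain ⟨C, hC, hf⟩ := Smearing.isSummable_iff.mp hf
  obtain ⟨C', hC', hg⟩ := Smearing.isSummable_iff.mp hg
  refine Smearing.isSummable_iff.mpr ⟨C + C', ENNReal.add_lt_top.mpr ⟨hC, hC'⟩, ?_⟩
  filter_upwards [hf, hg] with h h1 h2
  refine le_trans ?_ (add_le_add h1 h2)
  rw [norm1, norm1, norm1, ← mul_add, ← Finset.sum_add_distrib]
  refine mul_le_mul_right (Finset.sum_le_sum fun i _ => ?_) _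
  rw [← ENNReal.tsum_add]
  exact ENNReal.tsum_le_tsum fun k => enorm_add_le _ _

theorem Smearing.IsSummable.smul {f : Smearing d p} (hf : f.IsSummable) (c : ℂ) :
    (c • f).IsSummable := by
  obtain ⟨C, hC, hf⟩ := Smearing.isSummable_iff.mp hf
  refine Smearing.isSummable_iff.mpr ⟨‖c‖ₑ * C, ENNReal.mul_lt_top enorm_lt_top hC, ?_⟩
  filter_upwards [hf] with h h1
  refine le_trans (le_of_eq ?_) (mul_le_mul_right h1 _)
  simp only [norm1, Smearing.smul_toFun, enorm_mul, ENNReal.tsum_mul_left, ← Finset.mul_sum]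
  ring

namespace Observable

/-- The component of degree `r`, which is zero beyond the degree of the observable. -/
def coef (F : Observable d) (r : ℕ) : Smearing d r :=
  if h : r < F.deg + 1 then F.comp ⟨r, h⟩ else 0

theorem isSummable_coef (F : Observable d) (r : ℕ) : (F.coef r).IsSummable := by
  rw [coef]
  split_ifs
  · exact F.isSummable _
  · exact Smearing.isSummable_zero

theorem sum_comp_eq {A : Type*} [AddCommMonoid A] (F : Observable d)
    (Φ : ∀ r, Smearing d r → A) (h0 : ∀ r, Φ r 0 = 0) {D : ℕ} (hD : F.deg ≤ D) :
    ∑ r : Fin (F.deg + 1), Φ r (F.comp r) = ∑ r ∈ Finset.range (D + 1), Φ r (F.coef r) := by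
  have h1 : ∑ r : Fin (F.deg + 1), Φ r (F.comp r) = ∑ r ∈ Finset.range (F.deg + 1), Φ r (F.coef r) := by
    rw [Finset.sum_range]
    refine Finset.sum_congr rfl fun r _ => ?_
    rw [coef, dif_pos r.2]
  rw [h1]
  refine Finset.sum_subset (Finset.range_subset_range.mpr (by omega)) fun r _ hr => ?_
  rw [coef, dif_neg (by simpa using hr), h0]

/-- The sum of two observables. -/
def add (F G : Observable d) : Observable d where
  deg := max F.deg G.deg
  comp r := F.coef r + G.coef r
  isSummable r := (F.isSummable_coef r).add (G.isSummable_coef r)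

/-- The multiple of an observable. -/
def smul (c : ℂ) (F : Observable d) : Observable d where
  deg := F.deg
  comp r := c • F.comp r
  isSummable r := (F.isSummable r).smul c

/-- The observable with a single component. -/
def single (f : Smearing d p) (hf : f.IsSummable) : Observable d where
  deg := p
  comp := Fin.lastCases (motive := fun r => Smearing d r) f fun _ => 0
  isSummable r := by
    refine Fin.lastCases (motive := fun r => Smearing.IsSummable
      (Fin.lastCases (motive := fun r => Smearing d r) f (fun _ => 0) r)) ?_ (fun r => ?_) r
    · rw [Fin.lastCases_last]
      exact hf
    · rw [Fin.lastCases_castSucc]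
      exact Smearing.isSummable_zero

theorem sum_add_comp {A : Type*} [AddCommMonoid A] (F G : Observable d)
    (Φ : ∀ r, Smearing d r → A) (h0 : ∀ r, Φ r 0 = 0)
    (hadd : ∀ r f g, Φ r (f + g) = Φ r f + Φ r g) :
    ∑ r : Fin ((F.add G).deg + 1), Φ r ((F.add G).comp r) = ∑ r : Fin (F.deg + 1), Φ r (F.comp r) + ∑ r : Fin (G.deg + 1), Φ r (G.comp r) := by
  rw [F.sum_comp_eq Φ h0 (le_max_left F.deg G.deg), G.sum_comp_eq Φ h0 (le_max_right F.deg G.deg),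
    ← Finset.sum_add_distrib, Finset.sum_range]
  exact Finset.sum_congr rfl fun r _ => hadd _ _ _

theorem sum_single_comp {A : Type*} [AddCommMonoid A] (f : Smearing d p) (hf : f.IsSummable)
    (Φ : ∀ r, Smearing d r → A) (h0 : ∀ r, Φ r 0 = 0) :
    ∑ r : Fin ((single f hf).deg + 1), Φ r ((single f hf).comp r) = Φ p f := by
  change ∑ r : Fin (p + 1), Φ r
    (Fin.lastCases (motive := fun r => Smearing d r) f (fun _ => 0) r) = _
  rw [Fin.sum_univ_castSucc]
  simp only [Fin.lastCases_last, Fin.lastCases_castSucc]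
  rw [Finset.sum_eq_zero fun r _ => h0 _, zero_add]
  rfl

end Observable

end Observables

/-! ## Integrability of kernels on bounded regions -/

section Bounded

variable {d : ℕ}

theorem exists_kernel_bound {ι : Type*} [Finite ι] {k : (ι → Pt d) → ℂ} (hk : Continuous k)
    (R : ℝ) : ∃ C : ℝ, 0 ≤ C ∧ ∀ x, (∀ c, ‖x c‖ ≤ R) → ‖k x‖ ≤ C := by
  have hcpt : IsCompact (Set.univ.pi fun _ : ι => Metric.closedBall (0 : Pt d) R) :=
    isCompact_univ_pi fun _ => isCompact_closedBall _ _
  obtain ⟨C, hC⟩ := hcpt.exists_bound_of_continuousOn hk.continuousOn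
  refine ⟨max C 0, le_max_right _ _, fun x hx => (hC x ?_).trans (le_max_left _ _)⟩
  simpa using hx

/-- A bounded open region, with a bound. -/
structure Region (d : ℕ) where
  carrier : Set (Pt d)
  isOpen : IsOpen carrier
  radius : ℝ
  norm_le : ∀ x ∈ carrier, ‖x‖ ≤ radius

theorem exists_region {Λ : Set (Pt d)} (h : IsOpen Λ) (h' : Bornology.IsBounded Λ) :
    ∃ D : Region d, D.carrier = Λ := by
  obtain ⟨R, hR⟩ := h'.exists_norm_le
  exact ⟨⟨Λ, h, R, hR⟩, rfl⟩

namespace Region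

variable (D : Region d)

/-- Lebesgue measure on the region. -/
abbrev vol : Measure (Pt d) := (volume : Measure (Pt d)).restrict D.carrier

theorem isBounded : Bornology.IsBounded D.carrier :=
  (isBounded_iff_forall_norm_le).mpr ⟨D.radius, D.norm_le⟩

instance : IsFiniteMeasure D.vol :=
  ⟨by rw [Measure.restrict_apply_univ]; exact D.isBounded.measure_lt_top⟩

theorem ae_norm_le : ∀ᵐ x ∂D.vol, ‖x‖ ≤ D.radius :=
  (ae_restrict_iff' D.isOpen.measurableSet).mpr (Eventually.of_forall D.norm_le)

theorem ae_pi_norm_le {ι : Type*} [Fintype ι] :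
    ∀ᵐ x ∂(Measure.pi fun _ : ι => D.vol), ∀ c, ‖x c‖ ≤ D.radius :=
  ae_all_iff.mpr fun c => ae_pi_eval D.ae_norm_le c

theorem norm_sitePt_le {h : ℝ} (hh : 0 < h) (k : sites h D.carrier) : ‖sitePt h k‖ ≤ D.radius :=
  D.norm_le _ ((mem_sites hh D.isBounded _).mp k.2)

/-- A bound for the mass of the region, with respect to all of the measures that occur. -/
def bound : ℝ≥0∞ := volume (Metric.closedBall (0 : Pt d) (D.radius + 1))

theorem bound_lt_top : D.bound < ⊤ := Metric.isBounded_closedBall.measure_lt_top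

theorem vol_univ_le : D.vol Set.univ ≤ D.bound := by
  rw [Measure.restrict_apply_univ]
  refine measure_mono fun x hx => ?_
  rw [mem_closedBall_zero_iff]
  linarith [D.norm_le x hx]

end Region

theorem latticeMeasure_apply (h : ℝ) (X : Finset (Fin d → ℤ)) (s : Set X) [DecidablePred (· ∈ s)] :
    latticeMeasure h X s = ENNReal.ofReal (h ^ d) * (Finset.univ.filter (· ∈ s)).card := by
  rw [latticeMeasure, Measure.smul_apply, smul_eq_mul]
  congr 1
  rw [← Measure.count_apply_finset]
  congr 1
  ext x
  simp

theorem latticeMeasure_le_volume {h : ℝ} (hh : 0 < h) (X : Finset (Fin d → ℤ)) {s : Set X}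
    {B : Set (Pt d)} (hB : ∀ k ∈ s, ∀ y, ‖sitePt h k - y‖ ≤ h → y ∈ B) :
    latticeMeasure h X s ≤ volume B := by
  classical
  rw [latticeMeasure_apply]
  have h1 : (⋃ k ∈ Finset.univ.filter (fun k : X => k ∈ s), floorSite h ⁻¹' {(k : Fin d → ℤ)}) ⊆
      B := by
    intro y hy
    simp only [Finset.mem_filter, Finset.mem_univ, true_and, Set.mem_iUnion, Set.mem_preimage,
      Set.mem_singleton_iff] at hy
    obtain ⟨k, hk, hy⟩ := hy
    refine hB k hk y ?_
    rw [sitePt, ← hy]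
    exact norm_latticePt_floorSite_sub_le hh y
  refine le_trans (le_of_eq ?_) (measure_mono h1)
  rw [measure_biUnion_finset]
  · simp [volume_preimage_floorSite hh, mul_comm]
  · intro k _ k' _ hkk'
    refine Set.disjoint_left.mpr fun y hy hy' => hkk' (Subtype.ext ?_)
    exact (Set.mem_singleton_iff.mp hy).symm.trans (Set.mem_singleton_iff.mp hy')
  · exact fun k _ => measurable_floorSite h (measurableSet_singleton _)

theorem Region.lattice_univ_le (D : Region d) {h : ℝ} (hh : 0 < h) (h1 : h ≤ 1) :
    latticeMeasure h (sites h D.carrier) Set.univ ≤ D.bound := by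
  refine latticeMeasure_le_volume hh _ fun k _ y hy => ?_
  rw [mem_closedBall_zero_iff]
  have h2 := D.norm_sitePt_le hh k
  have h3 := norm_sub_norm_le y (sitePt h k)
  rw [norm_sub_rev] at h3
  linarith

end Bounded

/-! ## Limits of observables -/

section Approx

variable {d N : ℕ} {h₀ : ℝ} {D : Region d}

theorem integrable_classical (D : Region d) {ι : Type*} [Fintype ι] {k : (ι → Pt d) → ℂ}
    (hk : Continuous k) (i : ι → Idx) (M : Phase D.carrier) :
    Integrable (fun x => k x * ∏ a, ladder ((M : SpinField D.carrier) (x a)) (i a))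
      (Measure.pi fun _ : ι => D.vol) := by
  obtain ⟨C, -, hC⟩ := exists_kernel_bound hk D.radius
  refine Integrable.of_bound (hk.aestronglyMeasurable.mul
    (Finset.aestronglyMeasurable_fun_prod _ fun a _ => aestronglyMeasurable_pi_eval
      ((continuous_ladder (i a)).comp_aestronglyMeasurable (Lp.aestronglyMeasurable _)) a)) C ?_
  have h1 : ∀ᵐ x ∂(Measure.pi fun _ : ι => D.vol),
      ∀ a, ‖(M : SpinField D.carrier) (x a)‖ ≤ 1 := ae_all_iff.mpr fun a =>
    ae_pi_eval ((SpinEgorov.ae_norm_le (M : SpinField D.carrier)).mono fun y hy => hy.trans M.2) a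
  filter_upwards [h1, D.ae_pi_norm_le] with x hx hxR
  rw [norm_mul, norm_prod]
  have h2 : ∏ a, ‖ladder ((M : SpinField D.carrier) (x a)) (i a)‖ ≤ 1 :=
    Finset.prod_le_one (fun _ _ => norm_nonneg _) fun a _ => (norm_ladder_le _ _).trans (hx a)
  have h3 := mul_le_mul (hC x hxR) h2 (Finset.prod_nonneg fun _ _ => norm_nonneg _)
    ((norm_nonneg _).trans (hC x hxR))
  linarith

theorem classicalMonomial_zero {p : ℕ} (M : Phase D.carrier) :
    classicalMonomial D.carrier (0 : Smearing d p) M = 0 := by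
  simp [classicalMonomial, Smearing.zero_toFun]

theorem classicalMonomial_add {p : ℕ} (f g : Smearing d p) (M : Phase D.carrier) :
    classicalMonomial D.carrier (f + g) M =
      classicalMonomial D.carrier f M + classicalMonomial D.carrier g M := by
  rw [classicalMonomial, classicalMonomial, classicalMonomial, ← Finset.sum_add_distrib]
  refine Finset.sum_congr rfl fun i _ => ?_
  simp only [Smearing.add_toFun, add_mul]
  exact integral_add (integrable_classical D (f.continuous_toFun i) i M)
    (integrable_classical D (g.continuous_toFun i) i M)

theorem classicalMonomial_smul {p : ℕ} (c : ℂ) (f : Smearing d p) (M : Phase D.carrier) :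
    classicalMonomial D.carrier (c • f) M = c * classicalMonomial D.carrier f M := by
  rw [classicalMonomial, classicalMonomial, Finset.mul_sum]
  refine Finset.sum_congr rfl fun i _ => ?_
  rw [← integral_const_mul]
  simp only [Smearing.smul_toFun, mul_assoc]

theorem quantumMonomial_zero {p : ℕ} (h : ℝ) (Λ : Set (Pt d)) :
    quantumMonomial N h Λ (0 : Smearing d p) = 0 := by
  simp [quantumMonomial, Smearing.zero_toFun]

theorem quantumMonomial_add {p : ℕ} (f g : Smearing d p) (h : ℝ) (Λ : Set (Pt d)) :
    quantumMonomial N h Λ (f + g) = quantumMonomial N h Λ f + quantumMonomial N h Λ g := by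
  simp only [quantumMonomial, Smearing.add_toFun, add_smul, Finset.sum_add_distrib]

theorem quantumMonomial_smul {p : ℕ} (c : ℂ) (f : Smearing d p) (h : ℝ) (Λ : Set (Pt d)) :
    quantumMonomial N h Λ (c • f) = c • quantumMonomial N h Λ f := by
  simp only [quantumMonomial, Smearing.smul_toFun, Finset.smul_sum, smul_smul]

theorem Observable.classical_add (F G : Observable d) (M : Phase D.carrier) :
    (F.add G).classical D.carrier M = F.classical D.carrier M + G.classical D.carrier M :=
  F.sum_add_comp G (fun _ f => classicalMonomial D.carrier f M)
    (fun _ => classicalMonomial_zero M) fun _ f g => classicalMonomial_add f g M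

theorem Observable.quantum_add (F G : Observable d) (h : ℝ) (Λ : Set (Pt d)) :
    (F.add G).quantum N h Λ = F.quantum N h Λ + G.quantum N h Λ :=
  F.sum_add_comp G (fun _ f => quantumMonomial N h Λ f)
    (fun _ => quantumMonomial_zero h Λ) fun _ f g => quantumMonomial_add f g h Λ

theorem Observable.classical_smul (c : ℂ) (F : Observable d) (M : Phase D.carrier) :
    (F.smul c).classical D.carrier M = c * F.classical D.carrier M := by
  rw [Observable.classical, Observable.classical, Finset.mul_sum]
  exact Finset.sum_congr rfl fun r _ => classicalMonomial_smul _ _ _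

theorem Observable.quantum_smul (c : ℂ) (F : Observable d) (h : ℝ) (Λ : Set (Pt d)) :
    (F.smul c).quantum N h Λ = c • F.quantum N h Λ := by
  rw [Observable.quantum, Observable.quantum, Finset.smul_sum]
  exact Finset.sum_congr rfl fun r _ => quantumMonomial_smul _ _ _ _

/-- The family of operators `q` and the function `c` are simultaneously approximated by
observables, uniformly in `h` and on phase space. -/
def IsApprox (N : ℕ) (h₀ : ℝ) (D : Region d) (q : ∀ h : ℝ, Op N (sites h D.carrier))
    (c : Phase D.carrier → ℂ) : Prop :=
  ∀ ε : ℝ, 0 < ε → ∃ B : Observable d,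
    (∀ h, 0 < h → h < h₀ → ‖q h - B.quantum N h D.carrier‖ ≤ ε) ∧
    ∀ M, ‖c M - B.classical D.carrier M‖ ≤ ε

namespace IsApprox

variable {q q' : ∀ h : ℝ, Op N (sites h D.carrier)} {c c' : Phase D.carrier → ℂ}

theorem of_close (H : ∀ ε : ℝ, 0 < ε → ∃ q' c', IsApprox N h₀ D q' c' ∧
    (∀ h, 0 < h → h < h₀ → ‖q h - q' h‖ ≤ ε) ∧ ∀ M, ‖c M - c' M‖ ≤ ε) :
    IsApprox N h₀ D q c := by
  intro ε hε
  obtain ⟨q', c', h1, h2, h3⟩ := H (ε / 2) (half_pos hε)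
  obtain ⟨B, hB, hB'⟩ := h1 (ε / 2) (half_pos hε)
  refine ⟨B, fun h hh hh0 => ?_, fun M => ?_⟩
  · rw [← sub_add_sub_cancel _ (q' h)]
    exact (norm_add_le _ _).trans (by linarith [h2 h hh hh0, hB h hh hh0])
  · rw [← sub_add_sub_cancel _ (c' M)]
    exact (norm_add_le _ _).trans (by linarith [h3 M, hB' M])

theorem congr (H : IsApprox N h₀ D q c) (hq : ∀ h, 0 < h → h < h₀ → q' h = q h)
    (hc : ∀ M, c' M = c M) : IsApprox N h₀ D q' c' :=
  of_close fun ε hε => ⟨q, c, H, fun h hh hh0 => by rw [hq h hh hh0, sub_self, norm_zero]; exact hε.le,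
    fun M => by rw [hc M, sub_self, norm_zero]; exact hε.le⟩

theorem observable (B : Observable d) :
    IsApprox N h₀ D (fun h => B.quantum N h D.carrier) (B.classical D.carrier) :=
  fun ε hε => ⟨B, fun h _ _ => by rw [sub_self, norm_zero]; exact hε.le,
    fun M => by rw [sub_self, norm_zero]; exact hε.le⟩

theorem smearing {p : ℕ} (f : Smearing d p) (hf : f.IsSummable) :
    IsApprox N h₀ D (fun h => quantumMonomial N h D.carrier f) (classicalMonomial D.carrier f) :=
  (observable (Observable.single f hf)).congr
    (fun h _ _ => (Observable.sum_single_comp f hf (fun _ f => quantumMonomial N h D.carrier f)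
      fun _ => quantumMonomial_zero h _).symm)
    fun M => (Observable.sum_single_comp f hf (fun _ f => classicalMonomial D.carrier f M)
      fun _ => classicalMonomial_zero M).symm

theorem add (H : IsApprox N h₀ D q c) (H' : IsApprox N h₀ D q' c') :
    IsApprox N h₀ D (fun h => q h + q' h) (fun M => c M + c' M) := by
  intro ε hε
  obtain ⟨B, hB, hB1⟩ := H (ε / 2) (half_pos hε)
  obtain ⟨B', hB', hB1'⟩ := H' (ε / 2) (half_pos hε)
  refine ⟨B.add B', fun h hh hh0 => ?_, fun M => ?_⟩
  · rw [Observable.quantum_add, add_sub_add_comm]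
    exact (norm_add_le _ _).trans (by linarith [hB h hh hh0, hB' h hh hh0])
  · rw [Observable.classical_add, add_sub_add_comm]
    exact (norm_add_le _ _).trans (by linarith [hB1 M, hB1' M])

theorem smul (a : ℂ) (H : IsApprox N h₀ D q c) :
    IsApprox N h₀ D (fun h => a • q h) (fun M => a * c M) := by
  intro ε hε
  obtain ⟨B, hB, hB1⟩ := H (ε / (‖a‖ + 1)) (by positivity)
  have h1 : ‖a‖ * (ε / (‖a‖ + 1)) ≤ ε := by
    rw [mul_div_assoc', div_le_iff₀ (by positivity)]
    nlinarith [norm_nonneg a]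
  refine ⟨B.smul a, fun h hh hh0 => ?_, fun M => ?_⟩
  · rw [Observable.quantum_smul, ← smul_sub, norm_smul]
    exact (mul_le_mul_of_nonneg_left (hB h hh hh0) (norm_nonneg a)).trans h1
  · rw [Observable.classical_smul, ← mul_sub, norm_mul]
    exact (mul_le_mul_of_nonneg_left (hB1 M) (norm_nonneg a)).trans h1

theorem zero : IsApprox N h₀ D (fun _ => 0) (fun _ => 0) :=
  (smearing (0 : Smearing d 0) Smearing.isSummable_zero).congr
    (fun h _ _ => (quantumMonomial_zero h _).symm) fun M => (classicalMonomial_zero M).symm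

theorem sum {α : Type*} (s : Finset α) {q : α → ∀ h : ℝ, Op N (sites h D.carrier)}
    {c : α → Phase D.carrier → ℂ} (H : ∀ a ∈ s, IsApprox N h₀ D (q a) (c a)) :
    IsApprox N h₀ D (fun h => ∑ a ∈ s, q a h) (fun M => ∑ a ∈ s, c a M) := by
  classical
  induction s using Finset.induction_on with
  | empty => simpa using zero
  | insert a s ha ih =>
    simp only [Finset.sum_insert ha]
    exact (H a (Finset.mem_insert_self a s)).add
      (ih fun b hb => H b (Finset.mem_insert_of_mem hb))

end IsApprox

end Approx

/-! ## Observables with given kernels -/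

section Kernels

variable {d N : ℕ}

/-- The symmetrization of a kernel with given labels. -/
def symmSmearing {p : ℕ} (i : Fin p → Idx) (G : (Fin p → Pt d) → ℂ) (hG : Continuous G) :
    Smearing d p where
  toFun l x := ((p.factorial : ℂ))⁻¹ * ∑ σ : Equiv.Perm (Fin p),
    if l = i ∘ σ then G (x ∘ σ.symm) else 0
  continuous_toFun l := by
    refine continuous_const.mul (continuous_finsetSum _ fun σ _ => ?_)
    split_ifs
    · exact hG.comp (continuous_pi fun a => continuous_apply _)
    · exact continuous_const
  symm τ l x := by
    congr 1
    rw [← Equiv.sum_comp (Equiv.mulRight τ)]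
    refine Finset.sum_congr rfl fun σ _ => ?_
    have h1 : (l ∘ τ = i ∘ (Equiv.mulRight τ σ)) ↔ l = i ∘ σ := by
      constructor
      · intro h
        ext1 a
        have := congrFun h (τ.symm a)
        simpa using this
      · rintro rfl
        rfl
    have h2 : (x ∘ τ) ∘ ((Equiv.mulRight τ σ : Equiv.Perm (Fin p))).symm = x ∘ σ.symm := by
      ext1 a
      simp [Equiv.mulRight, Equiv.Perm.mul_def]
    rw [h2]
    simp only [h1]

theorem sum_symmSmearing {p : ℕ} {A : Type*} [AddCommGroup A] [Module ℂ A]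
    (Φ : Equiv.Perm (Fin p) → A) {a : A} (hΦ : ∀ σ, Φ σ = a) :
    ((p.factorial : ℂ))⁻¹ • ∑ σ, Φ σ = a := by
  simp only [hΦ, Finset.sum_const, Finset.card_univ, Fintype.card_perm, Fintype.card_fin,
    ← Nat.cast_smul_eq_nsmul ℂ, smul_smul]
  rw [inv_mul_cancel₀ (by exact_mod_cast p.factorial_ne_zero), one_smul]

theorem quantumMonomial_symmSmearing {p : ℕ} (i : Fin p → Idx) (G : (Fin p → Pt d) → ℂ)
    (hG : Continuous G) (h : ℝ) (Λ : Set (Pt d)) :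
    quantumMonomial N h Λ (symmSmearing i G hG) = ((h ^ d : ℝ) : ℂ) ^ p •
      ∑ x : Fin p → sites h Λ, G (fun a => sitePt h (x a)) • normalOp N i x := by
  have h1 : quantumMonomial N h Λ (symmSmearing i G hG) = ((p.factorial : ℂ))⁻¹ •
      ∑ σ : Equiv.Perm (Fin p), ∑ x : Fin p → sites h Λ,
        (G ((fun a => sitePt h (x a)) ∘ σ.symm) * ((h ^ d : ℝ) : ℂ) ^ p) • normalOp N (i ∘ σ) x := by
    rw [quantumMonomial]
    simp only [symmSmearing, normalOrdered_eq_normalOp, smul_smul, Finset.mul_sum, Finset.sum_mul,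
      Finset.sum_smul, Finset.smul_sum, mul_ite, ite_mul, mul_zero, zero_mul, ite_smul, zero_smul]
    rw [Finset.sum_congr rfl fun l _ => Finset.sum_comm, Finset.sum_comm]
    refine Finset.sum_congr rfl fun σ _ => ?_
    rw [Finset.sum_comm]
    refine Finset.sum_congr rfl fun x _ => ?_
    rw [Finset.sum_ite_eq' Finset.univ (i ∘ σ), if_pos (Finset.mem_univ _), mul_assoc]
    rfl
  rw [h1]
  refine sum_symmSmearing _ fun σ => ?_
  rw [Finset.smul_sum, ← Equiv.sum_comp (Equiv.arrowCongr σ.symm (Equiv.refl (sites h Λ)))]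
  refine Finset.sum_congr rfl fun x _ => ?_
  have h2 : (Equiv.arrowCongr σ.symm (Equiv.refl (sites h Λ))) x = x ∘ σ := rfl
  rw [h2, normalOp_comp, smul_smul, mul_comm]
  congr 3
  ext1 a
  simp

theorem coe_piCongrLeft_symm {Y : Type*} [MeasurableSpace Y] {p : ℕ} (σ : Equiv.Perm (Fin p)) :
    ⇑(MeasurableEquiv.piCongrLeft (fun _ : Fin p => Y) σ.symm) = fun x => x ∘ σ := by
  ext x a
  have h := Equiv.piCongrLeft_apply_apply (fun _ : Fin p => Y) σ.symm x (σ a)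
  rw [Equiv.symm_apply_apply] at h
  exact h

theorem measurePreserving_comp_perm {Y : Type*} [MeasurableSpace Y] {p : ℕ} (ν : Measure Y)
    [SigmaFinite ν] (σ : Equiv.Perm (Fin p)) :
    MeasurePreserving (fun x : Fin p → Y => x ∘ σ) (Measure.pi fun _ => ν)
      (Measure.pi fun _ => ν) := by
  rw [← coe_piCongrLeft_symm]
  exact measurePreserving_piCongrLeft (fun _ : Fin p => ν) σ.symm

theorem classicalMonomial_symmSmearing {D : Region d} {p : ℕ} (i : Fin p → Idx)
    (G : (Fin p → Pt d) → ℂ) (hG : Continuous G) (M : Phase D.carrier) :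
    classicalMonomial D.carrier (symmSmearing i G hG) M =
      ∫ x, G x * ∏ a, ladder ((M : SpinField D.carrier) (x a)) (i a)
        ∂(Measure.pi fun _ : Fin p => D.vol) := by
  have hGσ : ∀ σ : Equiv.Perm (Fin p), Continuous fun x : Fin p → Pt d => G (x ∘ σ.symm) :=
    fun σ => hG.comp (continuous_pi fun a => continuous_apply _)
  have h1 : classicalMonomial D.carrier (symmSmearing i G hG) M = ((p.factorial : ℂ))⁻¹ •
      ∑ σ : Equiv.Perm (Fin p), ∫ x, G (x ∘ σ.symm) *
        ∏ a, ladder ((M : SpinField D.carrier) (x a)) (i (σ a))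
          ∂(Measure.pi fun _ : Fin p => D.vol) := by
    rw [classicalMonomial, powMeasure]
    have h2 : ∀ l : Fin p → Idx, ∫ x, (symmSmearing i G hG).toFun l x *
        ∏ a, ladder ((M : SpinField D.carrier) (x a)) (l a) ∂(Measure.pi fun _ : Fin p => D.vol) =
        ∑ σ : Equiv.Perm (Fin p), if l = i ∘ σ then ((p.factorial : ℂ))⁻¹ * ∫ x, G (x ∘ σ.symm) *
          ∏ a, ladder ((M : SpinField D.carrier) (x a)) (i (σ a))
            ∂(Measure.pi fun _ : Fin p => D.vol) else 0 := by
      intro l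
      simp only [symmSmearing, Finset.mul_sum, Finset.sum_mul]
      rw [integral_finsetSum]
      · refine Finset.sum_congr rfl fun σ _ => ?_
        split_ifs with hl
        · subst hl
          rw [← integral_const_mul]
          simp only [mul_assoc]
          rfl
        · simp
      · intro σ _
        split_ifs
        · simp only [mul_assoc]
          exact (integrable_classical D (hGσ σ) l M).const_mul _
        · simp
    simp only [h2]
    rw [Finset.sum_comm, smul_eq_mul, Finset.mul_sum]
    refine Finset.sum_congr rfl fun σ _ => ?_
    rw [Finset.sum_ite_eq' Finset.univ (i ∘ σ), if_pos (Finset.mem_univ _)]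
  rw [h1]
  refine sum_symmSmearing _ fun σ => ?_
  have h3 := measurePreserving_comp_perm D.vol σ
  have h4 : MeasurableEmbedding fun x : Fin p → Pt d => x ∘ σ := by
    rw [← coe_piCongrLeft_symm]
    exact (MeasurableEquiv.piCongrLeft (fun _ : Fin p => Pt d) σ.symm).measurableEmbedding
  rw [← h3.integral_comp h4]
  refine integral_congr_ae (Eventually.of_forall fun x => ?_)
  have h5 : (x ∘ σ) ∘ σ.symm = x := by ext1 a; simp
  simp only [h5]
  congr 1
  exact Equiv.prod_comp σ fun a => ladder ((M : SpinField D.carrier) (x a)) (i a)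

theorem isSummable_symmSmearing {p : ℕ} (i : Fin p → Idx) {G : (Fin p → Pt d) → ℂ}
    (hG : Continuous G) {R : ℝ} (hR : ∀ x, G x ≠ 0 → ∀ a, ‖x a‖ ≤ R) :
    (symmSmearing i G hG).IsSummable := by
  obtain ⟨C, hC0, hC⟩ := exists_kernel_bound hG R
  have hC' : ∀ x, ‖G x‖ ≤ C := by
    intro x
    by_cases hx : G x = 0
    · rw [hx, norm_zero]; exact hC0
    · exact hC x (hR x hx)
  set S := symmSmearing i G hG
  have hS : ∀ l x, ‖S.toFun l x‖ ≤ C := by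
    intro l x
    change ‖((p.factorial : ℂ))⁻¹ * ∑ σ : Equiv.Perm (Fin p), _‖ ≤ C
    rw [norm_mul, norm_inv, Complex.norm_natCast, inv_mul_le_iff₀
      (by exact_mod_cast p.factorial_pos)]
    refine (norm_sum_le _ _).trans ?_
    have h1 : ∀ σ ∈ (Finset.univ : Finset (Equiv.Perm (Fin p))),
        ‖if l = i ∘ σ then G (x ∘ σ.symm) else 0‖ ≤ C := by
      intro σ _
      split_ifs
      · exact hC' _
      · rwa [norm_zero]
    refine (Finset.sum_le_card_nsmul _ _ _ h1).trans ?_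
    rw [Finset.card_univ, Fintype.card_perm, Fintype.card_fin, nsmul_eq_mul]
  have hS0 : ∀ l x a, R < ‖x a‖ → S.toFun l x = 0 := by
    intro l x a hx
    change ((p.factorial : ℂ))⁻¹ * ∑ σ : Equiv.Perm (Fin p), _ = 0
    rw [Finset.sum_eq_zero, mul_zero]
    intro σ _
    split_ifs
    · by_contra h
      have := hR _ h (σ a)
      simp at this
      linarith
    · rfl
  set W : ℝ≥0∞ := volume (Metric.closedBall (0 : Pt d) (R + 1)) with hW
  have hWt : W < ⊤ := Metric.isBounded_closedBall.measure_lt_top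
  refine Smearing.isSummable_iff.mpr
    ⟨∑ l : Fin p → Idx, ENNReal.ofReal C * W ^ p, ?_, ?_⟩
  · refine ENNReal.sum_lt_top.mpr fun l _ => ?_
    exact ENNReal.mul_lt_top ENNReal.ofReal_lt_top (ENNReal.pow_lt_top hWt)
  filter_upwards [Ioc_mem_nhdsGT (zero_lt_one (α := ℝ))] with h hh
  rw [norm1, Finset.mul_sum]
  refine Finset.sum_le_sum fun l _ => ?_
  have h1 := lintegral_floorSite (ι := Fin p) hh.1 fun k => ‖S.toFun l fun a => latticePt h (k a)‖ₑ
  rw [Fintype.card_fin, ← ENNReal.ofReal_pow (pow_nonneg hh.1.le _), ← pow_mul, mul_comm d p] at h1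
  rw [← h1]
  have h2 : ∀ y : Fin p → Pt d, ‖S.toFun l fun a => latticePt h (floorSite h (y a))‖ₑ ≤
      (Set.univ.pi fun _ : Fin p => Metric.closedBall (0 : Pt d) (R + 1)).indicator
        (fun _ => ENNReal.ofReal C) y := by
    intro y
    by_cases hy : y ∈ Set.univ.pi fun _ : Fin p => Metric.closedBall (0 : Pt d) (R + 1)
    · rw [Set.indicator_of_mem hy, ← ofReal_norm]
      exact ENNReal.ofReal_le_ofReal (hS _ _)
    · rw [Set.indicator_of_notMem hy]
      simp only [Set.mem_univ_pi, mem_closedBall_zero_iff, not_forall, not_le] at hy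
      obtain ⟨a, ha⟩ := hy
      rw [hS0 l _ a, enorm_zero]
      have h3 := norm_latticePt_floorSite_sub_le hh.1 (y a)
      have h4 := norm_sub_norm_le (y a) (latticePt h (floorSite h (y a)))
      rw [norm_sub_rev] at h4
      linarith [hh.2]
  refine (lintegral_mono h2).trans ?_
  rw [lintegral_indicator_const (MeasurableSet.univ_pi fun _ => measurableSet_closedBall),
    Measure.pi_pi]
  simp [hW]

end Kernels

/-! ## Configurations close to the diagonals -/

section Near

variable {d : ℕ} {Y : Type*} [MeasurableSpace Y]

/-- The configurations in which two points are closer than `δ`. -/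
def nearSet (pos : Y → Pt d) (δ : ℝ) (p : ℕ) : Set (Fin p → Y) :=
  {x | ∃ a b, a ≠ b ∧ ‖pos (x a) - pos (x b)‖ < δ}

theorem measure_near_succAbove_le {ν : Measure Y} [IsFiniteMeasure ν] {pos : Y → Pt d}
    (hpos : Measurable pos) {δ : ℝ} {W η : ℝ≥0∞} (hW : ν Set.univ ≤ W)
    (hη : ∀ y, ν {y' | ‖pos y' - pos y‖ < δ} ≤ η) {n : ℕ} (a : Fin (n + 1)) (b : Fin n) :
    (Measure.pi fun _ : Fin (n + 1) => ν) {x | ‖pos (x a) - pos (x (a.succAbove b))‖ < δ} ≤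
      η * W ^ n := by
  have h1 := measurePreserving_piFinSuccAbove (fun _ : Fin (n + 1) => ν) a
  let s : Set (Y × (Fin n → Y)) := {z | ‖pos z.1 - pos (z.2 b)‖ < δ}
  have hs : MeasurableSet s :=
    measurableSet_lt (((hpos.comp measurable_fst).sub
      (hpos.comp ((measurable_pi_apply b).comp measurable_snd))).norm) measurable_const
  have h3 : (ν.prod (Measure.pi fun _ : Fin n => ν)) s ≤ η * W ^ n := by
    refine (Measure.prod_apply_symm hs).trans_le ?_
    have h4 : ∀ z : Fin n → Y, ν ((fun y => (y, z)) ⁻¹' s) ≤ η := fun z => hη (z b)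
    have h5 : (Measure.pi fun _ : Fin n => ν) Set.univ ≤ W ^ n := by
      rw [Measure.pi_univ]
      simp only [Finset.prod_const, Finset.card_univ, Fintype.card_fin]
      exact pow_le_pow_left' hW n
    calc ∫⁻ z, ν ((fun y => (y, z)) ⁻¹' s) ∂(Measure.pi fun _ : Fin n => ν)
        ≤ ∫⁻ _, η ∂(Measure.pi fun _ : Fin n => ν) := lintegral_mono h4
      _ = η * (Measure.pi fun _ : Fin n => ν) Set.univ := lintegral_const η
      _ ≤ η * W ^ n := mul_le_mul_right h5 η
  have h6 := h1.measure_preimage hs.nullMeasurableSet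
  exact h6.trans_le h3

theorem measure_near_pair_le {ν : Measure Y} [IsFiniteMeasure ν] {pos : Y → Pt d}
    (hpos : Measurable pos) {δ : ℝ} {W η : ℝ≥0∞} (hW : ν Set.univ ≤ W)
    (hη : ∀ y, ν {y' | ‖pos y' - pos y‖ < δ} ≤ η) {p : ℕ} {a b : Fin p} (hab : a ≠ b) :
    (Measure.pi fun _ : Fin p => ν) {x | ‖pos (x a) - pos (x b)‖ < δ} ≤ η * W ^ (p - 1) := by
  cases p with
  | zero => exact a.elim0
  | succ n =>
    obtain ⟨c, hc⟩ := Fin.exists_succAbove_eq hab.symm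
    rw [← hc]
    exact measure_near_succAbove_le hpos hW hη a c

theorem measure_nearSet_le {ν : Measure Y} [IsFiniteMeasure ν] {pos : Y → Pt d}
    (hpos : Measurable pos) {δ : ℝ} {W η : ℝ≥0∞} (hW : ν Set.univ ≤ W)
    (hη : ∀ y, ν {y' | ‖pos y' - pos y‖ < δ} ≤ η) (p : ℕ) :
    (Measure.pi fun _ : Fin p => ν) (nearSet pos δ p) ≤ (p * p : ℕ) * (η * W ^ (p - 1)) := by
  have h1 : nearSet pos δ p ⊆ ⋃ z ∈ (Finset.univ : Finset (Fin p × Fin p)).filter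
      (fun z => z.1 ≠ z.2), {x : Fin p → Y | ‖pos (x z.1) - pos (x z.2)‖ < δ} := by
    rintro x ⟨a, b, hab, hx⟩
    simp only [Set.mem_iUnion]
    exact ⟨(a, b), by simpa using hab, hx⟩
  refine (measure_mono h1).trans ((measure_biUnion_finset_le _ _).trans ?_)
  refine (Finset.sum_le_card_nsmul _ _ (η * W ^ (p - 1)) fun z hz =>
    measure_near_pair_le hpos hW hη (by simpa using hz)).trans ?_
  rw [nsmul_eq_mul]
  refine mul_le_mul_left ?_ _
  have h2 := Finset.card_filter_le (Finset.univ : Finset (Fin p × Fin p)) fun z => z.1 ≠ z.2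
  rw [Finset.card_univ, Fintype.card_prod, Fintype.card_fin] at h2
  exact_mod_cast h2

theorem enorm_integral_le_of_near {Z B : Type*} [MeasurableSpace Z] [NormedAddCommGroup B]
    [NormedSpace ℝ B] {ζ : Measure Z} {f : Z → B} {s : Set Z} {c : ℝ}
    (hf : ∀ᵐ z ∂ζ, ‖f z‖ ≤ c) (hs : ∀ᵐ z ∂ζ, z ∉ s → f z = 0) :
    ‖∫ z, f z ∂ζ‖ₑ ≤ ENNReal.ofReal c * ζ s := by
  refine (enorm_integral_le_lintegral_enorm _).trans
    (le_trans (lintegral_mono_ae ?_) (lintegral_indicator_const_le s _))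
  filter_upwards [hf, hs] with z hz hz'
  by_cases h : z ∈ s
  · rw [Set.indicator_of_mem h, ← ofReal_norm]
    exact ENNReal.ofReal_le_ofReal hz
  · rw [hz' h, enorm_zero]
    exact zero_le

end Near

/-! ## Kernels supported on a coincidence pattern -/

section Pattern

variable {d : ℕ}

/-- The continuous tent function of height one and radius `δ`. -/
def tent (δ : ℝ) (v : Pt d) : ℝ := max 0 (1 - ‖v‖ / δ)

theorem continuous_tent (δ : ℝ) : Continuous (tent δ : Pt d → ℝ) := by
  unfold tent; fun_prop

theorem tent_nonneg (δ : ℝ) (v : Pt d) : 0 ≤ tent δ v := le_max_left _ _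

theorem tent_le_one {δ : ℝ} (hδ : 0 < δ) (v : Pt d) : tent δ v ≤ 1 :=
  max_le zero_le_one (by have := div_nonneg (norm_nonneg v) hδ.le; linarith)

theorem tent_zero (δ : ℝ) : tent δ (0 : Pt d) = 1 := by simp [tent]

theorem tent_eq_zero {δ : ℝ} (hδ : 0 < δ) {v : Pt d} (h : δ ≤ ‖v‖) : tent δ v = 0 :=
  max_eq_left (by have := (one_le_div hδ).mpr h; linarith)

/-- A continuous cutoff. -/
def cutoff (R : ℝ) {p : ℕ} (x : Fin p → Pt d) : ℝ := ∏ a, max 0 (min 1 (R + 1 - ‖x a‖))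

theorem continuous_cutoff (R : ℝ) (p : ℕ) : Continuous (cutoff R : (Fin p → Pt d) → ℝ) := by
  unfold cutoff; fun_prop

theorem cutoff_eq_one {R : ℝ} {p : ℕ} {x : Fin p → Pt d} (h : ∀ a, ‖x a‖ ≤ R) :
    cutoff R x = 1 :=
  Finset.prod_eq_one fun a _ => by
    rw [min_eq_left (by linarith [h a]), max_eq_right zero_le_one]

theorem norm_le_of_cutoff_ne_zero {R : ℝ} {p : ℕ} {x : Fin p → Pt d} (h : cutoff R x ≠ 0)
    (a : Fin p) : ‖x a‖ ≤ R + 1 := by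
  by_contra! ha
  refine h (Finset.prod_eq_zero (Finset.mem_univ a) (max_eq_left ?_))
  exact (min_le_right _ _).trans (by linarith)

variable {J : Type} {p : ℕ}

/-- The continuous approximation of the indicator function of a coincidence pattern. -/
def softPattern (δ : ℝ) (b : Fin p → J) (x : Fin p → Pt d) : ℝ :=
  open Classical in
  ∏ z : Fin p × Fin p, if b z.1 = b z.2 then tent δ (x z.1 - x z.2) else 1 - tent δ (x z.1 - x z.2)

theorem continuous_softPattern (δ : ℝ) (b : Fin p → J) :
    Continuous (softPattern δ b : (Fin p → Pt d) → ℝ) := by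
  refine continuous_finsetProd _ fun z _ => ?_
  have h : Continuous fun x : Fin p → Pt d => tent δ (x z.1 - x z.2) :=
    (continuous_tent δ).comp (by fun_prop)
  split_ifs
  · exact h
  · exact continuous_const.sub h

theorem softPattern_mem {δ : ℝ} (hδ : 0 < δ) (b : Fin p → J) (x : Fin p → Pt d) :
    0 ≤ softPattern δ b x ∧ softPattern δ b x ≤ 1 := by
  classical
  have h : ∀ z : Fin p × Fin p, 0 ≤ (if b z.1 = b z.2 then tent δ (x z.1 - x z.2) else
      1 - tent δ (x z.1 - x z.2)) ∧ (if b z.1 = b z.2 then tent δ (x z.1 - x z.2) else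
      1 - tent δ (x z.1 - x z.2)) ≤ 1 := by
    intro z
    have h1 := tent_nonneg δ (x z.1 - x z.2)
    have h2 := tent_le_one hδ (x z.1 - x z.2)
    split_ifs <;> constructor <;> linarith
  unfold softPattern
  exact ⟨Finset.prod_nonneg fun z _ => by convert (h z).1,
    Finset.prod_le_one (fun z _ => by convert (h z).1) fun z _ => by convert (h z).2⟩

/-- The points with equal positions are exactly those in the same block. -/
def HasPattern {ι Y : Type*} (b : ι → J) (x : ι → Y) : Prop :=
  ∀ a a', x a = x a' ↔ b a = b a'

theorem softPattern_eq {δ : ℝ} (hδ : 0 < δ) (b : Fin p → J) {x : Fin p → Pt d}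
    (hx : ∀ a a', x a = x a' ∨ δ ≤ ‖x a - x a'‖) [Decidable (HasPattern b x)] :
    softPattern δ b x = if HasPattern b x then 1 else 0 := by
  classical
  split_ifs with h
  · refine Finset.prod_eq_one fun z _ => ?_
    split_ifs with hb
    · rw [(h z.1 z.2).mpr hb, sub_self, tent_zero]
    · have h1 : x z.1 ≠ x z.2 := fun h' => hb ((h z.1 z.2).mp h')
      rw [tent_eq_zero hδ ((hx z.1 z.2).resolve_left h1), sub_zero]
  · rw [HasPattern] at h
    push Not at h
    obtain ⟨a, a', h⟩ := h
    refine Finset.prod_eq_zero (Finset.mem_univ (a, a')) ?_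
    rcases h with ⟨h1, h2⟩ | ⟨h1, h2⟩
    · rw [if_neg h2]
      simp only
      rw [h1, sub_self, tent_zero, sub_self]
    · rw [if_pos h2]
      exact tent_eq_zero hδ ((hx a a').resolve_left h1)

end Pattern

section Basic

variable {d N : ℕ} {D : Region d} {J : Type} [Fintype J] {p : ℕ}

theorem norm_normalOp_le (hN : 0 < N) {X : Finset (Fin d → ℤ)} (i : Fin p → Idx) (x : Fin p → X) :
    ‖normalOp N i x‖ ≤ Real.sqrt 2 ^ p := by
  rw [← word_normalList_quantumSpin]
  refine (norm_word_le _ fun c => norm_quantumSpin_le hN _ _).trans ?_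
  rw [length_normalList]

theorem sitePt_injective {h : ℝ} (hh : 0 < h) {X : Finset (Fin d → ℤ)} :
    Function.Injective (sitePt h : X → Pt d) := by
  intro k k' hk
  refine Subtype.ext (funext fun a => ?_)
  have := congrFun hk a
  simp only [sitePt, latticePt] at this
  exact_mod_cast mul_left_cancel₀ hh.ne' this

theorem le_norm_sitePt_sub {h : ℝ} (hh : 0 < h) {X : Finset (Fin d → ℤ)} {k k' : X}
    (hk : k ≠ k') : h ≤ ‖sitePt h k - sitePt h k'‖ := by
  obtain ⟨a, ha⟩ := Function.ne_iff.mp fun h' => hk (Subtype.ext h')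
  refine le_trans ?_ (norm_le_pi_norm _ a)
  have h1 : (1 : ℝ) ≤ |((k : Fin d → ℤ) a : ℝ) - ((k' : Fin d → ℤ) a : ℝ)| := by
    exact_mod_cast Int.one_le_abs (sub_ne_zero.mpr ha)
  rw [Pi.sub_apply, sitePt, sitePt, latticePt, latticePt, ← mul_sub, norm_mul, Real.norm_eq_abs,
    Real.norm_eq_abs, abs_of_pos hh]
  nlinarith

/-- The kernel which is supported on a coincidence pattern. -/
def patternKernel (b : Fin p → J) (s : J → Fin p) (K : (J → Pt d) → ℂ) (x : Fin p → Pt d) : ℂ :=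
  open Classical in if HasPattern b x then K (x ∘ s) else 0

theorem isApprox_patternKernel (hd : 0 < d) (hN : 0 < N) {h₀ : ℝ} (h₀1 : h₀ ≤ 1) (D : Region d)
    (b : Fin p → J) (s : J → Fin p) (i : Fin p → Idx) {K : (J → Pt d) → ℂ} (hK : Continuous K)
    [Decidable (Function.Injective b)] :
    IsApprox N h₀ D (fun h => ((h ^ d : ℝ) : ℂ) ^ p • ∑ x : Fin p → sites h D.carrier,
        patternKernel b s K (fun a => sitePt h (x a)) • normalOp N i x)
      (fun M => if Function.Injective b then
        ∫ x, K (x ∘ s) * ∏ a, ladder ((M : SpinField D.carrier) (x a)) (i a)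
          ∂(Measure.pi fun _ : Fin p => D.vol) else 0) := by
  classical
  obtain ⟨C, hC0, hC⟩ := exists_kernel_bound hK D.radius
  refine IsApprox.of_close fun ε hε => ?_
  set Q : ℝ := 2 * C * Real.sqrt 2 ^ p * ((p * p : ℕ) * D.bound.toReal ^ (p - 1)) with hQ
  have hQ0 : 0 ≤ Q := by positivity
  obtain ⟨δ, hδ, hδ4, hδε⟩ : ∃ δ : ℝ, 0 < δ ∧ 4 * δ ≤ 1 ∧ Q * (4 * δ) ≤ ε := by
    refine ⟨min (1 / 4) (ε / (4 * (Q + 1))), by positivity, ?_, ?_⟩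
    · linarith [min_le_left (1 / 4) (ε / (4 * (Q + 1)))]
    · have h1 := min_le_right (1 / 4) (ε / (4 * (Q + 1)))
      rw [le_div_iff₀ (by positivity)] at h1
      have h2 : 0 ≤ min (1 / 4) (ε / (4 * (Q + 1))) := by positivity
      nlinarith
  have hδd : (4 * δ) ^ d ≤ 4 * δ := by
    simpa using pow_le_pow_of_le_one (by positivity) hδ4 hd
  set G : (Fin p → Pt d) → ℂ := fun x =>
    (cutoff D.radius x : ℂ) * K (x ∘ s) * (softPattern δ b x : ℂ) with hG
  have hKs : Continuous fun x : Fin p → Pt d => K (x ∘ s) :=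
    hK.comp (continuous_pi fun j => continuous_apply _)
  have hGc : Continuous G := ((Complex.continuous_ofReal.comp (continuous_cutoff _ _)).mul hKs).mul
    (Complex.continuous_ofReal.comp (continuous_softPattern δ b))
  have hGsupp : ∀ x, G x ≠ 0 → ∀ a, ‖x a‖ ≤ D.radius + 1 := by
    intro x hx a
    refine norm_le_of_cutoff_ne_zero (fun h => hx ?_) a
    simp [hG, h]
  have hGb : ∀ x : Fin p → Pt d, (∀ a, ‖x a‖ ≤ D.radius) → ‖G x‖ ≤ C := by
    intro x hx
    simp only [hG]
    rw [cutoff_eq_one hx, Complex.ofReal_one, one_mul, norm_mul, Complex.norm_real,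
      Real.norm_eq_abs, abs_of_nonneg (softPattern_mem hδ b x).1]
    have := mul_le_mul (hC (x ∘ s) fun j => hx _) (softPattern_mem hδ b x).2
      (softPattern_mem hδ b x).1 hC0
    linarith
  have hPb : ∀ x : Fin p → Pt d, (∀ a, ‖x a‖ ≤ D.radius) → ‖patternKernel b s K x‖ ≤ C := by
    intro x hx
    rw [patternKernel]
    split_ifs
    · exact hC (x ∘ s) fun j => hx _
    · rwa [norm_zero]
  have hgap : ∀ x : Fin p → Pt d, (∀ a, ‖x a‖ ≤ D.radius) →
      (∀ a a', x a = x a' ∨ δ ≤ ‖x a - x a'‖) → G x = patternKernel b s K x := by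
    intro x hx hx'
    simp only [hG]
    rw [cutoff_eq_one hx, softPattern_eq hδ b hx', patternKernel]
    split_ifs <;> simp
  have hfin : ∀ {Y : Type} [MeasurableSpace Y] (ν : Measure Y) [IsFiniteMeasure ν]
      (pos : Y → Pt d), Measurable pos → ν Set.univ ≤ D.bound →
      (∀ y, ν {y' | ‖pos y' - pos y‖ < δ} ≤ ENNReal.ofReal ((4 * δ) ^ d)) →
      ENNReal.ofReal (2 * C * Real.sqrt 2 ^ p) *
        (Measure.pi fun _ : Fin p => ν) (nearSet pos δ p) ≤ ENNReal.ofReal ε := by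
    intro Y _ ν _ pos hpos hW hη
    refine (mul_le_mul_right (measure_nearSet_le hpos hW hη p) _).trans ?_
    have h1 : D.bound ^ (p - 1) = ENNReal.ofReal (D.bound.toReal ^ (p - 1)) := by
      rw [ENNReal.ofReal_pow ENNReal.toReal_nonneg, ENNReal.ofReal_toReal D.bound_lt_top.ne]
    rw [h1, ← ENNReal.ofReal_mul (by positivity), ← ENNReal.ofReal_natCast,
      ← ENNReal.ofReal_mul (by positivity), ← ENNReal.ofReal_mul (by positivity)]
    refine ENNReal.ofReal_le_ofReal (le_trans (le_trans (le_of_eq ?_)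
      (mul_le_mul_of_nonneg_left hδd hQ0)) hδε)
    rw [hQ]
    ring
  refine ⟨_, _, IsApprox.smearing (symmSmearing i G hGc) (isSummable_symmSmearing i hGc hGsupp),
    fun h hh hh0 => ?_, fun M => ?_⟩
  · have hR : ∀ (x : Fin p → sites h D.carrier) a, ‖sitePt h (x a)‖ ≤ D.radius :=
      fun x a => D.norm_sitePt_le hh _
    rw [quantumMonomial_symmSmearing, ← smul_sub, ← Finset.sum_sub_distrib]
    simp only [← sub_smul]
    rcases lt_or_ge h δ with hδh | hδh
    · rw [← ENNReal.ofReal_le_ofReal_iff hε.le, ofReal_norm]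
      have h1 := integral_lattice (ι := Fin p) hh (X := sites h D.carrier) fun x =>
        (patternKernel b s K (fun a => sitePt h (x a)) - G fun a => sitePt h (x a)) • normalOp N i x
      rw [Fintype.card_fin] at h1
      rw [← h1]
      refine (enorm_integral_le_of_near (s := nearSet (sitePt h) δ p)
        (c := 2 * C * Real.sqrt 2 ^ p) (Eventually.of_forall fun x => ?_)
        (Eventually.of_forall fun x hx => ?_)).trans
        (hfin (latticeMeasure h (sites h D.carrier)) (sitePt h) (measurable_of_finite _)
          (D.lattice_univ_le hh (hh0.le.trans h₀1)) fun y => ?_)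
      · rw [norm_smul]
        refine mul_le_mul ?_ (norm_normalOp_le hN i x) (norm_nonneg _) (by positivity)
        refine (norm_sub_le _ _).trans ?_
        linarith [hPb _ (hR x), hGb _ (hR x)]
      · rw [hgap _ (hR x), sub_self, zero_smul]
        intro a a'
        by_cases haa : a = a'
        · left; rw [haa]
        · right
          by_contra! hlt
          exact hx ⟨a, a', haa, hlt⟩
      · refine (latticeMeasure_le_volume hh _ (B := Metric.closedBall (sitePt h y) (2 * δ))
          fun k hk z hz => ?_).trans (le_of_eq ?_)
        · rw [Metric.mem_closedBall, dist_eq_norm]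
          have h2 : z - sitePt h y = -(sitePt h k - z) + (sitePt h k - sitePt h y) := by abel
          rw [h2]
          refine (norm_add_le _ _).trans ?_
          rw [norm_neg]
          have h3 : ‖sitePt h k - sitePt h y‖ < δ := hk
          linarith
        · rw [Real.volume_pi_closedBall _ (by positivity), Fintype.card_fin]
          ring_nf
    · rw [Finset.sum_eq_zero, smul_zero, norm_zero]
      · exact hε.le
      intro x _
      rw [hgap _ (hR x), sub_self, zero_smul]
      intro a a'
      by_cases haa : x a = x a'
      · left; rw [haa]
      · right; exact hδh.trans (le_norm_sitePt_sub hh haa)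
  · rw [classicalMonomial_symmSmearing]
    set P : (Fin p → Pt d) → ℂ := fun x => if Function.Injective b then K (x ∘ s) else 0 with hP
    set w : (Fin p → Pt d) → ℂ := fun x =>
      ∏ a, ladder ((M : SpinField D.carrier) (x a)) (i a) with hw
    have hPc : Continuous P := by
      simp only [hP]
      split_ifs
      · exact hKs
      · exact continuous_const
    have h1 : (if Function.Injective b then ∫ x, K (x ∘ s) * w x
        ∂(Measure.pi fun _ : Fin p => D.vol) else 0) =
        ∫ x, P x * w x ∂(Measure.pi fun _ : Fin p => D.vol) := by
      simp only [hP]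
      split_ifs <;> simp
    rw [h1, ← integral_sub (integrable_classical D hPc i M) (integrable_classical D hGc i M),
      ← ENNReal.ofReal_le_ofReal_iff hε.le, ofReal_norm]
    refine (enorm_integral_le_of_near (s := nearSet id δ p)
      (c := 2 * C * Real.sqrt 2 ^ p) ?_ ?_).trans
      (hfin D.vol id measurable_id D.vol_univ_le fun y => ?_)
    · have h2 : ∀ᵐ x ∂(Measure.pi fun _ : Fin p => D.vol),
          ∀ a, ‖(M : SpinField D.carrier) (x a)‖ ≤ 1 := ae_all_iff.mpr fun a => ae_pi_eval
        ((SpinEgorov.ae_norm_le (M : SpinField D.carrier)).mono fun y hy => hy.trans M.2) a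
      filter_upwards [h2, D.ae_pi_norm_le] with x hx hxR
      rw [← sub_mul, norm_mul]
      have h3 : ‖w x‖ ≤ Real.sqrt 2 ^ p := (norm_prod_le_one fun a =>
        (norm_ladder_le _ _).trans (hx a)).trans
          (one_le_pow₀ (Real.one_le_sqrt.mpr one_le_two))
      refine mul_le_mul ?_ h3 (norm_nonneg _) (by positivity)
      refine (norm_sub_le _ _).trans ?_
      have h4 : ‖P x‖ ≤ C := by
        simp only [hP]
        split_ifs
        · exact hC (x ∘ s) fun j => hxR _
        · rwa [norm_zero]
      linarith [h4, hGb _ hxR]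
    · filter_upwards [D.ae_pi_norm_le] with x hxR hx
      have hsep : ∀ a a', a ≠ a' → δ ≤ ‖x a - x a'‖ := by
        intro a a' haa
        by_contra! hlt
        exact hx ⟨a, a', haa, hlt⟩
      have hinj : ∀ a a', x a = x a' ↔ a = a' := by
        refine fun a a' => ⟨fun h => ?_, fun h => by rw [h]⟩
        by_contra haa
        have := hsep a a' haa
        rw [h, sub_self, norm_zero] at this
        linarith
      have hpat : HasPattern b x ↔ Function.Injective b :=
        ⟨fun h a a' hb => (hinj a a').mp ((h a a').mpr hb),
          fun h a a' => (hinj a a').trans h.eq_iff.symm⟩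
      have hGP : G x = P x := by
        rw [hgap x hxR fun a a' => ?_, patternKernel]
        · simp only [hP, hpat]
        · by_cases haa : a = a'
          · left; rw [haa]
          · right; exact hsep a a' haa
      rw [hGP, sub_self]
    · refine (Measure.restrict_apply_le _ _).trans ((measure_mono (t := Metric.closedBall y (2 * δ))
        fun z hz => ?_).trans (le_of_eq ?_))
      · have hz' : ‖z - y‖ < δ := hz
        rw [Metric.mem_closedBall, dist_eq_norm]
        linarith
      · rw [Real.volume_pi_closedBall _ (by positivity), Fintype.card_fin]
        ring_nf

end Basic

/-! ## Normal-ordered monomials span the one-site operators -/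

section Span

variable {N : ℕ}

theorem unitSpin_minus_apply (hN : 0 < N) (i j : Fin (N + 1)) :
    unitSpin N .minus i j ≠ 0 ↔ (i : ℕ) = j + 1 := by
  have hN' : (0 : ℝ) < N := by exact_mod_cast hN
  rw [unitSpin, Matrix.smul_apply, smul_eq_mul, spinMatrix, Matrix.of_apply]
  constructor
  · intro h
    by_contra h1
    exact h (by rw [if_neg fun h2 => h1 h2.symm, mul_zero])
  · intro h
    rw [if_pos h.symm]
    have h1 : (i : ℝ) < N + 1 := by exact_mod_cast i.2
    have h2 : (0 : ℝ) < i := by exact_mod_cast (by omega : 0 < (i : ℕ))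
    have h3 : 0 < Real.sqrt ((i : ℝ) * ((N : ℝ) + 1 - i)) / Real.sqrt 2 :=
      div_pos (Real.sqrt_pos.mpr (mul_pos h2 (by linarith))) (by positivity)
    exact mul_ne_zero (by exact_mod_cast (by positivity : ((N : ℝ) / 2)⁻¹ ≠ 0))
      (by exact_mod_cast h3.ne')

theorem unitSpin_minus_pow_apply (hN : 0 < N) (c : ℕ) (i j : Fin (N + 1)) :
    (unitSpin N .minus ^ c) i j ≠ 0 ↔ (i : ℕ) = j + c := by
  induction c generalizing i j with
  | zero => simp [Matrix.one_apply, Fin.ext_iff]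
  | succ c ih =>
    rw [pow_succ, Matrix.mul_apply]
    by_cases hj : (j : ℕ) + 1 < N + 1
    · rw [Finset.sum_eq_single ⟨j + 1, hj⟩]
      · rw [mul_ne_zero_iff, ih, unitSpin_minus_apply hN]
        change (i : ℕ) = (j : ℕ) + 1 + c ∧ (j : ℕ) + 1 = (j : ℕ) + 1 ↔ (i : ℕ) = (j : ℕ) + (c + 1)
        omega
      · intro k _ hk
        by_contra h
        exact hk (Fin.ext ((unitSpin_minus_apply hN k j).mp (right_ne_zero_of_mul h)))
      · simp
    · rw [Finset.sum_eq_zero]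
      · have := i.2
        simp only [ne_eq, not_true_eq_false, false_iff]
        omega
      · intro k _
        by_contra h
        have := (unitSpin_minus_apply hN k j).mp (right_ne_zero_of_mul h)
        have := k.2
        omega

theorem unitSpin_plus_pow_apply (hN : 0 < N) (c : ℕ) (i j : Fin (N + 1)) :
    (unitSpin N .plus ^ c) i j ≠ 0 ↔ (j : ℕ) = i + c := by
  have h : unitSpin N .plus ^ c = (unitSpin N .minus ^ c)ᴴ := by
    rw [Matrix.conjTranspose_pow, unitSpin_conjTranspose]
    rfl
  rw [← unitSpin_minus_pow_apply hN c j i, h, Matrix.conjTranspose_apply, star_ne_zero]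

theorem unitSpin_z_pow (b : ℕ) : unitSpin N .z ^ b =
    Matrix.diagonal fun k : Fin (N + 1) =>
      (((((N : ℝ) / 2)⁻¹ : ℝ) : ℂ) * ((N : ℂ) / 2 - ((k : ℕ) : ℂ))) ^ b := by
  rw [unitSpin, spinMatrix, ← Matrix.diagonal_smul, Matrix.diagonal_pow]
  rfl

theorem normalMat_apply (n : Idx → ℕ) (i j : Fin (N + 1)) :
    normalMat N n i j = ∑ k, (unitSpin N .plus ^ n .plus) i k *
      (((((N : ℝ) / 2)⁻¹ : ℝ) : ℂ) * ((N : ℂ) / 2 - ((k : ℕ) : ℂ))) ^ n .z *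
        (unitSpin N .minus ^ n .minus) k j := by
  rw [normalMat, unitSpin_z_pow, Matrix.mul_apply]
  simp only [Matrix.mul_diagonal]

/-- The exponents of the monomial which moves the state `β` to the state `α` through the lowest
state. -/
def moveExp (N p α β : ℕ) : Idx → ℕ
  | .plus => N - α
  | .z => p - (N - α) - (N - β)
  | .minus => N - β

theorem sum_moveExp {p α β : ℕ} (hp : 2 * N ≤ p) : ∑ j, moveExp N p α β j = p := by
  rw [sum_Idx]
  simp only [moveExp]
  omega

theorem normalMat_moveExp_apply_of_lt (hN : 0 < N) (p : ℕ) (α i : Fin (N + 1))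
    {β j : Fin (N + 1)} (h : β < j) : normalMat N (moveExp N p α β) i j = 0 := by
  rw [normalMat_apply]
  refine Finset.sum_eq_zero fun k _ => ?_
  by_contra h1
  have h2 := (unitSpin_minus_pow_apply hN (moveExp N p α β .minus) k j).mp (right_ne_zero_of_mul h1)
  simp only [moveExp] at h2
  have := k.2
  have := β.2
  have : (β : ℕ) < j := h
  omega

theorem normalMat_moveExp_apply (hN : 0 < N) (p : ℕ) (α β i : Fin (N + 1)) :
    normalMat N (moveExp N p α β) i β ≠ 0 ↔ i = α := by
  have hβ := β.2
  have hα := α.2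
  have hN' : (N : ℂ) ≠ 0 := by exact_mod_cast hN.ne'
  rw [normalMat_apply, Finset.sum_eq_single (Fin.last N)]
  · rw [mul_ne_zero_iff, mul_ne_zero_iff, unitSpin_plus_pow_apply hN, unitSpin_minus_pow_apply hN]
    simp only [moveExp, Fin.val_last, Fin.ext_iff]
    have h1 : (((((N : ℝ) / 2)⁻¹ : ℝ) : ℂ) * ((N : ℂ) / 2 - (N : ℂ))) ≠ 0 := by
      push_cast
      have : (N : ℂ) / 2 - N = -(N / 2) := by ring
      rw [this]
      simp [hN.ne']
    have h2 := pow_ne_zero (p - (N - α) - (N - β)) h1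
    constructor
    · rintro ⟨⟨h3, -⟩, -⟩
      omega
    · intro h3
      exact ⟨⟨by omega, h2⟩, by omega⟩
  · intro k _ hk
    by_contra h1
    have h2 := (unitSpin_minus_pow_apply hN (moveExp N p α β .minus) k β).mp
      (right_ne_zero_of_mul h1)
    simp only [moveExp] at h2
    exact hk (Fin.ext (by rw [Fin.val_last]; omega))
  · simp

theorem single_mem_span_normalMat (hN : 0 < N) {p : ℕ} (hp : 2 * N ≤ p) (β : ℕ)
    (hβ : β < N + 1) (α : Fin (N + 1)) : (Matrix.single α ⟨β, hβ⟩ 1 : SiteMat N) ∈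
      Submodule.span ℂ {W | ∃ n : Idx → ℕ, ∑ j, n j = p ∧ W = normalMat N n} := by
  induction β using Nat.strong_induction_on generalizing α with
  | _ β ih =>
    set S := Submodule.span ℂ {W | ∃ n : Idx → ℕ, ∑ j, n j = p ∧ W = normalMat N n} with hS
    set B : Fin (N + 1) := ⟨β, hβ⟩ with hB
    set A := normalMat N (moveExp N p α B) with hA
    have hAS : A ∈ S := Submodule.subset_span ⟨_, sum_moveExp hp, rfl⟩
    have hdec : A - A α B • Matrix.single α B (1 : ℂ) =
        ∑ i, ∑ j ∈ Finset.univ.filter (fun j => j < B), A i j • Matrix.single i j (1 : ℂ) := by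
      ext i j
      have h1 : ∀ i', (∑ j' ∈ Finset.univ.filter (fun j => j < B),
          A i' j' • Matrix.single i' j' (1 : ℂ)) i j =
          if i' = i ∧ j < B then A i j else 0 := by
        intro i'
        rw [Matrix.sum_apply]
        simp only [Matrix.smul_apply, Matrix.single_apply, smul_eq_mul, mul_ite, mul_one, mul_zero]
        by_cases hi : i' = i
        · subst hi
          simp [Finset.sum_ite_eq']
        · simp [hi]
      rw [Matrix.sum_apply, Finset.sum_congr rfl fun i' _ => h1 i']
      simp only [ite_and, Finset.sum_ite_eq', Finset.mem_univ, if_true, Matrix.sub_apply,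
        Matrix.smul_apply, Matrix.single_apply, smul_eq_mul, mul_ite, mul_one, mul_zero]
      rcases lt_trichotomy j B with h | h | h
      · simp [h, h.ne']
      · subst h
        by_cases hi : α = i
        · simp [hi]
        · have : A i B = 0 := by
            by_contra h3
            exact hi ((normalMat_moveExp_apply hN p α B i).mp h3).symm
          simp [hi, this]
      · have : A i j = 0 := normalMat_moveExp_apply_of_lt hN p α i h
        simp [this, h.ne]
    have h2 : A α B • Matrix.single α B (1 : ℂ) ∈ S := by
      have h3 : A α B • Matrix.single α B (1 : ℂ) =
          A - (A - A α B • Matrix.single α B (1 : ℂ)) := by abel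
      rw [h3, hdec]
      refine S.sub_mem hAS (S.sum_mem fun i _ => S.sum_mem fun j hj => S.smul_mem _ ?_)
      exact ih j (by simpa [hB, Fin.lt_def] using hj) j.2 i
    exact (S.smul_mem_iff ((normalMat_moveExp_apply hN p α B α).mpr rfl)).mp h2

theorem mem_span_normalMat (hN : 0 < N) {p : ℕ} (hp : 2 * N ≤ p) (W : SiteMat N) :
    W ∈ Submodule.span ℂ {W | ∃ n : Idx → ℕ, ∑ j, n j = p ∧ W = normalMat N n} := by
  rw [Matrix.matrix_eq_sum_single W]
  refine Submodule.sum_mem _ fun i _ => Submodule.sum_mem _ fun j _ => ?_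
  have h := Submodule.smul_mem _ (W i j) (single_mem_span_normalMat hN hp j j.2 i)
  simpa [Matrix.smul_single] using h

end Span

/-! ## Approximation of one-site operators of high order -/

section Density

variable {N : ℕ}

/-- The functions of the lattice volume which are combinations of normal-ordered monomials of
order at least two. -/
def normalSpan (N : ℕ) : Submodule ℂ (ℝ → SiteMat N) :=
  Submodule.span ℂ {f | ∃ n : Idx → ℕ, 2 ≤ ∑ j, n j ∧
    f = fun u : ℝ => (u : ℂ) ^ (∑ j, n j) • normalMat N n}

theorem smul_mem_normalSpan (hN : 0 < N) {p : ℕ} (hp : 2 * N ≤ p) (W : SiteMat N) :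
    (fun u : ℝ => (u : ℂ) ^ p • W) ∈ normalSpan N := by
  induction mem_span_normalMat hN hp W using Submodule.span_induction with
  | mem W hW =>
    obtain ⟨n, hn, rfl⟩ := hW
    exact Submodule.subset_span ⟨n, by omega, by rw [hn]⟩
  | zero =>
    convert (normalSpan N).zero_mem using 1
    ext u : 1
    simp
  | add x y _ _ hx hy =>
    convert (normalSpan N).add_mem hx hy using 1
    ext u : 1
    simp
  | smul c x _ hx =>
    convert (normalSpan N).smul_mem c hx using 1
    ext u : 1
    exact smul_comm _ _ _

theorem mul_one_sub_pow_le {u : ℝ} (hu : 0 ≤ u) (hu1 : u ≤ 1) (k : ℕ) :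
    ((k : ℝ) + 1) * (u * (1 - u) ^ k) ≤ 1 := by
  have h1 : (1 - (1 - u)) * ∑ i ∈ Finset.range (k + 1), (1 - u) ^ i = 1 - (1 - u) ^ (k + 1) :=
    mul_neg_geom_sum _ _
  have h2 : ((k : ℝ) + 1) * (1 - u) ^ k ≤ ∑ i ∈ Finset.range (k + 1), (1 - u) ^ i := by
    have := Finset.card_nsmul_le_sum (Finset.range (k + 1)) (fun i => (1 - u) ^ i) ((1 - u) ^ k)
      fun i hi => pow_le_pow_of_le_one (by linarith) (by linarith)
        (Nat.lt_succ_iff.mp (Finset.mem_range.mp hi))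
    simpa [nsmul_eq_mul] using this
  have h3 : 0 ≤ (1 - u) ^ (k + 1) := pow_nonneg (by linarith) _
  rw [sub_sub_cancel] at h1
  nlinarith

theorem exists_normalSpan_approx (hN : 0 < N) {m : ℕ} (hm : 2 ≤ m) (W : SiteMat N) {ε : ℝ}
    (hε : 0 < ε) : ∃ f ∈ normalSpan N, ∀ u : ℝ, 0 ≤ u → u ≤ 1 →
      ‖(u : ℂ) ^ m • W - f u‖ ≤ ε * u := by
  obtain ⟨k, hk⟩ := exists_nat_ge (2 * N * ‖W‖ / ε)
  obtain ⟨R, hR⟩ : (Polynomial.X : Polynomial ℂ) ^ (m + 2 * N) ∣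
      Polynomial.X ^ m * (1 - (1 - Polynomial.X) ^ k) ^ (2 * N) := by
    rw [pow_add]
    refine mul_dvd_mul_left _ (pow_dvd_pow_of_dvd ?_ _)
    have := sub_dvd_pow_sub_pow (1 : Polynomial ℂ) (1 - Polynomial.X) k
    simpa using this
  refine ⟨fun u => ((Polynomial.X : Polynomial ℂ) ^ (m + 2 * N) * R).eval (u : ℂ) • W, ?_, ?_⟩
  · have h1 : (fun u : ℝ => ((Polynomial.X : Polynomial ℂ) ^ (m + 2 * N) * R).eval (u : ℂ) • W) =
        ∑ j ∈ Finset.range (R.natDegree + 1),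
          R.coeff j • fun u : ℝ => (u : ℂ) ^ (m + 2 * N + j) • W := by
      ext u : 1
      rw [Finset.sum_apply, Polynomial.eval_mul, Polynomial.eval_eq_sum_range (p := R),
        Finset.mul_sum, Finset.sum_smul]
      refine Finset.sum_congr rfl fun j _ => ?_
      rw [Pi.smul_apply, smul_smul, Polynomial.eval_pow, Polynomial.eval_X]
      congr 1
      ring
    rw [h1]
    exact Submodule.sum_mem _ fun j _ => Submodule.smul_mem _ _
      (smul_mem_normalSpan hN (by omega) W)
  · intro u hu hu1
    have h0 : 0 ≤ (1 - u) ^ k := pow_nonneg (by linarith) _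
    have h0' : (1 - u) ^ k ≤ 1 := pow_le_one₀ (by linarith) (by linarith)
    have h2 : (u : ℂ) ^ m • W - ((Polynomial.X : Polynomial ℂ) ^ (m + 2 * N) * R).eval (u : ℂ) • W =
        ((u ^ m * (1 - (1 - (1 - u) ^ k) ^ (2 * N)) : ℝ) : ℂ) • W := by
      rw [← hR, ← sub_smul]
      congr 1
      simp
      ring
    have h3 : 1 - (1 - (1 - u) ^ k) ^ (2 * N) ≤ 2 * N * (1 - u) ^ k := by
      have := one_add_mul_le_pow (a := -(1 - u) ^ k) (by linarith) (2 * N)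
      push_cast at this
      rw [← sub_eq_add_neg] at this
      linarith
    have h4 : 0 ≤ 1 - (1 - (1 - u) ^ k) ^ (2 * N) := by
      have := pow_le_one₀ (n := 2 * N) (by linarith : (0 : ℝ) ≤ 1 - (1 - u) ^ k) (by linarith)
      linarith
    have h5 : u ^ m ≤ u * u := by
      have := pow_le_pow_of_le_one hu hu1 hm
      rwa [pow_two] at this
    have h6 := mul_one_sub_pow_le hu hu1 k
    simp only
    rw [h2, norm_smul, Complex.norm_real, Real.norm_eq_abs, abs_of_nonneg (by positivity)]
    rw [div_le_iff₀ hε] at hk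
    have h7 : u ^ m * (1 - (1 - (1 - u) ^ k) ^ (2 * N)) ≤ u * u * (2 * N * (1 - u) ^ k) :=
      mul_le_mul h5 h3 h4 (by positivity)
    calc u ^ m * (1 - (1 - (1 - u) ^ k) ^ (2 * N)) * ‖W‖
        ≤ u * u * (2 * N * (1 - u) ^ k) * ‖W‖ := by gcongr
      _ = u * (u * (1 - u) ^ k * (2 * N * ‖W‖)) := by ring
      _ ≤ u * (u * (1 - u) ^ k * ((k + 1) * ε)) := by
          have : 2 * N * ‖W‖ ≤ (k + 1) * ε := by nlinarith
          gcongr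
      _ = u * ε * ((k + 1) * (u * (1 - u) ^ k)) := by ring
      _ ≤ u * ε * 1 := by gcongr
      _ = ε * u := by ring

end Density

/-! ## Sums over distinct sites -/

section Distinct

variable {d N : ℕ} {X : Finset (Fin d → ℤ)} {J : Type} [Fintype J] [DecidableEq J]

theorem extend_update {Y B : Type*} [DecidableEq Y] {e : J → Y} (he : Function.Injective e)
    (v : J → B) (j : J) (a : B) (g : Y → B) :
    Function.extend e (Function.update v j a) g =
      Function.update (Function.extend e v g) (e j) a := by
  ext1 k
  by_cases hk : ∃ j', e j' = k
  · obtain ⟨j', rfl⟩ := hk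
    rw [he.extend_apply]
    by_cases hj : j' = j
    · subst hj
      simp
    · rw [Function.update_of_ne hj, Function.update_of_ne (he.ne hj), he.extend_apply]
  · rw [Function.extend_apply' _ _ _ hk, Function.update_of_ne fun h => hk ⟨j, h.symm⟩,
      Function.extend_apply' _ _ _ hk]

theorem tensorOp_update (v : X → SiteMat N) (k : X) (a : SiteMat N) :
    tensorOp (Function.update v k a) = tensorOp (Function.update v k 1) * siteOp k a := by
  rw [siteOp_eq_tensorOp, ← tensorOp_mul]
  congr 1
  ext1 k'
  by_cases h : k' = k
  · subst h; simp
  · simp [h]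

theorem prod_extend {Y B : Type*} [Fintype Y] [CommMonoid B] {e : J → Y}
    (he : Function.Injective e) (v : J → B) :
    ∏ k, Function.extend e v 1 k = ∏ j, v j :=
  (Fintype.prod_of_injective e he v _ (fun k hk => Function.extend_apply' v (1 : Y → B) k hk)
    fun _ => (he.extend_apply _ _ _).symm).symm

theorem norm_tensorOp_extend_le {e : J → X} (he : Function.Injective e) (v : J → SiteMat N) :
    ‖tensorOp (Function.extend e v 1)‖ ≤ ∏ j, ‖v j‖ := by
  refine (norm_tensorOp_le _).trans (le_of_eq ?_)
  rw [← prod_extend he]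
  refine Finset.prod_congr rfl fun k _ => ?_
  by_cases hk : ∃ j, e j = k
  · obtain ⟨j, rfl⟩ := hk
    rw [he.extend_apply, he.extend_apply]
  · rw [Function.extend_apply' _ _ _ hk, Function.extend_apply' _ _ _ hk]
    exact CStarRing.norm_one

theorem tensorOp_smul (c : X → ℂ) (v : X → SiteMat N) :
    tensorOp (fun k => c k • v k) = (∏ k, c k) • tensorOp v := by
  ext σ τ
  simp [tensorOp, Finset.prod_mul_distrib]

/-- The sum over all families of distinct sites, labelled by `J`, of a kernel times one-site
operators which depend on the lattice volume. -/
def distinctSum (K : (J → Pt d) → ℂ) (w : J → ℝ → SiteMat N) (h : ℝ) (X : Finset (Fin d → ℤ)) :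
    Op N X :=
  open Classical in
  ∑ e : J → X, if Function.Injective e then
    K (fun j => sitePt h (e j)) • tensorOp (Function.extend e (fun j => w j (h ^ d)) 1) else 0

theorem tensorOp_extend_update {e : J → X} (he : Function.Injective e) (w : J → ℝ → SiteMat N)
    (j : J) (f : ℝ → SiteMat N) (u : ℝ) :
    tensorOp (Function.extend e (fun j' => Function.update w j f j' u) 1) =
      tensorOp (Function.update (Function.extend e (fun j' => w j' u) 1) (e j) 1) *
        siteOp (e j) (f u) := by
  have h : (fun j' => Function.update w j f j' u) =
      Function.update (fun j' => w j' u) j (f u) := by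
    ext1 j'
    by_cases hj : j' = j
    · subst hj; simp
    · simp [hj]
  rw [h, extend_update he, tensorOp_update]

/-- The sum over distinct sites as a linear function of one of the operators. -/
def distinctSlot (K : (J → Pt d) → ℂ) (w : J → ℝ → SiteMat N) (j : J) (h : ℝ)
    (X : Finset (Fin d → ℤ)) : (ℝ → SiteMat N) →ₗ[ℂ] Op N X where
  toFun f := distinctSum K (Function.update w j f) h X
  map_add' f g := by
    rw [distinctSum, distinctSum, distinctSum, ← Finset.sum_add_distrib]
    refine Finset.sum_congr rfl fun e _ => ?_
    split_ifs with he
    · rw [tensorOp_extend_update he, tensorOp_extend_update he, tensorOp_extend_update he,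
        Pi.add_apply, siteOp_add, mul_add, smul_add]
    · rw [add_zero]
  map_smul' c f := by
    rw [distinctSum, distinctSum, Finset.smul_sum]
    refine Finset.sum_congr rfl fun e _ => ?_
    split_ifs with he
    · rw [tensorOp_extend_update he, tensorOp_extend_update he, Pi.smul_apply, siteOp_smul,
        mul_smul_comm, smul_comm]
      rfl
    · rw [smul_zero]

theorem distinctSlot_apply (K : (J → Pt d) → ℂ) (w : J → ℝ → SiteMat N) (j : J) (h : ℝ)
    (f : ℝ → SiteMat N) : distinctSlot K w j h X f = distinctSum K (Function.update w j f) h X :=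
  rfl

theorem norm_distinctSum_le {K : (J → Pt d) → ℂ} {w : J → ℝ → SiteMat N} {h C : ℝ} (hC0 : 0 ≤ C)
    (hC : ∀ e : J → X, ‖K fun j => sitePt h (e j)‖ ≤ C) {c : J → ℝ} (hh : 0 ≤ h)
    (hc0 : ∀ j, 0 ≤ c j) (hc : ∀ j, ‖w j (h ^ d)‖ ≤ c j * h ^ d) :
    ‖distinctSum K w h X‖ ≤ C * (∏ j, c j) * (X.card * h ^ d) ^ Fintype.card J := by
  have h1 : 0 ≤ C * ∏ j, (c j * h ^ d) :=
    mul_nonneg hC0 (Finset.prod_nonneg fun j _ => mul_nonneg (hc0 j) (by positivity))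
  refine (norm_sum_le_of_le (f := _) Finset.univ (n := fun _ => C * ∏ j, (c j * h ^ d))
    fun e _ => ?_).trans (le_of_eq ?_)
  · split_ifs with he
    · rw [norm_smul]
      exact mul_le_mul (hC e) ((norm_tensorOp_extend_le he _).trans
        (Finset.prod_le_prod (fun _ _ => norm_nonneg _) fun j _ => hc j)) (norm_nonneg _) hC0
    · rwa [norm_zero]
  · rw [Finset.sum_const, Finset.card_univ, Fintype.card_fun, Fintype.card_coe, nsmul_eq_mul,
      Finset.prod_mul_distrib, Finset.prod_const, Finset.card_univ, mul_pow]
    push_cast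
    ring

theorem sum_hasPattern {ι Y A : Type*} [Fintype ι] [DecidableEq ι] [Fintype Y] [AddCommMonoid A]
    {b : ι → J} (hb : Function.Surjective b) (F : (ι → Y) → A)
    [∀ x : ι → Y, Decidable (HasPattern b x)] [∀ e : J → Y, Decidable (Function.Injective e)] :
    ∑ x : ι → Y, (if HasPattern b x then F x else 0) =
      ∑ e : J → Y, if Function.Injective e then F (e ∘ b) else 0 := by
  rw [← Finset.sum_filter, ← Finset.sum_filter]
  symm
  refine Finset.sum_nbij (fun e => e ∘ b) (fun e he => ?_) (fun e _ e' _ h => ?_)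
    (fun x hx => ?_) fun _ _ => rfl
  · rw [Finset.mem_filter] at he ⊢
    exact ⟨Finset.mem_univ _, fun a a' => he.2.eq_iff⟩
  · exact hb.injective_comp_right h
  · have hx' : HasPattern b x := by simpa using hx
    refine ⟨x ∘ Function.surjInv hb, ?_, ?_⟩
    · simp only [Finset.coe_filter, Finset.mem_univ, true_and]
      intro j j' hj
      have := (hx' _ _).mp hj
      rwa [Function.surjInv_eq hb, Function.surjInv_eq hb] at this
    · ext1 a
      exact (hx' _ _).mpr (Function.surjInv_eq hb _)

/-- The one-site operator to which the factors with points in a block contribute. -/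
def blockFn {ι : Type} [Fintype ι] (N : ℕ) (L : List ι) (l : ι → Idx) (b : ι → J) (j : J) (u : ℝ) :
    SiteMat N :=
  (u : ℂ) ^ (Finset.univ.filter fun c => b c = j).card •
    ((L.filter fun c => b c = j).map fun c => unitSpin N (l c)).prod

theorem sum_hasPattern_word {ι : Type} [Fintype ι] [DecidableEq ι] (L : List ι) (l : ι → Idx)
    {b : ι → J} (hb : Function.Surjective b) (k : (ι → Pt d) → ℂ) (h : ℝ)
    [∀ x : ι → X, Decidable (HasPattern b x)] :
    ((h ^ d : ℝ) : ℂ) ^ Fintype.card ι • ∑ x : ι → X, (if HasPattern b x then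
      (k fun c => sitePt h (x c)) • word L (fun c => quantumSpin N X (l c) (x c)) else 0) =
    distinctSum (fun y => k (y ∘ b)) (blockFn N L l b) h X := by
  classical
  rw [sum_hasPattern hb (F := fun x : ι → X => (k fun c => sitePt h (x c)) •
    word L (fun c => quantumSpin N X (l c) (x c))), distinctSum, Finset.smul_sum]
  refine Finset.sum_congr rfl fun e _ => ?_
  split_ifs with he
  · have h1 : Function.extend e (fun j => blockFn N L l b j (h ^ d)) 1 =
        fun k => (Function.extend e (fun j => (((h ^ d : ℝ) : ℂ) ^
          (Finset.univ.filter fun c => b c = j).card)) 1 k) •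
          ((L.filter fun c => e (b c) = k).map fun c => unitSpin N (l c)).prod := by
      ext1 k
      by_cases hk : ∃ j, e j = k
      · obtain ⟨j, rfl⟩ := hk
        rw [he.extend_apply, he.extend_apply, blockFn]
        simp only [he.eq_iff]
      · rw [Function.extend_apply' _ _ _ hk, Function.extend_apply' _ _ _ hk,
          List.filter_eq_nil_iff.mpr fun c _ => by simpa using fun h => hk ⟨_, h⟩]
        simp
    rw [h1, tensorOp_smul, prod_extend he, Finset.prod_pow_eq_pow_sum,
      ← Finset.card_eq_sum_card_fiberwise (s := Finset.univ) fun c _ => Finset.mem_univ (b c),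
      Finset.card_univ, smul_comm]
    congr 2
    exact list_prod_siteOp L (fun c => e (b c)) fun c => unitSpin N (l c)
  · rw [smul_zero]

end Distinct

/-! ## Approximation of sums over distinct sites -/

section Approx

variable {d N : ℕ} {J : Type} [Fintype J] [DecidableEq J]

theorem isApprox_distinctSum_blockFn (hd : 0 < d) (hN : 0 < N) {h₀ : ℝ} (h₀1 : h₀ ≤ 1)
    (D : Region d) {p : ℕ} {b : Fin p → J} (hb : Function.Surjective b) (i : Fin p → Idx)
    {K : (J → Pt d) → ℂ} (hK : Continuous K) [Decidable (Function.Injective b)] :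
    IsApprox N h₀ D (fun h => distinctSum K (blockFn N (normalList i) i b) h (sites h D.carrier))
      (fun M => if Function.Injective b then
        ∫ x, K (x ∘ Function.surjInv hb) * ∏ a, ladder ((M : SpinField D.carrier) (x a)) (i a)
          ∂(Measure.pi fun _ : Fin p => D.vol) else 0) := by
  classical
  refine (isApprox_patternKernel hd hN h₀1 D b (Function.surjInv hb) i hK).congr
    (fun h hh _ => ?_) fun _ => rfl
  have h1 := sum_hasPattern_word (N := N) (X := sites h D.carrier) (normalList i) i hb
    (fun x => K (x ∘ Function.surjInv hb)) h
  have h2 : (fun y : J → Pt d => K ((y ∘ b) ∘ Function.surjInv hb)) = K := by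
    ext1 y
    rw [Function.comp_assoc, (Function.rightInverse_surjInv hb).comp_eq_id, Function.comp_id]
  rw [h2, Fintype.card_fin] at h1
  rw [← h1]
  congr 1
  refine Finset.sum_congr rfl fun x _ => ?_
  have h3 : HasPattern b (fun a => sitePt h (x a)) ↔ HasPattern b x := by
    simp only [HasPattern, (sitePt_injective hh).eq_iff]
  rw [patternKernel, word_normalList_quantumSpin]
  simp only [h3]
  split_ifs
  · rfl
  · rw [zero_smul]

/-- A normal-ordered one-site monomial as a function of the lattice volume. -/
def normalBlock (N : ℕ) (n : Idx → ℕ) (u : ℝ) : SiteMat N :=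
  (u : ℂ) ^ (∑ l, n l) • normalMat N n

theorem exists_labelling (n : J → Idx → ℕ) : ∃ (p : ℕ) (b : Fin p → J) (i : Fin p → Idx),
    (∀ j, siteCount i b j = n j) ∧ ∀ j, (Finset.univ.filter fun a => b a = j).card = ∑ l, n j l := by
  classical
  let e := (Fintype.equivFin (Σ j, Σ l, Fin (n j l))).symm
  have h1 : ∀ j l, siteCount (fun a => (e a).2.1) (fun a => (e a).1) j l = n j l := by
    intro j l
    have h2 : (Finset.univ.filter fun t : Σ j, Σ l, Fin (n j l) => t.2.1 = l ∧ t.1 = j) =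
        Finset.univ.image fun m : Fin (n j l) => (⟨j, l, m⟩ : Σ j, Σ l, Fin (n j l)) := by
      ext ⟨j', l', m⟩
      simp only [Finset.mem_filter, Finset.mem_univ, true_and, Finset.mem_image]
      constructor
      · rintro ⟨rfl, rfl⟩
        exact ⟨m, rfl⟩
      · rintro ⟨m', h⟩
        cases h
        exact ⟨rfl, rfl⟩
    rw [siteCount, Finset.card_equiv (t := Finset.univ.filter fun t : Σ j, Σ l, Fin (n j l) =>
      t.2.1 = l ∧ t.1 = j) e fun a => by simp, h2, Finset.card_image_of_injective,
      Finset.card_univ, Fintype.card_fin]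
    intro m m' h
    simpa using h
  refine ⟨_, fun a => (e a).1, fun a => (e a).2.1, fun j => funext (h1 j), fun j => ?_⟩
  rw [Finset.card_eq_sum_card_fiberwise (t := Finset.univ) (f := fun a => (e a).2.1)
    fun _ _ => Finset.mem_univ _]
  refine Finset.sum_congr rfl fun l _ => ?_
  rw [← h1 j l, siteCount, Finset.filter_filter]
  simp only [and_comm]

theorem isApprox_distinctSum_normalBlock (hd : 0 < d) (hN : 0 < N) {h₀ : ℝ} (h₀1 : h₀ ≤ 1)
    (D : Region d) {K : (J → Pt d) → ℂ} (hK : Continuous K) {n : J → Idx → ℕ}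
    (hn : ∀ j, 1 ≤ ∑ l, n j l) (hn2 : ∃ j, 2 ≤ ∑ l, n j l) :
    IsApprox N h₀ D (fun h => distinctSum K (fun j => normalBlock N (n j)) h (sites h D.carrier))
      (fun _ => 0) := by
  classical
  obtain ⟨p, b, i, hi, hcard⟩ := exists_labelling n
  have hb : Function.Surjective b := by
    intro j
    have := hn j
    rw [← hcard j, Nat.succ_le_iff, Finset.card_pos] at this
    obtain ⟨a, ha⟩ := this
    exact ⟨a, by simpa using ha⟩
  have hinj : ¬ Function.Injective b := by
    intro hinj
    obtain ⟨j, hj⟩ := hn2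
    rw [← hcard j] at hj
    have : (Finset.univ.filter fun a => b a = j).card ≤ 1 :=
      Finset.card_le_one.mpr fun a ha a' ha' => hinj (by simp at ha ha'; rw [ha, ha'])
    omega
  have h1 := isApprox_distinctSum_blockFn hd hN h₀1 D hb i hK
  simp only [if_neg hinj] at h1
  refine h1.congr (fun h _ _ => ?_) fun _ => rfl
  congr 1
  ext1 j
  ext1 u
  rw [blockFn, word_normalList_unitSpin, hi, hcard, normalBlock]

theorem norm_normalBlock_le {n : Idx → ℕ} (hn : 1 ≤ ∑ l, n l) {u : ℝ} (hu : 0 ≤ u) (hu1 : u ≤ 1) :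
    ‖normalBlock N n u‖ ≤ ‖normalMat N n‖ * u := by
  rw [normalBlock, norm_smul, norm_pow, Complex.norm_real, Real.norm_eq_abs, abs_of_nonneg hu,
    mul_comm]
  refine mul_le_mul_of_nonneg_left ?_ (norm_nonneg _)
  simpa using pow_le_pow_of_le_one hu hu1 hn

theorem Region.card_sites_mul_le (D : Region d) {h : ℝ} (hh : 0 < h) (h1 : h ≤ 1) :
    (sites h D.carrier).card * h ^ d ≤ D.bound.toReal := by
  have h2 := D.lattice_univ_le hh h1
  classical
  rw [latticeMeasure_apply] at h2
  have h3 := ENNReal.toReal_mono D.bound_lt_top.ne h2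
  rw [ENNReal.toReal_mul, ENNReal.toReal_ofReal (by positivity), mul_comm] at h3
  simpa using h3

/-- Sums over distinct sites in which some one-site operator is of second order in the lattice
volume are approximated by observables that vanish in the classical limit. For a single site,
the normal-ordered monomials of each order `p ≥ 2 * N` span all operators, so that powers of the
lattice volume times an arbitrary operator can be approximated by combinations of them; the
coincidence of the points is then imposed by a kernel concentrated near the diagonal. -/
theorem isApprox_distinctSum (hd : 0 < d) (hN : 0 < N) {h₀ : ℝ} (h₀1 : h₀ ≤ 1)
    (D : Region d) {K : (J → Pt d) → ℂ} (hK : Continuous K) (s : Finset J)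
    {w : J → ℝ → SiteMat N} {n : J → Idx → ℕ}
    (hw : ∀ j ∉ s, w j = normalBlock N (n j) ∧ 1 ≤ ∑ l, n j l)
    (hw' : ∀ j ∈ s, ∃ m W, 2 ≤ m ∧ w j = fun u : ℝ => (u : ℂ) ^ m • W)
    (hmult : s.Nonempty ∨ ∃ j ∉ s, 2 ≤ ∑ l, n j l) :
    IsApprox N h₀ D (fun h => distinctSum K w h (sites h D.carrier)) (fun _ => 0) := by
  induction s using Finset.induction_on generalizing w n with
  | empty =>
    obtain ⟨j, -, hj⟩ := hmult.resolve_left (by simp)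
    have h1 : w = fun j => normalBlock N (n j) := funext fun j => (hw j (by simp)).1
    rw [h1]
    exact isApprox_distinctSum_normalBlock hd hN h₀1 D hK (fun j => (hw j (by simp)).2) ⟨j, hj⟩
  | insert j s hj ih =>
    obtain ⟨m, W, hm, hmW⟩ := hw' j (Finset.mem_insert_self j s)
    have hspan : ∀ f ∈ normalSpan N, IsApprox N h₀ D
        (fun h => distinctSlot K w j h (sites h D.carrier) f) (fun _ => 0) := by
      intro f hf
      induction hf using Submodule.span_induction with
      | mem f hf =>
        obtain ⟨n', hn', hf⟩ := hf
        refine ih (n := Function.update n j n') (fun j' hj' => ?_) (fun j' hj' => ?_)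
          (Or.inr ⟨j, hj, by rwa [Function.update_self]⟩)
        · by_cases hjj : j' = j
          · subst hjj
            rw [Function.update_self, Function.update_self]
            exact ⟨hf, by omega⟩
          · rw [Function.update_of_ne hjj, Function.update_of_ne hjj]
            exact hw j' (by simp [hjj, hj'])
        · have hjj : j' ≠ j := fun h => hj (h ▸ hj')
          rw [Function.update_of_ne hjj]
          exact hw' j' (Finset.mem_insert_of_mem hj')
      | zero => exact IsApprox.zero.congr (fun h _ _ => map_zero _) fun _ => rfl
      | add f g _ _ hf hg =>
        exact (hf.add hg).congr (fun h _ _ => map_add _ _ _) fun _ => (add_zero _).symm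
      | smul c f _ hf =>
        exact (hf.smul c).congr (fun h _ _ => map_smul _ _ _) fun _ => (mul_zero _).symm
    have hbound : ∀ j', ∃ c, 0 ≤ c ∧ ∀ u : ℝ, 0 ≤ u → u ≤ 1 → ‖w j' u‖ ≤ c * u := by
      intro j'
      by_cases hj' : j' ∈ insert j s
      · obtain ⟨m', W', hm', hW'⟩ := hw' j' hj'
        refine ⟨‖W'‖, norm_nonneg _, fun u hu hu1 => ?_⟩
        rw [hW', norm_smul, norm_pow, Complex.norm_real, Real.norm_eq_abs, abs_of_nonneg hu,
          mul_comm]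
        refine mul_le_mul_of_nonneg_left ?_ (norm_nonneg _)
        simpa using pow_le_pow_of_le_one hu hu1 (by omega : 1 ≤ m')
      · obtain ⟨h1, h2⟩ := hw j' hj'
        exact ⟨‖normalMat N (n j')‖, norm_nonneg _, fun u hu hu1 => by
          rw [h1]; exact norm_normalBlock_le h2 hu hu1⟩
    choose c hc0 hc using hbound
    obtain ⟨C, hC0, hC⟩ := exists_kernel_bound hK D.radius
    refine IsApprox.of_close fun ε hε => ?_
    set P := ∏ j' ∈ Finset.univ.erase j, c j' with hP
    have hP0 : 0 ≤ P := Finset.prod_nonneg fun j' _ => hc0 j'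
    set Q := C * P * D.bound.toReal ^ Fintype.card J with hQ
    have hQ0 : 0 ≤ Q := by positivity
    obtain ⟨f, hf, hfW⟩ := exists_normalSpan_approx hN hm W (ε := ε / (Q + 1)) (by positivity)
    refine ⟨_, _, hspan f hf, fun h hh hh0 => ?_, fun M => by simpa using hε.le⟩
    have hh1 : h ≤ 1 := hh0.le.trans h₀1
    have hu0 : 0 ≤ h ^ d := by positivity
    have hu1 : h ^ d ≤ 1 := pow_le_one₀ hh.le hh1
    have h1 : distinctSum K w h (sites h D.carrier) =
        distinctSlot K w j h (sites h D.carrier) (w j) := by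
      rw [distinctSlot_apply, Function.update_eq_self]
    rw [h1, ← map_sub, distinctSlot_apply]
    refine (norm_distinctSum_le (c := Function.update c j (ε / (Q + 1))) hC0
      (fun e => hC _ fun j' => D.norm_sitePt_le hh _) hh.le (fun j' => ?_) fun j' => ?_).trans ?_
    · by_cases hjj : j' = j
      · subst hjj; rw [Function.update_self]; positivity
      · rw [Function.update_of_ne hjj]; exact hc0 j'
    · by_cases hjj : j' = j
      · subst hjj
        rw [Function.update_self, Function.update_self, Pi.sub_apply, hmW]
        exact hfW _ hu0 hu1
      · rw [Function.update_of_ne hjj, Function.update_of_ne hjj]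
        exact hc j' _ hu0 hu1
    · rw [Finset.prod_update_of_mem (Finset.mem_univ j), ← Finset.erase_eq, ← hP]
      have h2 := pow_le_pow_left₀ (by positivity) (D.card_sites_mul_le hh hh1) (Fintype.card J)
      calc C * (ε / (Q + 1) * P) * ((sites h D.carrier).card * h ^ d) ^ Fintype.card J
          ≤ C * (ε / (Q + 1) * P) * D.bound.toReal ^ Fintype.card J := by gcongr
        _ = ε * (Q / (Q + 1)) := by rw [hQ]; ring
        _ ≤ ε * 1 := by
          gcongr
          rw [div_le_one (by positivity)]
          linarith
        _ = ε := mul_one ε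

end Approx

/-! ## Approximation of ordered products -/

section Term

variable {d N : ℕ} {ι : Type} [Fintype ι] [DecidableEq ι]

instance : Finite (Setoid ι) :=
  Finite.of_injective (fun (r : Setoid ι) a b => r a b) fun _ _ h =>
    Setoid.ext fun a b => iff_of_eq (congrFun (congrFun h a) b)

theorem normalMat_single (i : Idx) : normalMat N (Pi.single i 1) = unitSpin N i := by
  cases i <;> simp [normalMat]

theorem blockFn_eq_normalBlock {J : Type} [Fintype J] [DecidableEq J] {L : List ι} (hL : L.Nodup)
    (l : ι → Idx) {b : ι → J} {j : J} {c₀ : ι} (hc₀ : c₀ ∈ L) (hb : ∀ c, b c = j ↔ c = c₀) :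
    blockFn N L l b j = normalBlock N (Pi.single (l c₀) 1) := by
  have h1 : (L.filter fun c => b c = j) = [c₀] := by
    refine List.perm_singleton.mp ((List.perm_ext_iff_of_nodup (hL.filter _)
      (List.nodup_singleton _)).mpr fun c => ?_)
    rw [List.mem_filter, decide_eq_true_eq, hb, List.mem_singleton]
    exact ⟨fun h => h.2, fun h => ⟨h ▸ hc₀, h⟩⟩
  have h2 : (Finset.univ.filter fun c => b c = j) = {c₀} := by
    ext c
    simp [hb]
  ext1 u
  rw [blockFn, h1, h2, normalBlock, normalMat_single]
  simp

theorem integral_comp_equiv {Y B : Type*} [MeasurableSpace Y] [NormedAddCommGroup B]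
    [NormedSpace ℝ B] {ι' : Type*} [Fintype ι'] (ν : Measure Y) [SigmaFinite ν] (e : ι' ≃ ι)
    (F : (ι → Y) → B) :
    ∫ x, F (x ∘ e.symm) ∂(Measure.pi fun _ : ι' => ν) = ∫ x, F x ∂(Measure.pi fun _ : ι => ν) := by
  have h1 : ⇑(MeasurableEquiv.piCongrLeft (fun _ : ι => Y) e) = fun x => x ∘ e.symm := by
    ext x a
    have h := Equiv.piCongrLeft_apply_apply (fun _ : ι => Y) e x (e.symm a)
    rw [Equiv.apply_symm_apply] at h
    exact h
  have h2 := (measurePreserving_piCongrLeft (fun _ : ι => ν) e).integral_comp' F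
  rw [h1] at h2
  exact h2

theorem isApprox_distinctSum_id (hd : 0 < d) (hN : 0 < N) {h₀ : ℝ} (h₀1 : h₀ ≤ 1)
    (D : Region d) {L : List ι} (hL : L.Nodup) (hc : ∀ c, c ∈ L) (l : ι → Idx)
    {K : (ι → Pt d) → ℂ} (hK : Continuous K) :
    IsApprox N h₀ D (fun h => distinctSum K (blockFn N L l id) h (sites h D.carrier))
      (fun M => ∫ x, K x * ∏ c, ladder ((M : SpinField D.carrier) (x c)) (l c)
        ∂(Measure.pi fun _ : ι => D.vol)) := by
  classical
  let e : Fin (Fintype.card ι) ≃ ι := (Fintype.equivFin ι).symm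
  have h1 := isApprox_distinctSum_blockFn hd hN h₀1 D e.surjective (l ∘ e) hK
  simp only [if_pos e.injective] at h1
  refine h1.congr (fun h _ _ => ?_) fun M => ?_
  · congr 1
    ext1 j
    rw [blockFn_eq_normalBlock (b := id) hL l (hc j) fun c => Iff.rfl,
      blockFn_eq_normalBlock (nodup_normalList _) (l ∘ e) (mem_normalList _ (e.symm j))
        fun c => (e.eq_symm_apply).symm]
    simp
  · have h2 : Function.surjInv e.surjective = e.symm := by
      ext1 j
      rw [Equiv.eq_symm_apply]
      exact Function.surjInv_eq _ _
    rw [h2, ← integral_comp_equiv D.vol e]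
    congr 1
    ext1 x
    congr 1
    rw [← Equiv.prod_comp e]
    simp

theorem isApprox_word (hd : 0 < d) (hN : 0 < N) {h₀ : ℝ} (h₀1 : h₀ ≤ 1)
    (D : Region d) {L : List ι} (hL : L.Nodup) (hc : ∀ c, c ∈ L) (l : ι → Idx)
    {K : (ι → Pt d) → ℂ} (hK : Continuous K) :
    IsApprox N h₀ D (fun h => ((h ^ d : ℝ) : ℂ) ^ Fintype.card ι • ∑ x : ι → sites h D.carrier,
        (K fun c => sitePt h (x c)) • word L (fun c => quantumSpin N _ (l c) (x c)))
      (fun M => ∫ x, K x * ∏ c, ladder ((M : SpinField D.carrier) (x c)) (l c)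
        ∂(Measure.pi fun _ : ι => D.vol)) := by
  classical
  let _ : Fintype (Setoid ι) := Fintype.ofFinite _
  have hpat : ∀ {Y : Type} (r : Setoid ι) (x : ι → Y),
      HasPattern (Quotient.mk r) x ↔ r = Setoid.ker x := by
    intro Y r x
    rw [Setoid.ext_iff]
    simp only [HasPattern, Quotient.eq, Setoid.ker_def]
    exact ⟨fun h a a' => (h a a').symm, fun h a a' => (h a a').symm⟩
  have hterm : ∀ r : Setoid ι, IsApprox N h₀ D (fun h => ((h ^ d : ℝ) : ℂ) ^ Fintype.card ι •
      ∑ x : ι → sites h D.carrier, if HasPattern (Quotient.mk r) x then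
        (K fun c => sitePt h (x c)) • word L (fun c => quantumSpin N _ (l c) (x c)) else 0)
      (fun M => if r = ⊥ then ∫ x, K x * ∏ c, ladder ((M : SpinField D.carrier) (x c)) (l c)
        ∂(Measure.pi fun _ : ι => D.vol) else 0) := by
    intro r
    by_cases hr : r = ⊥
    · subst hr
      refine (isApprox_distinctSum_id hd hN h₀1 D hL hc l hK).congr (fun h _ _ => ?_)
        fun M => if_pos rfl
      refine Eq.trans ?_ (sum_hasPattern_word L l Function.surjective_id K h)
      congr 1
      refine Finset.sum_congr rfl fun x _ => ?_
      have h1 : HasPattern (Quotient.mk (⊥ : Setoid ι)) x ↔ HasPattern id x := by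
        simp only [HasPattern, Quotient.eq]
        rfl
      simp only [h1]
    · simp only [if_neg hr]
      refine IsApprox.congr (q := fun h => distinctSum (fun y => K (y ∘ Quotient.mk r))
        (blockFn N L l (Quotient.mk r)) h (sites h D.carrier)) ?_
        (fun h _ _ => sum_hasPattern_word L l Quotient.mk_surjective K h) fun _ => rfl
      refine isApprox_distinctSum hd hN h₀1 D (hK.comp (continuous_pi fun j => continuous_apply _))
        (Finset.univ.filter fun j => 2 ≤ (Finset.univ.filter fun c => Quotient.mk r c = j).card)
        (n := fun j => Pi.single (l j.out) 1) (fun j hj => ⟨?_, ?_⟩) (fun j hj => ?_) (Or.inl ?_)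
      · refine blockFn_eq_normalBlock hL l (hc _) fun c => ⟨fun h => ?_, fun h => ?_⟩
        · simp only [Finset.mem_filter, Finset.mem_univ, true_and, not_le, Nat.lt_succ_iff] at hj
          exact Finset.card_le_one.mp hj c (by simpa using h) _ (by simp)
        · rw [h]; exact j.out_eq
      · rw [Finset.sum_pi_single']
        simp
      · exact ⟨_, _, by simpa using hj, rfl⟩
      · by_contra h1
        rw [Finset.not_nonempty_iff_eq_empty, Finset.filter_eq_empty_iff] at h1
        refine hr (eq_bot_iff.mpr fun a a' haa => ?_)
        have h2 := h1 (Finset.mem_univ (Quotient.mk r a))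
        rw [not_le, Nat.lt_succ_iff] at h2
        exact Finset.card_le_one.mp h2 a (by simp) a' (by simpa using Quotient.sound (Setoid.symm' r haa))
  refine (IsApprox.sum Finset.univ fun r _ => hterm r).congr (fun h _ _ => ?_) fun M => by simp
  rw [← Finset.smul_sum, Finset.sum_comm]
  congr 1
  refine Finset.sum_congr rfl fun x _ => ?_
  simp only [hpat]
  simp

theorem isApprox_term (hd : 0 < d) (hN : 0 < N) {h₀ : ℝ} (h₀1 : h₀ ≤ 1) (D : Region d)
    (T : Term d) :
    IsApprox N h₀ D (fun h => T.eval (latticeMeasure h (sites h D.carrier)) (sitePt h)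
        (quantumSpin N (sites h D.carrier)))
      (fun M => T.eval D.vol id (retractLadder (M : SpinField D.carrier))) := by
  refine (IsApprox.sum Finset.univ fun k _ => isApprox_word hd hN h₀1 D (T.nodup k) (T.complete k)
    (T.label k) (T.cont k)).congr (fun h hh _ => ?_) fun M => ?_
  · rw [Term.eval]
    exact Finset.sum_congr rfl fun k _ => integral_lattice hh _
  · rw [Term.eval]
    refine Finset.sum_congr rfl fun k _ => integral_congr_ae ?_
    have h1 : ∀ᵐ y ∂(Measure.pi fun _ : T.ι => D.vol), ∀ c i,
        ladder ((M : SpinField D.carrier) (y c)) i = retractLadder (M : SpinField D.carrier) i (y c) :=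
      ae_all_iff.mpr fun c => ae_pi_eval (ae_eq_retractLadder M.2) c
    filter_upwards [h1] with y hy
    rw [word_eq_prod (T.nodup k) (T.complete k), smul_eq_mul]
    simp only [hy, id]

end Term

/-! ## Observables as families of terms -/

section Family

variable {d N : ℕ}

/-- A smearing function as a term. -/
def Smearing.toTerm {p : ℕ} (f : Smearing d p) : Term d where
  ι := Fin p
  κ := Fin p → Idx
  fι := inferInstance
  dι := inferInstance
  fκ := inferInstance
  order := normalList
  nodup := nodup_normalList
  complete := mem_normalList
  label := id
  kernel := f.toFun
  cont := f.continuous_toFun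

theorem Smearing.eval_toTerm_quantum {p : ℕ} (f : Smearing d p) {h : ℝ} (hh : 0 < h)
    (Λ : Set (Pt d)) :
    f.toTerm.eval (latticeMeasure h (sites h Λ)) (sitePt h) (quantumSpin N (sites h Λ)) =
      quantumMonomial N h Λ f := (quantumMonomial_eq_integral hh Λ f).symm

theorem Smearing.eval_toTerm_classical {p : ℕ} (f : Smearing d p) (D : Region d)
    (M : Phase D.carrier) :
    f.toTerm.eval D.vol id (retractLadder (M : SpinField D.carrier)) =
      classicalMonomial D.carrier f M := by
  have h0 : f.toTerm.eval D.vol id (retractLadder (M : SpinField D.carrier)) =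
      ∑ l : Fin p → Idx, ∫ x : Fin p → Pt d, f.toFun l x • word (normalList l)
        (fun c => retractLadder (M : SpinField D.carrier) (l c) (x c))
          ∂(Measure.pi fun _ : Fin p => D.vol) := rfl
  rw [h0]
  refine Finset.sum_congr rfl fun k _ => integral_congr_ae ?_
  have h1 : ∀ᵐ y ∂(Measure.pi fun _ : Fin p => D.vol), ∀ c i,
      ladder ((M : SpinField D.carrier) (y c)) i = retractLadder (M : SpinField D.carrier) i (y c) :=
    ae_all_iff.mpr fun c => ae_pi_eval (ae_eq_retractLadder M.2) c
  filter_upwards [h1] with y hy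
  rw [word_eq_prod (nodup_normalList k) (mem_normalList k), smul_eq_mul]
  simp only [hy]

theorem Term.exists_mass_bound (T : Term d) (D : Region d) : ∃ b : ℝ≥0∞, b < ⊤ ∧
    ∀ {Y : Type} [MeasurableSpace Y] (ν : Measure Y) [IsFiniteMeasure ν] (pos : Y → Pt d),
      ν Set.univ ≤ D.bound → (∀ᵐ y ∂ν, ‖pos y‖ ≤ D.radius) → T.mass ν pos ≤ b := by
  choose C hC0 hC using fun k => exists_kernel_bound (T.cont k) D.radius
  refine ⟨∑ k, ENNReal.ofReal (C k) * D.bound ^ Fintype.card T.ι, ENNReal.sum_lt_top.mpr fun k _ =>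
    ENNReal.mul_lt_top ENNReal.ofReal_lt_top (ENNReal.pow_lt_top D.bound_lt_top), ?_⟩
  intro Y _ ν _ pos hν hpos
  refine Finset.sum_le_sum fun k _ => ?_
  have h1 : ∀ᵐ x ∂(Measure.pi fun _ : T.ι => ν), ∀ c, ‖pos (x c)‖ ≤ D.radius :=
    ae_all_iff.mpr fun c => ae_pi_eval hpos c
  calc ∫⁻ x, ‖T.kernel k fun c => pos (x c)‖ₑ ∂(Measure.pi fun _ : T.ι => ν)
      ≤ ∫⁻ _, ENNReal.ofReal (C k) ∂(Measure.pi fun _ : T.ι => ν) := by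
        refine lintegral_mono_ae (h1.mono fun x hx => ?_)
        rw [← ofReal_norm]
        exact ENNReal.ofReal_le_ofReal (hC k _ hx)
    _ = ENNReal.ofReal (C k) * (Measure.pi fun _ : T.ι => ν) Set.univ := lintegral_const _
    _ ≤ _ := by
      rw [Measure.pi_univ, Finset.prod_const, Finset.card_univ]
      exact mul_le_mul_right (pow_le_pow_left' hν _) _

/-- An observable as a family of terms, with the mass bounds for a region. -/
def Observable.family (A : Observable d) (D : Region d) : Family d where
  Ω := Fin (A.deg + 1)
  term p := (A.comp p).toTerm
  bd p := ((A.comp p).toTerm.exists_mass_bound D).choose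

instance (A : Observable d) (D : Region d) : Fintype (A.family D).Ω :=
  inferInstanceAs (Fintype (Fin (A.deg + 1)))

theorem Observable.weight_family_lt_top (A : Observable d) (D : Region d) (r : ℝ) :
    (A.family D).weight r < ⊤ := by
  have h1 : (A.family D).weight r = ∑ p : Fin (A.deg + 1), ENNReal.ofReal
      (Real.exp (r * ((A.comp p).toTerm).deg)) *
        ((A.comp p).toTerm.exists_mass_bound D).choose := tsum_fintype _
  rw [h1]
  exact ENNReal.sum_lt_top.mpr fun p _ => ENNReal.mul_lt_top ENNReal.ofReal_lt_top
    ((A.comp p).toTerm.exists_mass_bound D).choose_spec.1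

theorem Observable.isBoundedOn_lattice (A : Observable d) (D : Region d) {h : ℝ} (hh : 0 < h)
    (h1 : h ≤ 1) :
    (A.family D).IsBoundedOn (latticeMeasure h (sites h D.carrier)) (sitePt h) := fun p =>
  ((A.comp p).toTerm.exists_mass_bound D).choose_spec.2 _ _ (D.lattice_univ_le hh h1)
    (Eventually.of_forall fun k => D.norm_sitePt_le hh k)

theorem Observable.isBoundedOn_vol (A : Observable d) (D : Region d) :
    (A.family D).IsBoundedOn D.vol id := fun p =>
  ((A.comp p).toTerm.exists_mass_bound D).choose_spec.2 _ _ D.vol_univ_le D.ae_norm_le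

theorem Observable.eval_family_quantumField (A : Observable d) (D : Region d) {V : Interaction d}
    (hV : V.IsReal) {h : ℝ} (hh : 0 < h) (t : ℝ) :
    (A.family D).eval (latticeMeasure h (sites h D.carrier)) (sitePt h)
        (quantumField N h V D.carrier t) =
      quantumEvolution N h V D.carrier t (A.quantum N h D.carrier) := by
  have h1 : (A.family D).eval (latticeMeasure h (sites h D.carrier)) (sitePt h)
      (quantumField N h V D.carrier t) = ∑ p : Fin (A.deg + 1), (A.comp p).toTerm.eval
        (latticeMeasure h (sites h D.carrier)) (sitePt h) (quantumField N h V D.carrier t) :=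
    tsum_fintype _
  rw [h1, Observable.quantum, ← quantumEvolutionCLM_apply, map_sum]
  refine Finset.sum_congr rfl fun p _ => ?_
  rw [eval_quantumField hV hh, Smearing.eval_toTerm_quantum _ hh, quantumEvolutionCLM_apply]

theorem Observable.eval_family_classical (A : Observable d) (D : Region d) (M : Phase D.carrier) :
    (A.family D).eval D.vol id (retractLadder (M : SpinField D.carrier)) =
      A.classical D.carrier M := by
  have h1 : (A.family D).eval D.vol id (retractLadder (M : SpinField D.carrier)) =
      ∑ p : Fin (A.deg + 1), (A.comp p).toTerm.eval D.vol id
        (retractLadder (M : SpinField D.carrier)) := tsum_fintype _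
  rw [h1]
  exact Finset.sum_congr rfl fun p _ => Smearing.eval_toTerm_classical _ D M

theorem norm_tsum_sub_sum_le {α B : Type*} [NormedAddCommGroup B] [CompleteSpace B] {f : α → B}
    {g : α → ℝ} (hg : Summable g) (h : ∀ a, ‖f a‖ ≤ g a) (s : Finset α) :
    ‖∑' a, f a - ∑ a ∈ s, f a‖ ≤ ∑' a, g a - ∑ a ∈ s, g a := by
  have hf : Summable f := Summable.of_norm_bounded hg h
  rw [← hf.sum_add_tsum_compl (s := s), ← hg.sum_add_tsum_compl (s := s), add_sub_cancel_left,
    add_sub_cancel_left]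
  exact tsum_of_norm_bounded (hg.subtype _).hasSum fun a => h a

theorem isApprox_family (hd : 0 < d) (hN : 0 < N) {h₀ : ℝ} (h₀1 : h₀ ≤ 1) (D : Region d)
    {F : Family d} (hF : F.weight (1 / 2) < ⊤)
    (hb : ∀ h, 0 < h → h < h₀ →
      F.IsBoundedOn (latticeMeasure h (sites h D.carrier)) (sitePt h))
    (hb' : F.IsBoundedOn D.vol id) :
    IsApprox N h₀ D (fun h => F.eval (latticeMeasure h (sites h D.carrier)) (sitePt h)
        (quantumSpin N (sites h D.carrier)))
      (fun M => F.eval D.vol id (retractLadder (M : SpinField D.carrier))) := by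
  refine IsApprox.of_close fun ε hε => ?_
  have hs := Family.summable_valueBound hF
  obtain ⟨s, hs'⟩ := ((tendsto_order.mp hs.hasSum).1 (∑' ω, F.valueBound ω - ε)
    (by linarith)).exists
  refine ⟨_, _, IsApprox.sum s fun ω _ => isApprox_term hd hN h₀1 D (F.term ω),
    fun h hh hh0 => ?_, fun M => ?_⟩
  · refine (norm_tsum_sub_sum_le hs (Family.norm_eval_term_le hF (hb h hh hh0)
      fun i => Eventually.of_forall fun k => norm_quantumSpin_le hN i k) s).trans ?_
    linarith
  · refine (norm_tsum_sub_sum_le hs (Family.norm_eval_term_le hF hb'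
      fun i => Eventually.of_forall fun k => (norm_retractLadder_le _ i k).trans
        (Real.one_le_sqrt.mpr one_le_two)) s).trans ?_
    linarith

end Family

/-! ## Approximation of evolved observables -/

section Evolution

variable {d N : ℕ} {V : Interaction d}

theorem IsSolution.shift {Λ : Set (Pt d)} {M : ℝ → Phase Λ} (h : IsSolution V Λ M) (r : ℝ) :
    IsSolution V Λ fun t => M (t + r) := by
  refine ⟨h.1.comp (contDiff_id.add contDiff_const), fun t => ?_⟩
  have h1 : deriv (fun t => (M (t + r) : SpinField Λ)) t =
      deriv (fun t => (M t : SpinField Λ)) (t + r) :=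
    deriv_comp_add_const (fun t => (M t : SpinField Λ)) r t
  rw [h1]
  exact h.2 (t + r)

theorem IsHamiltonianFlow.add {Λ : Set (Pt d)} {φ : ℝ → Phase Λ → Phase Λ}
    (h : IsHamiltonianFlow V Λ φ) (t r : ℝ) (M : Phase Λ) : φ (t + r) M = φ t (φ r M) := by
  have h1 := (h (φ r M)).2.2 (fun t => φ (t + r) M) ((h M).2.1.shift r) (by rw [zero_add])
  exact congrFun h1 t

theorem quantumField_zero (h : ℝ) (Λ : Set (Pt d)) :
    quantumField N h V Λ 0 = quantumSpin N (sites h Λ) := by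
  ext1 i
  ext1 k
  simp [quantumField, quantumEvolution, propagator_zero]

variable (hd : 0 < d) (hN : 0 < N) (hVr : V.IsReal) {h₀ K : ℝ} (h₀0 : 0 < h₀) (h₀1 : h₀ ≤ 1)
  (hK : 0 ≤ K) (hVK : ∀ h, 0 < h → h < h₀ → V.normAt h ≤ ENNReal.ofReal K) (D : Region d)
include hd hN hVr h₀0 h₀1 hK hVK

theorem pointMass_vol_le (m : ℕ) (x : Pt d) :
    pointMass V m D.vol id x ≤ ENNReal.ofReal (massBound K m) :=
  pointMass_restrict_le V m h₀0 (fun h hh hh0 => normSup1_le_massBound (hVK h hh hh0) m) _ x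

theorem isApprox_quantumEvolution_observable {φ : ℝ → Phase D.carrier → Phase D.carrier}
    (hφ : IsHamiltonianFlow V D.carrier φ) (A : Observable d) {t : ℝ}
    (ht : 20 * K * Real.exp 1 * |t| ≤ 1 / 2) :
    IsApprox N h₀ D (fun h => quantumEvolution N h V D.carrier t (A.quantum N h D.carrier))
      (fun M => A.classical D.carrier (φ t M)) := by
  have hV := pointMass_vol_le hd hN hVr h₀0 h₀1 hK hVK D
  refine IsApprox.of_close fun ε hε => ?_
  set W := ((A.family D).weight (3 / 4)).toReal with hW
  have hw := A.weight_family_lt_top D (3 / 4)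
  obtain ⟨n, hn⟩ : ∃ n : ℕ, (1 / 2 : ℝ) ^ n * W ≤ ε := by
    have h1 : Tendsto (fun n : ℕ => (1 / 2 : ℝ) ^ n * W) atTop (𝓝 (0 * W)) :=
      (tendsto_pow_atTop_nhds_zero_of_lt_one (by norm_num) (by norm_num)).mul_const W
    rw [zero_mul] at h1
    exact ((tendsto_order.mp h1).2 ε hε).exists.imp fun _ => le_of_lt
  have hrem : (20 * K * Real.exp 1 * |t|) ^ n * W ≤ ε := by
    refine le_trans ?_ hn
    have : 0 ≤ W := ENNReal.toReal_nonneg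
    gcongr
  have hterm : ∀ j ∈ Finset.range n, IsApprox N h₀ D
      (fun h => ((t ^ j / (j.factorial : ℝ) : ℝ) : ℂ) • ((A.family D).iterDeriv V K j).eval
        (latticeMeasure h (sites h D.carrier)) (sitePt h) (quantumSpin N (sites h D.carrier)))
      (fun M => ((t ^ j / (j.factorial : ℝ) : ℝ) : ℂ) * ((A.family D).iterDeriv V K j).eval D.vol id
        (retractLadder (M : SpinField D.carrier))) := by
    intro j _
    refine (isApprox_family hd hN h₀1 D ?_ (fun h hh hh0 => ?_) ?_).smul _
    · exact (Family.weight_iterDeriv_le V hK _ j).trans_lt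
        (ENNReal.mul_lt_top ENNReal.ofReal_lt_top hw)
    · have hS := spinFlow_quantumField hN hVr hh hK (hVK h hh hh0) D.carrier
      exact (A.isBoundedOn_lattice D hh (hh0.le.trans h₀1)).iterDeriv hS.measurable_pos hS.mass_le j
    · exact (A.isBoundedOn_vol D).iterDeriv measurable_id
        (fun m => Eventually.of_forall fun y => hV m y) j
  refine ⟨_, _, IsApprox.sum (Finset.range n) hterm, fun h hh hh0 => ?_, fun M => ?_⟩
  · have hS := spinFlow_quantumField hN hVr hh hK (hVK h hh hh0) D.carrier
    have h1 := Family.norm_eval_sub_taylor_le hS hK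
      (A.isBoundedOn_lattice D hh (hh0.le.trans h₀1)) hw n t
    rw [A.eval_family_quantumField D hVr hh, quantumField_zero] at h1
    simp only [← Complex.coe_smul] at h1
    exact h1.trans hrem
  · have hS := spinFlow_classical hK hV hVr (hφ M).2.1
    have h1 := Family.norm_eval_sub_taylor_le hS hK (A.isBoundedOn_vol D) hw n t
    rw [A.eval_family_classical D, (hφ M).1] at h1
    simp only [← Complex.coe_smul, smul_eq_mul] at h1
    exact h1.trans hrem

theorem IsApprox.evolve {φ : ℝ → Phase D.carrier → Phase D.carrier}
    (hφ : IsHamiltonianFlow V D.carrier φ) {q : ∀ h : ℝ, Op N (sites h D.carrier)}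
    {c : Phase D.carrier → ℂ} (H : IsApprox N h₀ D q c) {t : ℝ}
    (ht : 20 * K * Real.exp 1 * |t| ≤ 1 / 2) :
    IsApprox N h₀ D (fun h => quantumEvolution N h V D.carrier t (q h)) (fun M => c (φ t M)) := by
  refine IsApprox.of_close fun ε hε => ?_
  obtain ⟨B, hB, hB'⟩ := H ε hε
  refine ⟨_, _, isApprox_quantumEvolution_observable hd hN hVr h₀0 h₀1 hK hVK D hφ B ht,
    fun h hh hh0 => ?_, fun M => hB' _⟩
  rw [← quantumEvolution_sub]
  exact (norm_quantumEvolution_le hVr h D.carrier t _).trans (hB h hh hh0)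

/-- The classical and the quantum evolution of an observable are simultaneously approximated by
observables, for all times: for short times by the Taylor expansion, whose terms converge
uniformly in `h` and on phase space, and then by the group law. -/
theorem isApprox_evolution {φ : ℝ → Phase D.carrier → Phase D.carrier}
    (hφ : IsHamiltonianFlow V D.carrier φ) (A : Observable d) (t : ℝ) :
    IsApprox N h₀ D (fun h => quantumEvolution N h V D.carrier t (A.quantum N h D.carrier))
      (fun M => A.classical D.carrier (φ t M)) := by
  have hstep : ∀ (r : ℝ), 20 * K * Real.exp 1 * |r| ≤ 1 / 2 → ∀ n : ℕ, IsApprox N h₀ D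
      (fun h => quantumEvolution N h V D.carrier (n * r) (A.quantum N h D.carrier))
      (fun M => A.classical D.carrier (φ (n * r) M)) := by
    intro r hr n
    induction n with
    | zero =>
      refine isApprox_quantumEvolution_observable hd hN hVr h₀0 h₀1 hK hVK D hφ A ?_
      simp
    | succ n ih =>
      refine (ih.evolve hd hN hVr h₀0 h₀1 hK hVK D hφ hr).congr (fun h _ _ => ?_) fun M => ?_
      · rw [← quantumEvolution_add_time hVr]
        congr 1
        push_cast
        ring
      · rw [← hφ.add]
        congr 2
        push_cast
        ring
  obtain ⟨n, hn⟩ := exists_nat_ge (2 * (20 * K * Real.exp 1 * |t|))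
  have hn1 : (0 : ℝ) < (n + 1 : ℕ) := by positivity
  have h1 := hstep (t / (n + 1 : ℕ)) (by
    rw [abs_div, abs_of_pos hn1, ← mul_div_assoc, div_le_iff₀ hn1]
    push_cast
    linarith) (n + 1)
  rwa [mul_div_cancel₀ _ hn1.ne'] at h1

end Evolution

theorem Interaction.IsBounded.exists_bound {d : ℕ} {V : Interaction d} (hV : V.IsBounded) :
    ∃ h₀ K : ℝ, 0 < h₀ ∧ h₀ ≤ 1 ∧ 0 ≤ K ∧
      ∀ h, 0 < h → h < h₀ → V.normAt h ≤ ENNReal.ofReal K := by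
  obtain ⟨C, hC, hC'⟩ := exists_between hV
  obtain ⟨h₁, hh₁, h1⟩ := mem_nhdsGT_iff_exists_Ioo_subset.mp (eventually_lt_of_limsup_lt hC)
  refine ⟨min h₁ 1, C.toReal, lt_min hh₁ one_pos, min_le_right _ _, ENNReal.toReal_nonneg,
    fun h hh hh0 => ?_⟩
  rw [ENNReal.ofReal_toReal hC'.ne]
  exact (h1 ⟨hh, hh0.trans_le (min_le_left _ _)⟩ : V.normAt h < C).le

end SpinEgorov

end

theorem mainTheorem4
    -- dimension `d ≥ 1`, spin `s = N/2 > 0`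
    (d : ℕ) (hd : 0 < d) (N : ℕ) (hN : 0 < N)
    (V : SpinEgorov.Interaction d) (hVreal : V.IsReal) (hVbdd : V.IsBounded) :
    ∃ h₀ : ℝ, 0 < h₀ ∧
      -- the series defining the quantum Hamiltonian converges
      (∀ Λ : Set (SpinEgorov.Pt d), IsOpen Λ → Bornology.IsBounded Λ →
        ∀ h : ℝ, 0 < h → h < h₀ →
          Summable fun m : ℕ => SpinEgorov.quantumMonomial N h Λ (V m)) ∧
      ∀ (A : SpinEgorov.Observable d) (ε : ℝ), 0 < ε →
        ∃ C : ℝ → ℝ, ∀ Λ : Set (SpinEgorov.Pt d), IsOpen Λ → Bornology.IsBounded Λ →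
          ∃ φ : ℝ → SpinEgorov.Phase Λ → SpinEgorov.Phase Λ,
            SpinEgorov.IsHamiltonianFlow V Λ φ ∧
            ∃ At : ℝ → SpinEgorov.Observable d,
              (∀ (t : ℝ) (M : SpinEgorov.Phase Λ),
                ‖A.classical Λ (φ t M) - (At t).classical Λ M‖ ≤ ε) ∧
              ∀ t h : ℝ, 0 < h → h < h₀ →
                ‖SpinEgorov.quantumEvolution N h V Λ t (A.quantum N h Λ) -
                    (At t).quantum N h Λ‖ ≤ ε + C t * h ^ d := by
  open SpinEgorov in
  obtain ⟨h₀, K, h₀0, h₀1, hK, hVK⟩ := hVbdd.exists_bound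
  refine ⟨h₀, h₀0, fun Λ _ _ h hh hh0 => summable_quantumMonomial hN hh hK (hVK h hh hh0) Λ,
    fun A ε hε => ⟨fun _ => 0, fun Λ hΛ hΛ' => ?_⟩⟩
  obtain ⟨D, rfl⟩ := exists_region hΛ hΛ'
  obtain ⟨φ, hφ⟩ := exists_isHamiltonianFlow hK
    (pointMass_vol_le hd hN hVreal h₀0 h₀1 hK hVK D) hVreal
  choose At hAt hAt' using fun t =>
    isApprox_evolution hd hN hVreal h₀0 h₀1 hK hVK D hφ A t ε hε
  refine ⟨φ, hφ, At, hAt', fun t h hh hh0 => ?_⟩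
  rw [zero_mul, add_zero]
  exact hAt t h hh hh0
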